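/- **Setting.** Let $V$ be a vector space of finite dimension $n$ over a division ring and let $k$ be an integer with $1<k<n-1$. The Grassmann space has as points the $k$-dimensional subspaces of $V$, and as lines the sets $\{U : H\subseteq U\subseteq B,\ \dim U=k\}$ with $\dim H=k-1$, $\dim B=k+1$, $H\subseteq B$. Let $W$ be a subspace of $V$ and let $m\ge 0$ be an integer with $k-(n-\dim W)\le m\le \min(k,\dim W)$. The *spine space* $\mathfrak M$ has as points (the *proper points*) all $k$-dimensional $U$ with $\dim(U\cap W)=m$; its set $\mathcal L$ of lines consists of the sets of proper points on a line of the Grassmann space that contain at least two points. In a point-line space a *subspace* is a set of points that contains every line having two points in it; it is *strong* if any two of its points are collinear, and a *plane* of the Grassmann space is a strong subspace on which the induced geometry is a projective plane. The *closure* $\overline X$ is the smallest subspace of the Grassmann space containing $X$; a *plane of $\mathfrak M$* is a subspace $E$ of $\mathfrak M$ such that $\overline E$ is a plane of the Grassmann space. For $L_1,L_2\in\mathcal L$ write $L_1\mathrel{\pi}L_2$ if there is a plane $E$ of $\mathfrak M$ with $L_1,L_2\subseteq E$, and $L_1\mathrel{\rho}L_2$ if there are a plane $E$ of $\mathfrak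 M$ and a proper point $U\in\overline E$ such that $L_1,L_2$ both belong to the pencil $\{L\in\mathcal L : U\in\overline L\subseteq\overline E\}$. For a relation $\delta$ on $\mathcal L$, the spine space $\mathfrak M$, regarded as the two-sorted incidence structure of its points and lines, and $\langle\mathcal L,\delta\rangle$ are *definitionally equivalent* if, with all definitions first-order and without parameters: (a) $\delta$ is definable in $\mathfrak M$; and (b) for some $t\ge 0$ there is a surjection $f$ from a set $D\subseteq\mathcal L^t$ onto the set of points of $\mathfrak M$ such that $D$, the relation $f(x)=f(y)$ on $D$ and the relation $f(x)\in L$ (for $x\in D$, $L\in\mathcal L$) are definable in $\langle\mathcal L,\delta\rangle$, while the relation $f(x)=U$ (for $x\in D$, $U$ a point) is definable in $\mathfrak M$. **Theorem.** Suppose that $$4\le n-k\ \text{ and }\ \dim W\ne m+1,\qquad\text{or}\qquad 4\le k-m\ \text{ and }\ k\ne m+1.$$ Then, for each $\delta\in\{\pi,\rho\}$, the spine space $\mathfrak M$ and the structure $\langle\mathcal L,\delta\rangle$ of its lines are definitionally equivalent. -/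

import Mathlib

/-! ## Point-line spaces and their fragments

A point-line space on a type `S` of points is given by its set `ℒ : Set (Set S)` of lines. A fragment
is given by the set `P : Set S` of its proper points. -/

namespace SpineSpace

section PointLine

variable {S : Type*}

/-- `X` is a subspace: a line having two points in `X` is contained in `X`. -/
def IsSubspace (ℒ : Set (Set S)) (X : Set S) : Prop :=
  ∀ l ∈ ℒ, (l ∩ X).Nontrivial → l ⊆ X

/-- A strong subspace: a subspace any two points of which are collinear. -/
def IsStrong (ℒ : Set (Set S)) (X : Set S) : Prop :=
  IsSubspace ℒ X ∧ ∀ a ∈ X, ∀ b ∈ X, a ≠ b → ∃ l ∈ ℒ, a ∈ l ∧ b ∈ l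

/-- The points of `E` and the lines in `𝓔` form a projective plane: two points are on exactly one
line, two lines have exactly one common point, and there is a quadrangle. -/
def IsProjectivePlane (E : Set S) (𝓔 : Set (Set S)) : Prop :=
  (∀ a ∈ E, ∀ b ∈ E, a ≠ b → ∃! l, l ∈ 𝓔 ∧ a ∈ l ∧ b ∈ l) ∧
  (∀ l ∈ 𝓔, ∀ l' ∈ 𝓔, l ≠ l' → ∃! p, p ∈ E ∧ p ∈ l ∧ p ∈ l') ∧
  ∃ q : Fin 4 → S, Function.Injective q ∧ (∀ i, q i ∈ E) ∧
    ∀ l ∈ 𝓔, ∀ i j h : Fin 4, i ≠ j → j ≠ h → i ≠ h → ¬ (q i ∈ l ∧ q j ∈ l ∧ q h ∈ l)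

/-- A plane: a strong subspace `E` such that the restriction of the space to `E` is a projective
plane. -/
def IsPlane (ℒ : Set (Set S)) (E : Set S) : Prop :=
  IsStrong ℒ E ∧ IsProjectivePlane E {l | l ∈ ℒ ∧ l ⊆ E}

/-- The closure of `X`: the smallest subspace containing `X`. For a line `L` of a fragment
of a partial linear space this is the unique line of the whole space that contains `L`. -/
def cl (ℒ : Set (Set S)) (X : Set S) : Set S :=
  ⋂₀ {Y | IsSubspace ℒ Y ∧ X ⊆ Y}

/-- The lines of the fragment with the set `P` of proper points: the sets `l ∩ P` that have
at least two points, where `l` is a line. -/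
def fragLines (ℒ : Set (Set S)) (P : Set S) : Set (Set S) :=
  {L | ∃ l ∈ ℒ, L = l ∩ P ∧ L.Nontrivial}

/-- A plane of the fragment: a subspace of the fragment whose closure is a plane. -/
def IsFragPlane (ℒ : Set (Set S)) (P : Set S) (E : Set S) : Prop :=
  E ⊆ P ∧ IsSubspace (fragLines ℒ P) E ∧ IsPlane ℒ (cl ℒ E)

/-- The set of all lines `L` of the fragment with `U ∈ cl L ⊆ cl E`. -/
def pencil (ℒ : Set (Set S)) (P : Set S) (U : S) (E : Set S) : Set (Set S) :=
  {L | L ∈ fragLines ℒ P ∧ U ∈ cl ℒ L ∧ cl ℒ L ⊆ cl ℒ E}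

/-- A pencil of lines of the fragment: its vertex `U` is a proper point on the closure of its base
plane `E`. -/
def IsPencil (ℒ : Set (Set S)) (P : Set S) (p : Set (Set S)) : Prop :=
  ∃ U E, IsFragPlane ℒ P E ∧ U ∈ P ∧ U ∈ cl ℒ E ∧ p = pencil ℒ P U E

/-- The relation `π`: two lines of the fragment are coplanar. -/
def Coplanar (ℒ : Set (Set S)) (P : Set S) (L₁ L₂ : fragLines ℒ P) : Prop :=
  ∃ E, IsFragPlane ℒ P E ∧ (L₁ : Set S) ⊆ E ∧ (L₂ : Set S) ⊆ E

/-- The relation `ρ`: two lines of the fragment are in a common pencil of lines. -/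
def Copencil (ℒ : Set (Set S)) (P : Set S) (L₁ L₂ : fragLines ℒ P) : Prop :=
  ∃ p, IsPencil ℒ P p ∧ (L₁ : Set S) ∈ p ∧ (L₂ : Set S) ∈ p

end PointLine

/-! ## Grassmann spaces and spine spaces -/

section Grassmann

variable (K V : Type*) [DivisionRing K] [AddCommGroup V] [Module K V]

/-- The points of the Grassmann space: the `k`-dimensional subspaces of `V`. -/
abbrev Grass (k : ℕ) : Type _ := {U : Submodule K V // Module.finrank K U = k}

/-- The lines of the Grassmann space: the `k`-pencils `{U | H ≤ U ≤ B}` with `dim H = k - 1`,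
`dim B = k + 1` and `H ≤ B`. -/
def grassLines (k : ℕ) : Set (Set (Grass K V k)) :=
  {l | ∃ H B : Submodule K V, Module.finrank K H + 1 = k ∧ Module.finrank K B = k + 1 ∧
    H ≤ B ∧ l = {U | H ≤ U.1 ∧ U.1 ≤ B}}

variable {K V}

/-- The points of the spine space: the `k`-dimensional `U` with `dim (U ∩ W) = m`. -/
def spinePoints (k m : ℕ) (W : Submodule K V) : Set (Grass K V k) :=
  {U | Module.finrank K (U.1 ⊓ W : Submodule K V) = m}

/-- The lines of the spine space. -/
abbrev spineLines (k m : ℕ) (W : Submodule K V) : Set (Set (Grass K V k)) :=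
  fragLines (grassLines K V k) (spinePoints k m W)

/-- Incidence in the spine space. -/
def spineInc (k m : ℕ) (W : Submodule K V) (U : spinePoints k m W) (L : spineLines k m W) : Prop :=
  (U : Grass K V k) ∈ (L : Set (Grass K V k))

/-- Coplanarity `π` of lines of the spine space. -/
def spinePi (k m : ℕ) (W : Submodule K V) : spineLines k m W → spineLines k m W → Prop :=
  Coplanar (grassLines K V k) (spinePoints k m W)

/-- The relation `ρ` on lines of the spine space: being in a common pencil of lines. -/
def spineRho (k m : ℕ) (W : Submodule K V) : spineLines k m W → spineLines k m W → Prop :=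
  Copencil (grassLines K V k) (spinePoints k m W)

end Grassmann

/-! ## Definitional equivalence -/

section Definability

open FirstOrder

/-- The relation symbols for point-line structures: a predicate for being a point and incidence. -/
inductive IncRel : ℕ → Type
  | isPoint : IncRel 1
  | inc : IncRel 2

/-- The first-order language of point-line structures. -/
def incLanguage : Language := ⟨fun _ => Empty, IncRel⟩

/-- The symbol of one binary relation. -/
inductive BinRel : ℕ → Type
  | rel : BinRel 2

/-- The first-order language of one binary relation. -/
def binLanguage : Language := ⟨fun _ => Empty, BinRel⟩

variable {S L : Type*}

/-- The point-line structure with points `S`, lines `L` and incidence `inc`, as a first-order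
structure on the disjoint union of the points and the lines. -/
abbrev incStructure (inc : S → L → Prop) : incLanguage.Structure (S ⊕ L) where
  funMap := fun f => f.elim
  RelMap := fun r => match r with
    | IncRel.isPoint => fun x => ∃ p, x 0 = Sum.inl p
    | IncRel.inc => fun x => ∃ p l, x 0 = Sum.inl p ∧ x 1 = Sum.inr l ∧ inc p l

/-- The structure `⟨L, δ⟩`. -/
abbrev binStructure (δ : L → L → Prop) : binLanguage.Structure L where
  funMap := fun f => f.elim
  RelMap := fun r => match r with
    | BinRel.rel => fun x => δ (x 0) (x 1)

/-- `s` is first-order definable without parameters in the given structure. -/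
def DefinableIn {𝓛 : Language} {M : Type*} (str : 𝓛.Structure M) {α : Type} (s : Set (α → M)) :
    Prop :=
  letI := str
  (∅ : Set M).Definable 𝓛 s

/-- The point-line structure `⟨S, L, inc⟩` and the structure `⟨L, δ⟩` of its lines are definitionally
equivalent (all definitions are first-order and without parameters):

* `δ` is definable in `⟨S, L, inc⟩`;
* the points and the incidence are definable in `⟨L, δ⟩`: there is a surjection `f` from a set `D` of
  `t`-tuples of lines onto the points such that `D`, the equivalence `f x = f y` on `D`
  and the relation `inc (f x) l` between `x ∈ D` and lines `l` are definable in `⟨L, δ⟩`;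
* the two translations are inverse to each other: lines are represented by themselves, and the
  relation `f x = p` between tuples `x ∈ D` of lines and points `p` is definable in `⟨S, L, inc⟩`. -/
def DefinitionallyEquivalent (inc : S → L → Prop) (δ : L → L → Prop) : Prop :=
  DefinableIn (incStructure inc)
    {z : Fin 2 → S ⊕ L | ∃ a b, z 0 = Sum.inr a ∧ z 1 = Sum.inr b ∧ δ a b} ∧
  ∃ (t : ℕ) (D : Set (Fin t → L)) (f : D → S), Function.Surjective f ∧
    DefinableIn (binStructure δ) D ∧
    DefinableIn (binStructure δ)
      {z : Fin t ⊕ Fin t → L | ∃ x y : D,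
        (∀ i, z (Sum.inl i) = x.1 i) ∧ (∀ i, z (Sum.inr i) = y.1 i) ∧ f x = f y} ∧
    DefinableIn (binStructure δ)
      {z : Fin t ⊕ Unit → L | ∃ x : D,
        (∀ i, z (Sum.inl i) = x.1 i) ∧ inc (f x) (z (Sum.inr ()))} ∧
    DefinableIn (incStructure inc)
      {z : Fin t ⊕ Unit → S ⊕ L | ∃ x : D,
        (∀ i, z (Sum.inl i) = Sum.inr (x.1 i)) ∧ z (Sum.inr ()) = Sum.inl (f x)}

end Definability

end SpineSpace

/-!
A line of the spine space extends to a line `{U | H ≤ U ≤ B}` of the Grassmann space, so the lines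
are flags `H ≤ B` of subspaces of dimensions `k - 1` and `k + 1`. Two distinct lines are adjacent,
for `π` as well as for `ρ`, if and only if they have the same `H` (they are in a common star) or the
same `B` (they are in a common top), and their closures share a point, which for `ρ` has to be proper
(`exists_pointGeom_lineGeom`). All that is used of the subspaces of `V` is that they form a modular
lattice with a rank function as in `IsProjRank`. These axioms are self-dual, so every argument about
stars also serves for tops.

Points from lines. Two neighbours `a`, `c` of a line `l` are on different sides of `l`, the one in a
common star and the other in a common top with `l`, if and only if they cannot be joined within
the neighbours of `l` in at most two steps (`LineGeom.opp_iff`). Hence the relation `Sq` is definable,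
which describes the quadrangles of lines `(H, B), (H, B'), (H', B'), (H', B)`. The four lines of such
a square share the point `U = H ⊔ H' = B ⊓ B'` (`LineGeom.exists_on_of_sq`), and the square encodes it.
If `m + 2 ≤ k`, then every proper point is encoded, since it has many hyperplanes `H` with
`dim (H ∩ W) = m`. The lines through `U` are reached from the square by passing, at most three
times, from two consecutive lines of a square to the other two; if `dim W ≤ m + 1`, the lines with
`dim (H ∩ W) = m - 1` are in no square and are recognised by their neighbours through `U`
(`LineGeom.sqInc_of_on`, `LineGeom.on_of_sqInc`). For `π`, squares may encode improper points as well.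
An improper point has another improper point in a common top, and the two are not joined by a line,
whereas a proper point is joined to every encoded point in a common star or top; this separates the
two kinds (`LineGeom.bad_of_not_proper`, `LineGeom.not_bad_of_proper`). So quadruples of lines
encode the points if `m + 2 ≤ k`, and by duality if `m + 2 ≤ dim W`.

Under the numerical assumptions there remain two cases, both with `dim W = m`. If `k = m + 1`, then
the points contain `W` and form the projective space of `V / W`, of dimension at least four, where two
lines are adjacent if and only if they meet. A point is encoded by three lines through it that are not
coplanar; among the triples of pairwise meeting lines these are told from triangles by the
fact that two pencils of lines of a plane always share a line (`StarTriple`). If `k = m`, then `W` is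
the only point, and there are no lines.

Lines from points. Every point of a line is collinear with or equal to every point of another line if
and only if the lines are in a common star or top (`PointGeom.col_iff`). With this, the adjacency
of lines is definable from incidence; for `π`, an improper common point of the closures is found as
the vertex of a square of lines (`PointGeom.incDef_adj`).

Definability is treated semantically: `LineDef` and `IncDef` are the classes of predicates generated
from the basic relations by the logical operations, and `definitionallyEquivalent_of` reduces
definitional equivalence to a definable encoding of the sets of lines through a point.
-/

namespace SpineSpace

/-! ### First-order definability as closure under the logical operations -/

section Calculus

open FirstOrder

variable {S L : Type*}

/-- The predicates on tuples of lines that are first-order over `⟨L, δ⟩`, generated semantically: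
atoms, Boolean operations and quantification over a new variable, indexed by `none`. -/
inductive LineDef (δ : L → L → Prop) : ∀ {κ : Type}, ((κ → L) → Prop) → Prop
  | rel {κ : Type} (i j : κ) : LineDef δ (fun v : κ → L => δ (v i) (v j))
  | eq {κ : Type} (i j : κ) : LineDef δ (fun v : κ → L => v i = v j)
  | not {κ : Type} {P : (κ → L) → Prop} : LineDef δ P → LineDef δ (fun v => ¬ P v)
  | and {κ : Type} {P Q : (κ → L) → Prop} :
      LineDef δ P → LineDef δ Q → LineDef δ (fun v => P v ∧ Q v)
  | ex {κ : Type} {P : (κ → L) → L → Prop} :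
      LineDef δ (fun v : Option κ → L => P (fun i => v (some i)) (v none)) →
      LineDef δ (fun v => ∃ x, P v x)

/-- The predicates on tuples of points and tuples of lines that are first-order over the two-sorted
structure `⟨S, L, inc⟩`. -/
inductive IncDef (inc : S → L → Prop) :
    ∀ {ι κ : Type}, ((ι → S) → (κ → L) → Prop) → Prop
  | inc {ι κ : Type} (i : ι) (j : κ) : IncDef inc (fun (s : ι → S) (v : κ → L) => inc (s i) (v j))
  | eqPt {ι κ : Type} (i j : ι) : IncDef inc (fun (s : ι → S) (_ : κ → L) => s i = s j)
  | eqLine {ι κ : Type} (i j : κ) : IncDef inc (fun (_ : ι → S) (v : κ → L) => v i = v j)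
  | not {ι κ : Type} {P : (ι → S) → (κ → L) → Prop} :
      IncDef inc P → IncDef inc (fun s v => ¬ P s v)
  | and {ι κ : Type} {P Q : (ι → S) → (κ → L) → Prop} :
      IncDef inc P → IncDef inc Q → IncDef inc (fun s v => P s v ∧ Q s v)
  | exPt {ι κ : Type} {P : (ι → S) → (κ → L) → S → Prop} :
      IncDef inc (fun (s : Option ι → S) v => P (fun i => s (some i)) v (s none)) →
      IncDef inc (fun s v => ∃ x, P s v x)
  | exLine {ι κ : Type} {P : (ι → S) → (κ → L) → L → Prop} :
      IncDef inc (fun s (v : Option κ → L) => P s (fun i => v (some i)) (v none)) →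
      IncDef inc (fun s v => ∃ x, P s v x)

namespace LineDef

variable {δ : L → L → Prop} {κ : Type} {P Q : (κ → L) → Prop}

theorem or (hP : LineDef δ P) (hQ : LineDef δ Q) : LineDef δ (fun v => P v ∨ Q v) := by
  simpa only [not_and_or, not_not] using (hP.not.and hQ.not).not

theorem imp (hP : LineDef δ P) (hQ : LineDef δ Q) : LineDef δ (fun v => P v → Q v) := by
  simpa only [imp_iff_not_or] using hP.not.or hQ

theorem iff (hP : LineDef δ P) (hQ : LineDef δ Q) : LineDef δ (fun v => P v ↔ Q v) := by
  simpa only [iff_iff_implies_and_implies] using (hP.imp hQ).and (hQ.imp hP)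

theorem all {P : (κ → L) → L → Prop}
    (h : LineDef δ (fun v : Option κ → L => P (fun i => v (some i)) (v none))) :
    LineDef δ (fun v => ∀ x, P v x) := by
  have h' := (LineDef.ex (P := fun v x => ¬ P v x) h.not).not
  simpa only [not_exists, not_not] using h'

theorem definableIn [Finite κ] (h : LineDef δ P) :
    DefinableIn (binStructure δ) {v : κ → L | P v} := by
  revert ‹Finite κ›
  let := binStructure δ
  unfold DefinableIn
  induction h with
  | rel i j =>
    intro _
    refine Set.empty_definable_iff.2
      ⟨Language.Relations.formula₂ (L := binLanguage) BinRel.rel (.var i) (.var j), ?_⟩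
    ext v
    exact (Language.Formula.realize_rel₂ (L := binLanguage) (M := L) (R := BinRel.rel)
      (t₁ := .var i) (t₂ := .var j) (v := v)).symm
  | eq i j =>
    intro _
    refine Set.empty_definable_iff.2 ⟨(Language.Term.var i).equal (.var j), ?_⟩
    ext v
    simp
  | not _ ih => intro _; exact ih.compl
  | and _ _ ih₁ ih₂ => intro _; exact ih₁.inter ih₂
  | @ex κ P _ ih =>
    intro _
    have h := Set.Definable.image_comp ih (some : κ → Option κ)
    convert h using 1
    ext v
    constructor
    · rintro ⟨x, hx⟩
      exact ⟨fun i => i.elim x v, hx, rfl⟩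
    · rintro ⟨g, hg, rfl⟩
      exact ⟨g none, hg⟩

end LineDef

namespace IncDef

variable {inc : S → L → Prop} {ι κ : Type} {P Q : (ι → S) → (κ → L) → Prop}

theorem or (hP : IncDef inc P) (hQ : IncDef inc Q) : IncDef inc (fun s v => P s v ∨ Q s v) := by
  simpa only [not_and_or, not_not] using (hP.not.and hQ.not).not

theorem imp (hP : IncDef inc P) (hQ : IncDef inc Q) : IncDef inc (fun s v => P s v → Q s v) := by
  simpa only [imp_iff_not_or] using hP.not.or hQ

theorem iff (hP : IncDef inc P) (hQ : IncDef inc Q) : IncDef inc (fun s v => P s v ↔ Q s v) := by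
  simpa only [iff_iff_implies_and_implies] using (hP.imp hQ).and (hQ.imp hP)

theorem allPt {P : (ι → S) → (κ → L) → S → Prop}
    (h : IncDef inc (fun (s : Option ι → S) v => P (fun i => s (some i)) v (s none))) :
    IncDef inc (fun s v => ∀ x, P s v x) := by
  have h' := (IncDef.exPt (P := fun s v x => ¬ P s v x) h.not).not
  simpa only [not_exists, not_not] using h'

theorem allLine {P : (ι → S) → (κ → L) → L → Prop}
    (h : IncDef inc (fun s (v : Option κ → L) => P s (fun i => v (some i)) (v none))) :
    IncDef inc (fun s v => ∀ x, P s v x) := by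
  have h' := (IncDef.exLine (P := fun s v x => ¬ P s v x) h.not).not
  simpa only [not_exists, not_not] using h'

/-- The set of tuples over the disjoint union of points and lines given by a predicate on points and
lines. -/
def sorted (P : (ι → S) → (κ → L) → Prop) : Set (ι ⊕ κ → S ⊕ L) :=
  {z | ∃ s v, z = Sum.elim (Sum.inl ∘ s) (Sum.inr ∘ v) ∧ P s v}

theorem sum_elim_inj {s s' : ι → S} {v v' : κ → L}
    (h : (Sum.elim (Sum.inl ∘ s) (Sum.inr ∘ v) : ι ⊕ κ → S ⊕ L) =
      Sum.elim (Sum.inl ∘ s') (Sum.inr ∘ v')) : s = s' ∧ v = v' :=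
  ⟨funext fun i => Sum.inl_injective (congrFun h (.inl i)),
    funext fun j => Sum.inr_injective (congrFun h (.inr j))⟩

theorem mem_sorted {P : (ι → S) → (κ → L) → Prop} {s : ι → S} {v : κ → L} :
    (Sum.elim (Sum.inl ∘ s) (Sum.inr ∘ v) : ι ⊕ κ → S ⊕ L) ∈ sorted P ↔ P s v := by
  constructor
  · rintro ⟨s', v', h, hP⟩
    obtain ⟨rfl, rfl⟩ := sum_elim_inj h
    exact hP
  · exact fun h => ⟨s, v, rfl, h⟩

theorem sort_definable (inc : S → L → Prop) [Finite ι] [Finite κ] :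
    DefinableIn (incStructure inc) (sorted fun (_ : ι → S) (_ : κ → L) => True) := by
  let := incStructure inc
  unfold DefinableIn
  have hp : ∀ i : ι ⊕ κ, (∅ : Set (S ⊕ L)).Definable incLanguage
      {z : ι ⊕ κ → S ⊕ L | ∃ p, z i = Sum.inl p} := fun i => by
    refine Set.empty_definable_iff.2
      ⟨Language.Relations.formula₁ (L := incLanguage) IncRel.isPoint (.var i), ?_⟩
    ext v
    exact (Language.Formula.realize_rel₁ (L := incLanguage) (M := S ⊕ L)
      (R := IncRel.isPoint) (t := .var i) (v := v)).symm
  have := (Set.definable_iInter_of_finite fun i : ι => hp (.inl i)).inter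
    (Set.definable_iInter_of_finite fun j : κ => (hp (.inr j)).compl)
  convert this using 1
  ext z
  simp only [sorted, Set.mem_inter_iff, Set.mem_iInter, Set.mem_compl_iff, Set.mem_ofPred_eq,
    and_true]
  constructor
  · rintro ⟨s, v, rfl⟩
    simp
  · rintro ⟨h₁, h₂⟩
    choose s hs using h₁
    have h₃ : ∀ j, ∃ l, z (.inr j) = Sum.inr l := fun j => by
      rcases h : z (.inr j) with p | l
      · exact absurd ⟨p, h⟩ (h₂ j)
      · exact ⟨l, rfl⟩
    choose v hv using h₃
    exact ⟨s, v, funext fun i => by cases i <;> simp [hs, hv]⟩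

theorem definableIn_sorted [Finite ι] [Finite κ] (h : IncDef inc P) :
    DefinableIn (incStructure inc) (sorted P) := by
  revert ‹Finite ι› ‹Finite κ›
  let := incStructure inc
  have aux : ∀ {ι κ : Type} [Finite ι] [Finite κ] {P : (ι → S) → (κ → L) → Prop}
      {X : Set (ι ⊕ κ → S ⊕ L)}, (∅ : Set (S ⊕ L)).Definable incLanguage X →
      (∀ s v, (Sum.elim (Sum.inl ∘ s) (Sum.inr ∘ v) : ι ⊕ κ → S ⊕ L) ∈ X ↔ P s v) →
      (∅ : Set (S ⊕ L)).Definable incLanguage (sorted P) := by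
    intro ι κ _ _ P X hX hP
    have hs : (∅ : Set (S ⊕ L)).Definable incLanguage
      (sorted fun (_ : ι → S) (_ : κ → L) => True) := sort_definable inc
    convert hX.inter hs using 1
    ext z
    constructor
    · rintro ⟨s, v, rfl, h⟩
      exact ⟨(hP s v).2 h, s, v, rfl, trivial⟩
    · rintro ⟨h, s, v, rfl, -⟩
      exact ⟨s, v, rfl, (hP s v).1 h⟩
  unfold DefinableIn
  induction h with
  | inc i j =>
    intro _ _
    refine aux (Set.empty_definable_iff.2
      ⟨Language.Relations.formula₂ (L := incLanguage) IncRel.inc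
        (.var (.inl i)) (.var (.inr j)), rfl⟩) fun s v => ?_
    refine (Language.Formula.realize_rel₂ (L := incLanguage) (R := IncRel.inc)).trans ?_
    constructor
    · rintro ⟨p, l, hp, hl, h⟩
      obtain rfl := Sum.inl_injective hp
      obtain rfl := Sum.inr_injective hl
      exact h
    · exact fun h => ⟨_, _, rfl, rfl, h⟩
  | eqPt i j =>
    intro _ _
    refine aux (Set.empty_definable_iff.2
      ⟨(Language.Term.var (.inl i)).equal (.var (.inl j)), rfl⟩) fun s v => ?_
    simp
  | eqLine i j =>
    intro _ _
    refine aux (Set.empty_definable_iff.2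
      ⟨(Language.Term.var (.inr i)).equal (.var (.inr j)), rfl⟩) fun s v => ?_
    simp
  | not _ ih => intro _ _; exact aux ih.compl fun s v => by simp [mem_sorted]
  | and _ _ ih₁ ih₂ => intro _ _; exact aux (ih₁.inter ih₂) fun s v => by simp [mem_sorted]
  | @exPt ι κ P _ ih =>
    intro _ _
    refine aux (Set.Definable.image_comp ih (Sum.map (some : ι → Option ι) (id : κ → κ)))
      fun s v => ?_
    constructor
    · rintro ⟨g, ⟨s', v', rfl, h⟩, hg⟩
      replace hg := (Sum.elim_comp_map ..).symm.trans hg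
      obtain ⟨rfl, rfl⟩ := sum_elim_inj (s := s' ∘ some) (v := v') hg
      exact ⟨_, h⟩
    · rintro ⟨x, hx⟩
      refine ⟨_, ⟨fun i => i.elim x s, v, rfl, hx⟩, ?_⟩
      ext i
      cases i <;> rfl
  | @exLine ι κ P _ ih =>
    intro _ _
    refine aux (Set.Definable.image_comp ih (Sum.map (id : ι → ι) (some : κ → Option κ)))
      fun s v => ?_
    constructor
    · rintro ⟨g, ⟨s', v', rfl, h⟩, hg⟩
      replace hg := (Sum.elim_comp_map ..).symm.trans hg
      obtain ⟨rfl, rfl⟩ := sum_elim_inj (s := s') (v := v' ∘ some) hg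
      exact ⟨_, h⟩
    · rintro ⟨x, hx⟩
      refine ⟨_, ⟨s, fun i => i.elim x v, rfl, hx⟩, ?_⟩
      ext i
      cases i <;> rfl

/-- If `δ` is definable in the point-line structure, then so is everything definable from `δ`. -/
theorem of_lineDef {δ : L → L → Prop} {P : (κ → L) → Prop}
    (hδ : ∀ {κ : Type} (i j : κ), IncDef inc (fun (_ : ι → S) (v : κ → L) => δ (v i) (v j)))
    (h : LineDef δ P) : IncDef inc (fun (_ : ι → S) (v : κ → L) => P v) := by
  induction h with
  | rel i j => exact hδ i j
  | eq i j => exact .eqLine i j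
  | not _ ih => exact ih.not
  | and _ _ ih₁ ih₂ => exact ih₁.and ih₂
  | ex _ ih => exact .exLine ih

end IncDef

/-- A criterion for definitional equivalence: a definable family of sets of lines, indexed by the
tuples with `D`, whose members are exactly the sets of lines through the individual points. -/
theorem definitionallyEquivalent_of {inc : S → L → Prop} {δ : L → L → Prop} (t : ℕ)
    (D : (Fin t → L) → Prop) (I : (Fin t → L) → L → Prop)
    (hδ : ∀ {ι κ : Type} (i j : κ), IncDef inc (fun (_ : ι → S) (v : κ → L) => δ (v i) (v j)))
    (hD : ∀ {κ : Type} (g : Fin t → κ), LineDef δ (fun v : κ → L => D (fun i => v (g i))))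
    (hI : ∀ {κ : Type} (g : Fin t → κ) (j : κ),
      LineDef δ (fun v : κ → L => I (fun i => v (g i)) (v j)))
    (hpt : ∀ x, D x → ∃ p, ∀ l, inc p l ↔ I x l)
    (hsurj : ∀ p, ∃ x, D x ∧ ∀ l, inc p l ↔ I x l)
    (hsep : ∀ p q, (∀ l, inc p l ↔ inc q l) → p = q) :
    DefinitionallyEquivalent inc δ := by
  choose f hf using hpt
  have hfeq : ∀ x hx y hy, f x hx = f y hy ↔ ∀ l, I x l ↔ I y l := fun x hx y hy =>
    ⟨fun h l => by rw [← hf x hx, ← hf y hy, h],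
      fun h => hsep _ _ fun l => by rw [hf x hx, hf y hy, h]⟩
  have hfp : ∀ x hx p, f x hx = p ↔ ∀ l, inc p l ↔ I x l := fun x hx p =>
    ⟨fun h l => by rw [← hf x hx, h], fun h => hsep _ _ fun l => by rw [hf x hx, h]⟩
  refine ⟨?_, t, {x | D x}, fun x => f x.1 x.2, ?_, ?_, ?_, ?_, ?_⟩
  · have h := (hδ (ι := Empty) (0 : Fin 2) 1).definableIn_sorted
    let := incStructure inc
    unfold DefinableIn at h ⊢
    have h' := h.preimage_comp (Sum.elim Empty.elim id : Empty ⊕ Fin 2 → Fin 2)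
    convert h' using 1
    ext z
    constructor
    · rintro ⟨a, b, ha, hb, hab⟩
      refine ⟨Empty.elim, ![a, b], ?_, hab⟩
      ext i
      rcases i with i | i
      · exact i.elim
      · fin_cases i
        · simpa using ha
        · simpa using hb
    · rintro ⟨s, v, hz, h⟩
      exact ⟨v 0, v 1, congrFun hz (.inr 0), congrFun hz (.inr 1), h⟩
  · intro p
    obtain ⟨x, hx, h⟩ := hsurj p
    exact ⟨⟨x, hx⟩, (hfp x hx p).2 h⟩
  · exact (hD id).definableIn
  · have h : LineDef δ fun z : Fin t ⊕ Fin t → L =>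
        D (fun i => z (Sum.inl i)) ∧ D (fun i => z (Sum.inr i)) ∧
          ∀ l, (I (fun i => z (Sum.inl i)) l ↔ I (fun i => z (Sum.inr i)) l) :=
      (hD _).and ((hD _).and (.all ((hI _ _).iff (hI _ _))))
    convert h.definableIn using 1
    ext z
    constructor
    · rintro ⟨⟨x, hx⟩, ⟨y, hy⟩, h₁, h₂, h⟩
      obtain rfl : (fun i => z (Sum.inl i)) = x := funext h₁
      obtain rfl : (fun i => z (Sum.inr i)) = y := funext h₂
      exact ⟨hx, hy, (hfeq _ _ _ _).1 h⟩
    · rintro ⟨hx, hy, h⟩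
      exact ⟨⟨_, hx⟩, ⟨_, hy⟩, fun _ => rfl, fun _ => rfl, (hfeq _ _ _ _).2 h⟩
  · have h : LineDef δ fun z : Fin t ⊕ Unit → L =>
        D (fun i => z (Sum.inl i)) ∧ I (fun i => z (Sum.inl i)) (z (Sum.inr ())) :=
      (hD _).and (hI _ _)
    convert h.definableIn using 1
    ext z
    constructor
    · rintro ⟨⟨x, hx⟩, h₁, h⟩
      obtain rfl : (fun i => z (Sum.inl i)) = x := funext h₁
      exact ⟨hx, (hf _ hx _).1 h⟩
    · rintro ⟨hx, h⟩
      exact ⟨⟨_, hx⟩, fun _ => rfl, (hf _ hx _).2 h⟩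
  · have h : IncDef inc fun (s : Unit → S) (v : Fin t → L) =>
        D (fun i => v i) ∧ ∀ l, (inc (s ()) l ↔ I (fun i => v i) l) :=
      (IncDef.of_lineDef hδ (hD _)).and (.allLine ((IncDef.inc _ _).iff
        (IncDef.of_lineDef hδ (hI (fun i => some i) none))))
    have h := h.definableIn_sorted
    let := incStructure inc
    unfold DefinableIn at h ⊢
    have h' := h.preimage_comp (Sum.swap : Unit ⊕ Fin t → Fin t ⊕ Unit)
    convert h' using 1
    ext z
    constructor
    · rintro ⟨⟨x, hx⟩, h₁, h₂⟩
      refine ⟨fun _ => f x hx, x, ?_, hx, (hfp _ hx _).1 rfl⟩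
      ext i
      rcases i with i | i
      · exact h₂
      · exact h₁ i
    · rintro ⟨s, v, hz, hx, h⟩
      exact ⟨⟨v, hx⟩, fun i => congrFun hz (.inr i),
        (congrFun hz (.inl ())).trans (congrArg _ ((hfp _ hx _).2 h).symm)⟩

end Calculus

/-! ### Ranked modular lattices -/

section Rank

variable {α : Type*} [Lattice α] [BoundedOrder α]

/-- `r` is the rank function of a bounded lattice that behaves like the lattice of subspaces of a
vector space: it is strictly monotone and modular, one can add an atom or remove a coatom while
avoiding a prescribed element, and every interval of length two has a third element besides two
given ones. The axioms are invariant under reversing the order. -/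
structure IsProjRank (r : α → ℕ) : Prop where
  bot : r ⊥ = 0
  lt : ∀ {x y}, x < y → r x < r y
  mod : ∀ x y, r (x ⊔ y) + r (x ⊓ y) = r x + r y
  atom : ∀ {x y z}, x ≤ y → x ≤ z → ¬ z ≤ y →
    ∃ p, x ≤ p ∧ p ≤ z ∧ r p = r x + 1 ∧ ¬ p ≤ y
  coatom : ∀ {x y z}, x ≤ z → y ≤ z → ¬ y ≤ x →
    ∃ h, x ≤ h ∧ h ≤ z ∧ r h + 1 = r z ∧ ¬ y ≤ h
  third : ∀ {x z y₁ y₂}, x ≤ y₁ → y₁ ≤ z → x ≤ y₂ → y₂ ≤ z → r z = r x + 2 →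
    r y₁ = r x + 1 → r y₂ = r x + 1 →
    ∃ y, x ≤ y ∧ y ≤ z ∧ r y = r x + 1 ∧ y ≠ y₁ ∧ y ≠ y₂

/-- The corank, as a rank function of the dual lattice. -/
def corank (r : α → ℕ) : αᵒᵈ → ℕ := fun x => r ⊤ - r (OrderDual.ofDual x)

namespace IsProjRank

variable {r : α → ℕ}

theorem mono (h : IsProjRank r) {x y : α} (hxy : x ≤ y) : r x ≤ r y :=
  hxy.eq_or_lt.elim (fun e => e ▸ le_rfl) fun hlt => (h.lt hlt).le

theorem eq_of_le (h : IsProjRank r) {x y : α} (hxy : x ≤ y) (hr : r y ≤ r x) : x = y :=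
  hxy.eq_or_lt.elim id fun hlt => absurd (h.lt hlt) (not_lt.2 hr)

theorem le_top (h : IsProjRank r) (x : α) : r x ≤ r ⊤ := h.mono _root_.le_top

theorem dual (h : IsProjRank r) : IsProjRank (corank r) where
  bot := by simp [corank]
  lt {x y} hxy := by
    have h₁ := h.lt (OrderDual.ofDual_lt_ofDual.2 hxy)
    have h₂ := h.le_top (OrderDual.ofDual x)
    simp only [corank]
    omega
  mod x y := by
    have h₁ := h.mod (OrderDual.ofDual x) (OrderDual.ofDual y)
    have h₂ := h.le_top (OrderDual.ofDual x ⊔ OrderDual.ofDual y)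
    have h₃ := h.le_top (OrderDual.ofDual x ⊓ OrderDual.ofDual y)
    have h₄ := h.le_top (OrderDual.ofDual x)
    have h₅ := h.le_top (OrderDual.ofDual y)
    simp only [corank, ofDual_sup, ofDual_inf]
    omega
  atom {x y z} hxy hxz hzy := by
    obtain ⟨p, h₁, h₂, h₃, h₄⟩ := h.coatom (x := OrderDual.ofDual z) (y := OrderDual.ofDual y)
      (z := OrderDual.ofDual x) hxz hxy hzy
    refine ⟨OrderDual.toDual p, h₂, h₁, ?_, h₄⟩
    have := h.le_top (OrderDual.ofDual x)
    simp only [corank, OrderDual.ofDual_toDual]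
    omega
  coatom {x y z} hxz hyz hyx := by
    obtain ⟨p, h₁, h₂, h₃, h₄⟩ := h.atom (x := OrderDual.ofDual z) (y := OrderDual.ofDual y)
      (z := OrderDual.ofDual x) hyz hxz hyx
    refine ⟨OrderDual.toDual p, h₂, h₁, ?_, h₄⟩
    have := h.le_top p
    simp only [corank, OrderDual.ofDual_toDual]
    omega
  third {x z y₁ y₂} h₁ h₂ h₃ h₄ h₅ h₆ h₇ := by
    have e₁ := h.le_top (OrderDual.ofDual x)
    have e₂ := h.le_top (OrderDual.ofDual z)
    have e₃ := h.le_top (OrderDual.ofDual y₁)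
    have e₄ := h.le_top (OrderDual.ofDual y₂)
    simp only [corank] at h₅ h₆ h₇
    obtain ⟨y, g₁, g₂, g₃, g₄⟩ := h.third (x := OrderDual.ofDual z) (z := OrderDual.ofDual x)
      (y₁ := OrderDual.ofDual y₁) (y₂ := OrderDual.ofDual y₂) h₂ h₁ h₄ h₃
      (by omega) (by omega) (by omega)
    refine ⟨OrderDual.toDual y, g₂, g₁, ?_, g₄⟩
    simp only [corank, OrderDual.ofDual_toDual]
    omega

theorem inf_eq (h : IsProjRank r) {x y z : α} (hx : z ≤ x) (hy : z ≤ y) (hrx : r x = r z + 1)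
    (hry : r y = r z + 1) (hne : x ≠ y) : x ⊓ y = z := by
  refine (h.eq_of_le (le_inf hx hy) ?_).symm
  by_contra hlt
  have e₁ := h.eq_of_le (inf_le_left : x ⊓ y ≤ x) (by omega)
  have e₂ := h.eq_of_le (inf_le_right : x ⊓ y ≤ y) (by omega)
  exact hne (e₁.symm.trans e₂)

theorem sup_eq (h : IsProjRank r) {x y z : α} (hx : x ≤ z) (hy : y ≤ z) (hrx : r x + 1 = r z)
    (hry : r y + 1 = r z) (hne : x ≠ y) : x ⊔ y = z := by
  refine h.eq_of_le (sup_le hx hy) ?_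
  by_contra hlt
  have e₁ := h.eq_of_le (le_sup_left : x ≤ x ⊔ y) (by omega)
  have e₂ := h.eq_of_le (le_sup_right : y ≤ x ⊔ y) (by omega)
  exact hne (e₁.trans e₂.symm)

theorem not_le_of_rank_lt (h : IsProjRank r) {x y : α} (hr : r y < r x) : ¬ x ≤ y :=
  fun hle => absurd (h.mono hle) (not_le.2 hr)

/-- Intersecting with a fixed element lowers ranks no faster than the rank itself drops. -/
theorem inf_le_add (h : IsProjRank r) {x y : α} (hxy : x ≤ y) (W : α) :
    r (y ⊓ W) + r x ≤ r (x ⊓ W) + r y := by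
  have h₁ := h.mod x (y ⊓ W)
  have h₂ : r (x ⊔ y ⊓ W) ≤ r y := h.mono (sup_le hxy inf_le_left)
  rw [← inf_assoc, inf_eq_left.2 hxy] at h₁
  omega

/-- A coatom of an interval can be chosen to avoid two elements at once: two coatoms that avoid one
each span an interval of length two, and a third element of this interval avoids both. -/
theorem coatom₂ (h : IsProjRank r) {x z y₁ y₂ : α} (hxz : x ≤ z) (h₁ : y₁ ≤ z) (h₂ : y₂ ≤ z)
    (h₁' : ¬ y₁ ≤ x) (h₂' : ¬ y₂ ≤ x) :
    ∃ c, x ≤ c ∧ c ≤ z ∧ r c + 1 = r z ∧ ¬ y₁ ≤ c ∧ ¬ y₂ ≤ c := by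
  obtain ⟨a, a₁, a₂, a₃, a₄⟩ := h.coatom hxz h₁ h₁'
  obtain ⟨b, b₁, b₂, b₃, b₄⟩ := h.coatom hxz h₂ h₂'
  by_cases ha : y₂ ≤ a
  swap
  · exact ⟨a, a₁, a₂, a₃, a₄, ha⟩
  by_cases hb : y₁ ≤ b
  swap
  · exact ⟨b, b₁, b₂, b₃, hb, b₄⟩
  have hab : a ≠ b := fun e => a₄ (e ▸ hb)
  have e₁ := h.mod a b
  rw [h.sup_eq a₂ b₂ a₃ b₃ hab] at e₁
  obtain ⟨c, c₁, c₂, c₃, c₄, c₅⟩ := h.third (x := a ⊓ b) (z := z) inf_le_left a₂ inf_le_right b₂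
    (by omega) (by omega) (by omega)
  refine ⟨c, (le_inf a₁ b₁).trans c₁, c₂, by omega, fun hc => ?_, fun hc => ?_⟩
  · have := h.inf_eq c₁ inf_le_right c₃ (by omega) c₅
    exact a₄ ((le_inf hc hb).trans (this.trans_le inf_le_left))
  · have := h.inf_eq c₁ inf_le_left c₃ (by omega) c₄
    exact b₄ ((le_inf hc ha).trans (this.trans_le inf_le_right))

theorem atom₂ (h : IsProjRank r) {x z y₁ y₂ : α} (hxz : x ≤ z) (h₁ : x ≤ y₁) (h₂ : x ≤ y₂)
    (h₁' : ¬ z ≤ y₁) (h₂' : ¬ z ≤ y₂) :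
    ∃ c, x ≤ c ∧ c ≤ z ∧ r c = r x + 1 ∧ ¬ c ≤ y₁ ∧ ¬ c ≤ y₂ := by
  obtain ⟨c, c₁, c₂, c₃, c₄, c₅⟩ := h.dual.coatom₂ (x := OrderDual.toDual z)
    (z := OrderDual.toDual x) (y₁ := OrderDual.toDual y₁) (y₂ := OrderDual.toDual y₂)
    hxz h₁ h₂ h₁' h₂'
  refine ⟨OrderDual.ofDual c, c₂, c₁, ?_, c₄, c₅⟩
  have e₁ := h.le_top x
  have e₂ := h.le_top (OrderDual.ofDual c)
  have e₃ : r x ≤ r (OrderDual.ofDual c) := h.mono c₂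
  simp only [corank, OrderDual.ofDual_toDual] at c₃
  omega

end IsProjRank

/-! ### Spine spaces in a ranked lattice -/

/-- `U` is a proper point: it has rank `k` and meets `W` in rank `m`. -/
def Proper (r : α → ℕ) (W : α) (k m : ℕ) (U : α) : Prop := r U = k ∧ r (U ⊓ W) = m

/-- The pair `H ≤ B` determines a line of the spine space: `H` and `B` have ranks `k - 1` and
`k + 1`, and at least two proper points lie between them. -/
def IsLine (r : α → ℕ) (W : α) (k m : ℕ) (H B : α) : Prop :=
  H ≤ B ∧ r H + 1 = k ∧ r B = k + 1 ∧ ∃ U₁ U₂, U₁ ≠ U₂ ∧ Proper r W k m U₁ ∧ Proper r W k m U₂ ∧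
    H ≤ U₁ ∧ U₁ ≤ B ∧ H ≤ U₂ ∧ U₂ ≤ B

/-- The numerical assumptions on a spine space in a ranked lattice; they are invariant
under duality, which sends `k` to `r ⊤ - k` and `m` to `r ⊤ + m - k - r W`. -/
structure IsSpine (r : α → ℕ) (W : α) (k m : ℕ) : Prop where
  rank : IsProjRank r
  two_le : 2 ≤ k
  le_top : k + 2 ≤ r ⊤
  le_k : m ≤ k
  le_w : m ≤ r W
  le_sup : k + r W ≤ r ⊤ + m

variable {r : α → ℕ} {W : α} {k m : ℕ}

namespace IsSpine

theorem dual (h : IsSpine r W k m) :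
    IsSpine (corank r) (OrderDual.toDual W) (r ⊤ - k) (r ⊤ + m - k - r W) := by
  obtain ⟨h₀, h₁, h₂, h₃, h₄, h₅⟩ := h
  have h₆ := h₀.le_top W
  have h₇ := h₀.bot
  have h₈ : corank r ⊤ = r ⊤ := by simp [corank, h₇]
  refine ⟨h₀.dual, by omega, by omega, by omega, ?_, ?_⟩
  · simp only [corank, OrderDual.ofDual_toDual]; omega
  · rw [h₈]; simp only [corank, OrderDual.ofDual_toDual]; omega

theorem proper_dual (h : IsSpine r W k m) {U : α} :
    Proper (corank r) (OrderDual.toDual W) (r ⊤ - k) (r ⊤ + m - k - r W) (OrderDual.toDual U) ↔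
      Proper r W k m U := by
  obtain ⟨h₀, h₁, h₂, h₃, h₄, h₅⟩ := h
  have h₆ := h₀.le_top U
  have h₇ := h₀.le_top (U ⊔ W)
  have h₈ := h₀.mod U W
  have h₉ := h₀.le_top W
  simp only [Proper, corank, ofDual_inf, OrderDual.ofDual_toDual]
  omega

theorem isLine_dual (h : IsSpine r W k m) {H B : α} :
    IsLine (corank r) (OrderDual.toDual W) (r ⊤ - k) (r ⊤ + m - k - r W) (OrderDual.toDual B)
      (OrderDual.toDual H) ↔ IsLine r W k m H B := by
  have e₁ := h.rank.le_top H
  have e₂ := h.rank.le_top B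
  have e₃ := h.le_top
  have e₄ := h.two_le
  constructor
  · rintro ⟨h₁, h₂, h₃, U₁, U₂, h₄, h₅, h₆, h₇, h₈, h₉, h₁₀⟩
    simp only [corank, OrderDual.ofDual_toDual] at h₂ h₃
    exact ⟨h₁, by omega, by omega, OrderDual.ofDual U₁, OrderDual.ofDual U₂, h₄,
      h.proper_dual.1 h₅, h.proper_dual.1 h₆, h₈, h₇, h₁₀, h₉⟩
  · rintro ⟨h₁, h₂, h₃, U₁, U₂, h₄, h₅, h₆, h₇, h₈, h₉, h₁₀⟩
    refine ⟨h₁, ?_, ?_, OrderDual.toDual U₁, OrderDual.toDual U₂, h₄,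
      h.proper_dual.2 h₅, h.proper_dual.2 h₆, h₈, h₇, h₁₀, h₉⟩
    all_goals simp only [corank, OrderDual.ofDual_toDual]; omega

end IsSpine

namespace IsProjRank

/-- The three types of lines: all points of the closure are proper in the first and in the third
case, and all but one in the second case. -/
theorem isLine_types (h : IsProjRank r) {H B : α} (hl : IsLine r W k m H B) :
    (r (H ⊓ W) = m ∧ (r (B ⊓ W) = m ∨ r (B ⊓ W) = m + 1)) ∨
      (r (H ⊓ W) + 1 = m ∧ r (B ⊓ W) = m + 1) := by
  obtain ⟨-, hH, hB, U₁, U₂, hne, ⟨p₁, q₁⟩, ⟨p₂, q₂⟩, a₁, b₁, a₂, b₂⟩ := hl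
  have e₁ := h.inf_le_add a₁ W
  have e₂ := h.inf_le_add b₁ W
  have e₃ := h.mono (inf_le_inf_right W a₁)
  have e₄ := h.mono (inf_le_inf_right W b₁)
  have e₅ := h.mod (U₁ ⊓ W) (U₂ ⊓ W)
  have e₆ : U₁ ⊓ W ⊓ (U₂ ⊓ W) = H ⊓ W := by
    rw [← inf_inf_distrib_right, h.inf_eq a₁ a₂ (by omega) (by omega) hne]
  have e₇ := h.mono (sup_le (inf_le_inf_right W b₁) (inf_le_inf_right W b₂))
  rw [e₆] at e₅
  omega

theorem rank_inf_of_between (h : IsProjRank r) {H B V : α} (hH : r H + 1 = k) (hB : r B = k + 1)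
    (hV : r V = k) (hHV : H ≤ V) (hVB : V ≤ B) :
    r (H ⊓ W) ≤ r (V ⊓ W) ∧ r (V ⊓ W) ≤ r (H ⊓ W) + 1 ∧ r (V ⊓ W) ≤ r (B ⊓ W) ∧
      r (B ⊓ W) ≤ r (V ⊓ W) + 1 := by
  have e₁ := h.inf_le_add hHV W
  have e₂ := h.inf_le_add hVB W
  have e₃ := h.mono (inf_le_inf_right W hHV)
  have e₄ := h.mono (inf_le_inf_right W hVB)
  omega

/-- A point through which the closure of a line passes is proper, unless the line is affine
and the point is its point at infinity. -/
theorem types_of_not_proper (h : IsProjRank r) {H B U : α} (hl : IsLine r W k m H B) (hU : r U = k)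
    (hHU : H ≤ U) (hUB : U ≤ B) (hp : ¬ Proper r W k m U) :
    r (H ⊓ W) = m ∧ r (B ⊓ W) = m + 1 ∧ r (U ⊓ W) = m + 1 := by
  have e₁ := h.isLine_types hl
  have e₂ := h.rank_inf_of_between (W := W) hl.2.1 hl.2.2.1 hU hHU hUB
  have e₃ : r (U ⊓ W) ≠ m := fun e => hp ⟨hU, e⟩
  omega

/-- The point at infinity of an affine line is determined by the line. -/
theorem eq_of_rank_inf (h : IsProjRank r) {H B U V : α} (hH : r H + 1 = k) (hB : r B = k + 1)
    (hHm : r (H ⊓ W) = m) (hU : r U = k) (hHU : H ≤ U) (hUB : U ≤ B) (hUm : r (U ⊓ W) = m + 1)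
    (hV : r V = k) (hHV : H ≤ V) (hVB : V ≤ B) (hVm : r (V ⊓ W) = m + 1)
    (hBm : r (B ⊓ W) = m + 1) : U = V := by
  by_contra hne
  have e₁ := h.eq_of_le (inf_le_inf_right W hUB) (by omega)
  have e₂ := h.eq_of_le (inf_le_inf_right W hVB) (by omega)
  have e₃ : U ⊓ W ≤ H ⊓ W := by
    refine le_inf ?_ inf_le_right
    rw [← h.inf_eq hHU hHV (by omega) (by omega) hne]
    exact le_inf inf_le_left (by rw [e₁, ← e₂]; exact inf_le_left)
  have := h.mono e₃
  omega

theorem isLine_of_proper (h : IsProjRank r) {H B U : α} (hH : r H + 1 = k) (hB : r B = k + 1)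
    (hU : Proper r W k m U) (hHU : H ≤ U) (hUB : U ≤ B)
    (ht : r (H ⊓ W) = m ∨ r (B ⊓ W) = m + 1) : IsLine r W k m H B := by
  obtain ⟨hUk, hUm⟩ := hU
  have e₁ := h.rank_inf_of_between (W := W) hH hB hUk hHU hUB
  obtain ⟨V, v₁, v₂, v₃, v₄, -⟩ := h.third hHU hUB hHU hUB (by omega) (by omega) (by omega)
  have e₂ := h.rank_inf_of_between (W := W) hH hB (by omega : r V = k) v₁ v₂
  by_cases hV : r (V ⊓ W) = m
  · exact ⟨hHU.trans hUB, hH, hB, U, V, v₄.symm, ⟨hUk, hUm⟩, ⟨by omega, hV⟩, hHU, hUB, v₁, v₂⟩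
  obtain ⟨V', w₁, w₂, w₃, w₄, w₅⟩ := h.third hHU hUB v₁ v₂ (by omega) (by omega) (by omega)
  have e₃ := h.rank_inf_of_between (W := W) hH hB (by omega : r V' = k) w₁ w₂
  refine ⟨hHU.trans hUB, hH, hB, U, V', w₄.symm, ⟨hUk, hUm⟩, ⟨by omega, ?_⟩, hHU, hUB, w₁, w₂⟩
  by_contra hV'
  exact w₅ (h.eq_of_rank_inf (W := W) (m := m) hH hB (by omega) (by omega) w₁ w₂ (by omega) (by omega)
    v₁ v₂ (by omega) (by omega))

theorem isLine_affine (h : IsProjRank r) {H B : α} (hHB : H ≤ B) (hH : r H + 1 = k)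
    (hB : r B = k + 1) (hHm : r (H ⊓ W) = m) (hBm : r (B ⊓ W) = m + 1) : IsLine r W k m H B := by
  have e₁ := h.mod H (B ⊓ W)
  rw [← inf_assoc, inf_eq_left.2 hHB] at e₁
  obtain ⟨p, p₁, p₂, p₃, p₄⟩ := h.atom (x := H) (y := H ⊔ B ⊓ W) (z := B) le_sup_left hHB
    (h.not_le_of_rank_lt (by omega))
  have e₂ := h.rank_inf_of_between (W := W) hH hB (by omega : r p = k) p₁ p₂
  refine h.isLine_of_proper hH hB ⟨by omega, ?_⟩ p₁ p₂ (.inl hHm)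
  by_contra hne
  refine p₄ ?_
  rw [h.eq_of_rank_inf (m := m) hH hB hHm (by omega) p₁ p₂ (by omega) (V := H ⊔ B ⊓ W) (by omega)
    le_sup_left (sup_le hHB inf_le_left) ?_ hBm]
  have e₃ : r (B ⊓ W) ≤ r ((H ⊔ B ⊓ W) ⊓ W) := h.mono (le_inf le_sup_right inf_le_right)
  have e₄ := h.mono (inf_le_inf_right W (sup_le hHB inf_le_left : H ⊔ B ⊓ W ≤ B))
  omega

/-- A proper point and a point on the closure of a line, both above `H`, are joined by a line. -/
theorem isLine_sup (h : IsProjRank r) {H B U V : α} (hl : IsLine r W k m H B) (hU : r U = k)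
    (hHU : H ≤ U) (hUB : U ≤ B) (hV : Proper r W k m V) (hHV : H ≤ V) (hne : U ≠ V) :
    IsLine r W k m H (U ⊔ V) := by
  have e₀ := hl.2.1
  have e₁ := h.inf_eq hHU hHV (by omega) (by have := hV.1; omega) hne
  have e₂ := h.mod U V
  rw [e₁, hV.1] at e₂
  by_cases hp : Proper r W k m U
  · exact ⟨hHU.trans le_sup_left, e₀, by omega, U, V, hne, hp, hV, hHU, le_sup_left, hHV,
      le_sup_right⟩
  · obtain ⟨t₁, -, -⟩ := h.types_of_not_proper hl hU hHU hUB hp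
    exact h.isLine_of_proper e₀ (by omega) hV hHV le_sup_right (.inl t₁)

end IsProjRank

theorem IsSpine.isLine_inf (h : IsSpine r W k m) {H B U V : α} (hl : IsLine r W k m H B)
    (hU : r U = k) (hHU : H ≤ U) (hUB : U ≤ B) (hV : Proper r W k m V) (hVB : V ≤ B)
    (hne : U ≠ V) : IsLine r W k m (U ⊓ V) B := by
  have := h.dual.rank.isLine_sup (U := OrderDual.toDual U) (V := OrderDual.toDual V)
    (h.isLine_dual.2 hl) (by simp [corank, hU]) hUB hHU (h.proper_dual.2 hV) hVB hne
  exact h.isLine_dual.1 this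

end Rank

/-! ### First-order formulas in the adjacency of lines -/

section Formulas

variable {L : Type*} (δ : L → L → Prop)

/-- Two distinct lines that are in the relation `δ`. -/
def Nb (a b : L) : Prop := a ≠ b ∧ δ a b

/-- The neighbours `a` and `c` of `l` are not connected by a path of length at most two within the
neighbourhood of `l`. In a spine space this says that one of them is in a common star with `l`
and the other one in a common top. -/
def Opp (a l c : L) : Prop :=
  Nb δ a l ∧ Nb δ l c ∧ a ≠ c ∧ ¬ δ a c ∧ ¬ ∃ x, Nb δ x a ∧ Nb δ x l ∧ Nb δ x c

/-- A quadrangle of lines that is opposite at each of its vertices. In a spine space it consists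
of the lines `(H, B), (H, B'), (H', B'), (H', B)` with `H ⊔ H' = B ⊓ B'`, and so it encodes
a point. -/
def Sq (a b c d : L) : Prop := Opp δ a b c ∧ Opp δ b c d ∧ Opp δ c d a ∧ Opp δ d a b

/-- The lines that can be reached from the square `a b c d` in at most `n` steps, a step leading from
two lines to a square with these two lines as consecutive vertices. -/
def Lin : ℕ → L → L → L → L → L → Prop
  | 0, a, b, c, d, l => l = a ∨ l = b ∨ l = c ∨ l = d
  | n + 1, a, b, c, d, l => Lin n a b c d l ∨
      ∃ p q s, Lin n a b c d p ∧ Lin n a b c d q ∧ Sq δ p q l s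

/-- The line `l` is a vertex of a square. -/
def InSq (l : L) : Prop := ∃ b c d, Sq δ l b c d

/-- The line `l` passes through the point encoded by the square `a b c d`. The second alternative
takes care of the lines that are in no square because no other line has the same lower end: such
a line has a neighbour `p` through the point with the same upper end, and every neighbour of `p`
through the point is a neighbour of `l` or lies on the other side of `p`. -/
def SqInc (a b c d l : L) : Prop :=
  Lin δ 3 a b c d l ∨ (¬ InSq δ l ∧ ∃ p, Lin δ 3 a b c d p ∧ Nb δ p l ∧
    ∀ q, Lin δ 3 a b c d q → Nb δ q p → Nb δ q l ∨ Opp δ q p l)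

/-- The point encoded by the square `a b c d` is improper: some point in a common star or top is not
joined to it. -/
def Bad (a b c d : L) : Prop :=
  ∃ a' b' c' d', Sq δ a' b' c' d' ∧
    (∃ l l', Lin δ 0 a b c d l ∧ Lin δ 0 a' b' c' d' l' ∧ Nb δ l l') ∧
      ¬ ∃ x, SqInc δ a b c d x ∧ SqInc δ a' b' c' d' x

namespace LineDef

variable {δ} {κ : Type}

theorem nb (i j : κ) : LineDef δ fun v : κ → L => Nb δ (v i) (v j) :=
  (LineDef.eq _ _).not.and (.rel _ _)

theorem opp (i j l : κ) : LineDef δ fun v : κ → L => Opp δ (v i) (v j) (v l) :=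
  (nb _ _).and ((nb _ _).and ((LineDef.eq _ _).not.and ((LineDef.rel _ _).not.and
    (LineDef.ex ((nb _ _).and ((nb _ _).and (nb _ _)))).not)))

theorem sq (i j l p : κ) : LineDef δ fun v : κ → L => Sq δ (v i) (v j) (v l) (v p) :=
  (opp _ _ _).and ((opp _ _ _).and ((opp _ _ _).and (opp _ _ _)))

theorem lin (n : ℕ) : ∀ {κ : Type} (i j l p q : κ),
    LineDef δ fun v : κ → L => Lin δ n (v i) (v j) (v l) (v p) (v q) := by
  induction n with
  | zero =>
    exact fun i j l p q => (LineDef.eq _ _).or ((LineDef.eq _ _).or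
      ((LineDef.eq _ _).or (LineDef.eq _ _)))
  | succ n ih =>
    exact fun i j l p q => (ih _ _ _ _ _).or
      (.ex (.ex (.ex ((ih _ _ _ _ _).and ((ih _ _ _ _ _).and (sq _ _ _ _))))))

theorem inSq (i : κ) : LineDef δ fun v : κ → L => InSq δ (v i) :=
  .ex (.ex (.ex (sq _ _ _ _)))

theorem sqInc (i j l p q : κ) :
    LineDef δ fun v : κ → L => SqInc δ (v i) (v j) (v l) (v p) (v q) :=
  (lin _ _ _ _ _ _).or ((inSq _).not.and (.ex ((lin _ _ _ _ _ _).and ((nb _ _).and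
    (.all ((lin _ _ _ _ _ _).imp ((nb _ _).imp ((nb _ _).or (opp _ _ _)))))))))

theorem bad (i j l p : κ) : LineDef δ fun v : κ → L => Bad δ (v i) (v j) (v l) (v p) :=
  .ex (.ex (.ex (.ex ((sq _ _ _ _).and ((LineDef.ex (.ex ((lin _ _ _ _ _ _).and
    ((lin _ _ _ _ _ _).and (nb _ _))))).and
      (LineDef.ex ((sqInc _ _ _ _ _).and (sqInc _ _ _ _ _))).not)))))

end LineDef

end Formulas

/-! ### The adjacency of lines in terms of stars and tops -/

section LineGeom

variable {α : Type*} [Lattice α] [BoundedOrder α] {L : Type*}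

/-- The point `U` is on the closure of the line `l`. -/
def On (lo hi : L → α) (U : α) (l : L) : Prop := lo l ≤ U ∧ U ≤ hi l

/-- `L` is the set of lines of a spine space, a line `l` being given by its lower end `lo l` and
its upper end `hi l`, and two distinct lines are in the relation `δ` if and only if they are in a
common star or top and their closures meet in a point with `Q`. The points with `Q`
are either just the proper points or all elements of rank `k`. -/
structure LineGeom (r : α → ℕ) (W : α) (k m : ℕ) (Q : α → Prop) (lo hi : L → α)
    (δ : L → L → Prop) : Prop where
  spine : IsSpine r W k m
  line : ∀ l, IsLine r W k m (lo l) (hi l)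
  exists_line : ∀ {H B}, IsLine r W k m H B → ∃ l, lo l = H ∧ hi l = B
  ext : ∀ {l l'}, lo l = lo l' → hi l = hi l' → l = l'
  adj : ∀ {l l'}, l ≠ l' → (δ l l' ↔ (lo l = lo l' ∨ hi l = hi l') ∧
    ∃ U, Q U ∧ On lo hi U l ∧ On lo hi U l')
  rank_of_Q : ∀ {U}, Q U → r U = k
  Q_of_proper : ∀ {U}, Proper r W k m U → Q U
  Q_of_rank : ∀ {U V}, Q U → ¬ Proper r W k m U → r V = k → Q V

namespace LineGeom

variable {r : α → ℕ} {W : α} {k m : ℕ} {Q : α → Prop} {lo hi : L → α} {δ : L → L → Prop}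

theorem dual (h : LineGeom r W k m Q lo hi δ) :
    LineGeom (corank r) (OrderDual.toDual W) (r ⊤ - k) (r ⊤ + m - k - r W)
      (fun U => Q (OrderDual.ofDual U)) (fun l => OrderDual.toDual (hi l))
      (fun l => OrderDual.toDual (lo l)) δ where
  spine := h.spine.dual
  line l := h.spine.isLine_dual.2 (h.line l)
  exists_line {H B} hl := by
    obtain ⟨l, h₁, h₂⟩ := h.exists_line (h.spine.isLine_dual.1 hl)
    exact ⟨l, h₂, h₁⟩
  ext h₁ h₂ := h.ext h₂ h₁
  adj hne := by
    rw [h.adj hne, or_comm]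
    refine and_congr Iff.rfl ⟨?_, ?_⟩
    · rintro ⟨U, h₁, h₂, h₃⟩
      exact ⟨U, h₁, h₂.symm, h₃.symm⟩
    · rintro ⟨U, h₁, h₂, h₃⟩
      exact ⟨U, h₁, h₂.symm, h₃.symm⟩
  rank_of_Q {U} hU := by
    have := h.rank_of_Q hU
    simp [corank, this]
  Q_of_proper {U} hU := h.Q_of_proper (h.spine.proper_dual.1 hU)
  Q_of_rank {U V} hU hp hV := by
    refine h.Q_of_rank hU (fun hp' => hp (h.spine.proper_dual.2 hp')) ?_
    have e₁ := h.spine.le_top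
    have e₂ := h.spine.rank.le_top (OrderDual.ofDual V)
    simp only [corank] at hV
    omega

theorem symm (h : LineGeom r W k m Q lo hi δ) {a b : L} (hab : Nb δ a b) : Nb δ b a := by
  obtain ⟨hne, hd⟩ := hab
  refine ⟨hne.symm, (h.adj hne.symm).2 ?_⟩
  obtain ⟨h₁, U, h₂, h₃, h₄⟩ := (h.adj hne).1 hd
  exact ⟨h₁.imp Eq.symm Eq.symm, U, h₂, h₄, h₃⟩

theorem nb_of_lo (h : LineGeom r W k m Q lo hi δ) {a b : L} {U : α} (hne : a ≠ b)
    (hlo : lo a = lo b) (hU : Q U) (ha : On lo hi U a) (hb : On lo hi U b) : Nb δ a b :=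
  ⟨hne, (h.adj hne).2 ⟨.inl hlo, U, hU, ha, hb⟩⟩

theorem nb_of_hi (h : LineGeom r W k m Q lo hi δ) {a b : L} {U : α} (hne : a ≠ b)
    (hhi : hi a = hi b) (hU : Q U) (ha : On lo hi U a) (hb : On lo hi U b) : Nb δ a b :=
  ⟨hne, (h.adj hne).2 ⟨.inr hhi, U, hU, ha, hb⟩⟩

theorem rank_lo (h : LineGeom r W k m Q lo hi δ) (l : L) : r (lo l) + 1 = k := (h.line l).2.1

theorem rank_hi (h : LineGeom r W k m Q lo hi δ) (l : L) : r (hi l) = k + 1 := (h.line l).2.2.1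

/-- Two distinct lines have at most one point in common. -/
theorem eq_of_on (h : LineGeom r W k m Q lo hi δ) {a b : L} {U V : α} (hne : a ≠ b)
    (hU : r U = k) (hV : r V = k) (hUa : On lo hi U a) (hUb : On lo hi U b) (hVa : On lo hi V a)
    (hVb : On lo hi V b) : U = V := by
  by_contra hUV
  have e₁ := h.rank_lo a
  have e₂ := h.rank_lo b
  have e₃ := h.rank_hi a
  have e₄ := h.rank_hi b
  have R := h.spine.rank
  refine hne (h.ext ?_ ?_)
  · exact (R.inf_eq hUa.1 hVa.1 (by omega) (by omega) hUV).symm.trans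
      (R.inf_eq hUb.1 hVb.1 (by omega) (by omega) hUV)
  · exact (R.sup_eq hUa.2 hVa.2 (by omega) (by omega) hUV).symm.trans
      (R.sup_eq hUb.2 hVb.2 (by omega) (by omega) hUV)

/-- Neighbours of `l` in a common star with `l` and in a common top with `l` are opposite. -/
theorem opp_of_lo_hi (h : LineGeom r W k m Q lo hi δ) {a l c : L} (hal : Nb δ a l)
    (hlc : Nb δ l c) (hlo : lo a = lo l) (hhi : hi l = hi c) : Opp δ a l c := by
  have hac : a ≠ c := fun e => hal.1 (h.ext hlo (by rw [e, hhi]))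
  refine ⟨hal, hlc, hac, fun hd => ?_, ?_⟩
  · rcases ((h.adj hac).1 hd).1 with e | e
    · exact hlc.1 (h.ext (hlo.symm.trans e) hhi)
    · exact hal.1 (h.ext hlo (e.trans hhi.symm))
  · rintro ⟨x, ⟨ax, xa⟩, ⟨lx, xl⟩, ⟨cx, xc⟩⟩
    rcases ((h.adj lx).1 xl).1 with e | e
    · rcases ((h.adj cx).1 xc).1 with e' | e'
      · exact hlc.1 (h.ext (e.symm.trans e') hhi)
      · exact lx (h.ext e (e'.trans hhi.symm))
    · rcases ((h.adj ax).1 xa).1 with e' | e'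
      · exact lx (h.ext (e'.trans hlo) e)
      · exact hal.1 (h.ext hlo (e'.symm.trans e))

theorem opp_of_hi_lo (h : LineGeom r W k m Q lo hi δ) {a l c : L} (hal : Nb δ a l)
    (hlc : Nb δ l c) (hhi : hi a = hi l) (hlo : lo l = lo c) : Opp δ a l c :=
  h.dual.opp_of_lo_hi hal hlc hhi hlo

/-- Neighbours of `l` in one star with `l` are not opposite: join the common point of `a` and `l`
with a proper point of `c`. -/
theorem not_opp_of_lo (h : LineGeom r W k m Q lo hi δ) {a l c : L} (h₁ : lo a = lo l)
    (h₂ : lo l = lo c) : ¬ Opp δ a l c := by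
  rintro ⟨hal, hlc, hac, hnd, hnx⟩
  have R := h.spine.rank
  obtain ⟨U₁, q₁, ⟨a₁, b₁⟩, ⟨a₂, b₂⟩⟩ := ((h.adj hal.1).1 hal.2).2
  obtain ⟨U₃, q₃, ⟨a₃, b₃⟩, ⟨a₄, b₄⟩⟩ := ((h.adj hlc.1).1 hlc.2).2
  have r₁ := h.rank_of_Q q₁
  have r₃ := h.rank_of_Q q₃
  obtain ⟨p, pp, p₁, p₂, p₃⟩ : ∃ p, Proper r W k m p ∧ lo c ≤ p ∧ p ≤ hi c ∧ p ≠ U₃ := by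
    obtain ⟨-, -, -, V₁, V₂, hne, g₁, g₂, g₃, g₄, g₅, g₆⟩ := h.line c
    by_cases e : V₁ = U₃
    · exact ⟨V₂, g₂, g₅, g₆, fun e' => hne (e.trans e'.symm)⟩
    · exact ⟨V₁, g₁, g₃, g₄, e⟩
  have key : ∀ V, Q V → lo l ≤ V → V ≤ hi a → V ≤ hi c → False := fun V qV v₁ v₂ v₃ =>
    hnd ((h.adj hac).2 ⟨.inl (h₁.trans h₂), V, qV, ⟨h₁.trans_le v₁, v₂⟩, ⟨h₂.symm.trans_le v₁, v₃⟩⟩)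
  have qp := h.Q_of_proper pp
  have hU₁p : U₁ ≠ p := fun e => key U₁ q₁ a₂ b₁ (e ▸ p₂)
  have hpl : ¬ p ≤ hi l := fun hp =>
    p₃ (h.eq_of_on hlc.1 pp.1 r₃ ⟨h₂.trans_le p₁, hp⟩ ⟨p₁, p₂⟩ ⟨a₃, b₃⟩ ⟨a₄, b₄⟩)
  obtain ⟨x, x₁, x₂⟩ := h.exists_line
    (R.isLine_sup (h.line l) r₁ a₂ b₂ pp (h₂.trans_le p₁) hU₁p)
  have ox₁ : On lo hi U₁ x := ⟨x₁.trans_le a₂, x₂ ▸ le_sup_left⟩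
  have oxp : On lo hi p x := ⟨x₁.trans_le (h₂.trans_le p₁), x₂ ▸ le_sup_right⟩
  refine hnx ⟨x, h.nb_of_lo ?_ (x₁.trans h₁.symm) q₁ ox₁ ⟨a₁, b₁⟩,
    h.nb_of_lo ?_ x₁ q₁ ox₁ ⟨a₂, b₂⟩, h.nb_of_lo ?_ (x₁.trans h₂) qp oxp ⟨p₁, p₂⟩⟩
  · rintro rfl
    exact key p qp (h₂.trans_le p₁) oxp.2 p₂
  · rintro rfl
    exact hpl oxp.2
  · rintro rfl
    exact key U₁ q₁ a₂ b₁ ox₁.2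

theorem opp_iff (h : LineGeom r W k m Q lo hi δ) {a l c : L} : Opp δ a l c ↔ Nb δ a l ∧ Nb δ l c ∧
    ((lo a = lo l ∧ hi l = hi c) ∨ (hi a = hi l ∧ lo l = lo c)) := by
  constructor
  · intro ho
    refine ⟨ho.1, ho.2.1, ?_⟩
    rcases ((h.adj ho.1.1).1 ho.1.2).1 with e | e <;>
    rcases ((h.adj ho.2.1.1).1 ho.2.1.2).1 with e' | e'
    · exact absurd ho (h.not_opp_of_lo e e')
    · exact .inl ⟨e, e'⟩
    · exact .inr ⟨e, e'⟩
    · exact absurd ho (h.dual.not_opp_of_lo e e')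
  · rintro ⟨h₁, h₂, ⟨h₃, h₄⟩ | ⟨h₃, h₄⟩⟩
    · exact h.opp_of_lo_hi h₁ h₂ h₃ h₄
    · exact h.opp_of_hi_lo h₁ h₂ h₃ h₄

theorem sq_iff (h : LineGeom r W k m Q lo hi δ) {a b c d : L} : Sq δ a b c d ↔
    Nb δ a b ∧ Nb δ b c ∧ Nb δ c d ∧ Nb δ d a ∧
      ((lo a = lo b ∧ hi b = hi c ∧ lo c = lo d ∧ hi d = hi a) ∨
        (hi a = hi b ∧ lo b = lo c ∧ hi c = hi d ∧ lo d = lo a)) := by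
  simp only [Sq, h.opp_iff]
  constructor
  · rintro ⟨⟨ab, bc, h₁⟩, ⟨-, cd, h₂⟩, ⟨-, da, h₃⟩, -⟩
    refine ⟨ab, bc, cd, da, ?_⟩
    rcases h₁ with ⟨e₁, e₂⟩ | ⟨e₁, e₂⟩
    · rcases h₂ with ⟨e₃, e₄⟩ | ⟨e₃, e₄⟩
      · exact absurd (h.ext e₃ e₂) bc.1
      · rcases h₃ with ⟨e₅, e₆⟩ | ⟨e₅, e₆⟩
        · exact .inl ⟨e₁, e₂, e₄, e₆⟩
        · exact absurd (h.ext e₄ e₅) cd.1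
    · rcases h₂ with ⟨e₃, e₄⟩ | ⟨e₃, e₄⟩
      · rcases h₃ with ⟨e₅, e₆⟩ | ⟨e₅, e₆⟩
        · exact absurd (h.ext e₅ e₄) cd.1
        · exact .inr ⟨e₁, e₂, e₄, e₆⟩
      · exact absurd (h.ext e₂ e₃) bc.1
  · rintro ⟨ab, bc, cd, da, ⟨e₁, e₂, e₃, e₄⟩ | ⟨e₁, e₂, e₃, e₄⟩⟩
    · exact ⟨⟨ab, bc, .inl ⟨e₁, e₂⟩⟩, ⟨bc, cd, .inr ⟨e₂, e₃⟩⟩, ⟨cd, da, .inl ⟨e₃, e₄⟩⟩,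
        ⟨da, ab, .inr ⟨e₄, e₁⟩⟩⟩
    · exact ⟨⟨ab, bc, .inr ⟨e₁, e₂⟩⟩, ⟨bc, cd, .inl ⟨e₂, e₃⟩⟩, ⟨cd, da, .inr ⟨e₃, e₄⟩⟩,
        ⟨da, ab, .inl ⟨e₄, e₁⟩⟩⟩

/-- The lines of a square pass through a common point. -/
theorem exists_on_of_sq (h : LineGeom r W k m Q lo hi δ) {a b c d : L} (hs : Sq δ a b c d) :
    ∃ U, Q U ∧ On lo hi U a ∧ On lo hi U b ∧ On lo hi U c ∧ On lo hi U d := by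
  obtain ⟨ab, bc, cd, da, hs⟩ := h.sq_iff.1 hs
  obtain ⟨-, U, qU, Ua, Ub⟩ := (h.adj ab.1).1 ab.2
  have R := h.spine.rank
  have rU := h.rank_of_Q qU
  have e₁ := h.rank_hi a
  have e₂ := h.rank_hi b
  have e₃ := h.rank_lo a
  have e₄ := h.rank_lo b
  have key : ∀ l, (lo l ≤ hi a ⊓ hi b ∨ hi a = hi b) → (lo a ⊔ lo b ≤ hi l ∨ lo a = lo b) →
      (hi a = hi b → lo l ≤ U) → (lo a = lo b → U ≤ hi l) → On lo hi U l := by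
    intro l h₁ h₂ h₃ h₄
    constructor
    · rcases h₁ with h₁ | h₁
      · by_cases e : hi a = hi b
        · exact h₃ e
        · rwa [R.inf_eq Ua.2 Ub.2 (by omega) (by omega) e] at h₁
      · exact h₃ h₁
    · rcases h₂ with h₂ | h₂
      · by_cases e : lo a = lo b
        · exact h₄ e
        · rwa [R.sup_eq Ua.1 Ub.1 (by omega) (by omega) e] at h₂
      · exact h₄ h₂
  refine ⟨U, qU, Ua, Ub, ?_⟩
  rcases hs with ⟨g₁, g₂, g₃, g₄⟩ | ⟨g₁, g₂, g₃, g₄⟩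
  · have nab : hi a ≠ hi b := fun e => ab.1 (h.ext g₁ e)
    have hc : lo c ≤ hi a ⊓ hi b :=
      le_inf (g₃ ▸ g₄ ▸ (h.line d).1) (g₂ ▸ (h.line c).1)
    exact ⟨key c (.inl hc) (.inr g₁) (absurd · nab) (fun _ => g₂ ▸ Ub.2),
      key d (.inl (g₃ ▸ hc)) (.inr g₁) (absurd · nab) (fun _ => g₄ ▸ Ua.2)⟩
  · have nab : lo a ≠ lo b := fun e => ab.1 (h.ext e g₁)
    have hc : lo a ⊔ lo b ≤ hi c :=
      sup_le (g₃ ▸ g₄ ▸ (h.line d).1) (g₂ ▸ (h.line c).1)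
    exact ⟨key c (.inr g₁) (.inl hc) (fun _ => g₂ ▸ Ub.1) (absurd · nab),
      key d (.inr g₁) (.inl (g₃ ▸ hc)) (fun _ => g₄ ▸ Ua.1) (absurd · nab)⟩

theorem sq_of_on (h : LineGeom r W k m Q lo hi δ) {a b c d : L} {U : α} (qU : Q U)
    (Ua : On lo hi U a) (Ub : On lo hi U b) (Uc : On lo hi U c) (Ud : On lo hi U d)
    (e₁ : lo a = lo b) (e₂ : hi b = hi c) (e₃ : lo c = lo d) (e₄ : hi d = hi a)
    (hlo : lo a ≠ lo c) (hhi : hi a ≠ hi b) : Sq δ a b c d := by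
  refine h.sq_iff.2 ⟨h.nb_of_lo ?_ e₁ qU Ua Ub, h.nb_of_hi ?_ e₂ qU Ub Uc,
    h.nb_of_lo ?_ e₃ qU Uc Ud, h.nb_of_hi ?_ e₄ qU Ud Ua, .inl ⟨e₁, e₂, e₃, e₄⟩⟩
  · rintro rfl; exact hhi rfl
  · rintro rfl; exact hlo e₁
  · rintro rfl; exact hhi (e₄.symm.trans e₂.symm)
  · rintro rfl; exact hlo e₃.symm

theorem sq_of_on' (h : LineGeom r W k m Q lo hi δ) {a b c d : L} {U : α} (qU : Q U)
    (Ua : On lo hi U a) (Ub : On lo hi U b) (Uc : On lo hi U c) (Ud : On lo hi U d)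
    (e₁ : hi a = hi b) (e₂ : lo b = lo c) (e₃ : hi c = hi d) (e₄ : lo d = lo a)
    (hhi : hi a ≠ hi c) (hlo : lo a ≠ lo b) : Sq δ a b c d :=
  h.dual.sq_of_on (U := OrderDual.toDual U) qU Ua.symm Ub.symm Uc.symm Ud.symm e₁ e₂ e₃ e₄ hhi hlo

theorem on_of_lin (h : LineGeom r W k m Q lo hi δ) {a b c d : L} {U : α} (rU : r U = k)
    (Ua : On lo hi U a) (Ub : On lo hi U b) (Uc : On lo hi U c) (Ud : On lo hi U d) (n : ℕ) :
    ∀ l, Lin δ n a b c d l → On lo hi U l := by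
  induction n with
  | zero => rintro l (rfl | rfl | rfl | rfl) <;> assumption
  | succ n ih =>
    rintro l (hl | ⟨p, q, s, hp, hq, hs⟩)
    · exact ih l hl
    · obtain ⟨V, qV, Vp, Vq, Vl, -⟩ := h.exists_on_of_sq hs
      have := h.eq_of_on hs.1.1.1 rU (h.rank_of_Q qV) (ih p hp) (ih q hq) Vp Vq
      rwa [this]

end LineGeom

end LineGeom

/-! ### Squares of lines and points -/

section Squares

variable {α : Type*} [Lattice α] [BoundedOrder α] {L : Type*}

/-- The square `a b c d` encodes the point `U`. -/
def SqAt (δ : L → L → Prop) (lo hi : L → α) (U : α) (a b c d : L) : Prop :=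
  Sq δ a b c d ∧ On lo hi U a ∧ On lo hi U b ∧ On lo hi U c ∧ On lo hi U d

/-- `H` is a hyperplane of `U` that meets `W` in rank `m`. Together with the upper end of any line
of the spine space through `U` it determines a line. -/
def IsAlpha (r : α → ℕ) (W : α) (k m : ℕ) (U H : α) : Prop :=
  H ≤ U ∧ r H + 1 = k ∧ r (H ⊓ W) = m

namespace LineGeom

variable {r : α → ℕ} {W : α} {k m : ℕ} {Q : α → Prop} {lo hi : L → α} {δ : L → L → Prop}

theorem types_of_on (h : LineGeom r W k m Q lo hi δ) {l : L} {U : α} (rU : r U = k)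
    (Ul : On lo hi U l) (hp : ¬ Proper r W k m U) :
    r (lo l ⊓ W) = m ∧ r (hi l ⊓ W) = m + 1 ∧ r (U ⊓ W) = m + 1 :=
  h.spine.rank.types_of_not_proper (h.line l) rU Ul.1 Ul.2 hp

theorem exists_line_of_alpha (h : LineGeom r W k m Q lo hi δ) {l : L} {U H : α} (rU : r U = k)
    (Ul : On lo hi U l) (hH : IsAlpha r W k m U H) :
    ∃ l', lo l' = H ∧ hi l' = hi l ∧ On lo hi U l' := by
  have R := h.spine.rank
  obtain ⟨l', e₁, e₂⟩ : ∃ l', lo l' = H ∧ hi l' = hi l := by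
    apply h.exists_line
    by_cases hp : Proper r W k m U
    · exact R.isLine_of_proper hH.2.1 (h.rank_hi l) hp hH.1 Ul.2 (.inl hH.2.2)
    · exact R.isLine_affine (hH.1.trans Ul.2) hH.2.1 (h.rank_hi l) hH.2.2
        (h.types_of_on rU Ul hp).2.1
  exact ⟨l', e₁, e₂, e₁.trans_le hH.1, Ul.2.trans_eq e₂.symm⟩

theorem exists_alpha_ne (h : LineGeom r W k m Q lo hi δ) {l : L} {U H : α}
    (hb : Proper r W k m U → m + 2 ≤ k) (rU : r U = k) (Ul : On lo hi U l) (hHU : H ≤ U)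
    (hH : r H + 1 = k) :
    ∃ H', IsAlpha r W k m U H' ∧ H' ≠ H := by
  have R := h.spine.rank
  have e₀ := R.bot
  by_cases hp : Proper r W k m U
  · have e₁ := hp.2
    have hb := hb hp
    obtain ⟨c, c₁, c₂, c₃, c₄⟩ := R.coatom (x := U ⊓ W) (y := H) (z := U) inf_le_left hHU
      (R.not_le_of_rank_lt (by omega))
    have e₂ : c ⊓ W = U ⊓ W := le_antisymm (inf_le_inf_right W c₂) (le_inf c₁ inf_le_right)
    exact ⟨c, ⟨c₂, by omega, by rw [e₂, e₁]⟩, fun e => c₄ e.ge⟩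
  · have e₁ := (h.types_of_on rU Ul hp).2.2
    have e₃ := h.spine.two_le
    obtain ⟨c, -, c₂, c₃, c₄, c₅⟩ := R.coatom₂ (x := ⊥) (z := U) (y₁ := U ⊓ W) (y₂ := H) bot_le
      inf_le_left hHU (R.not_le_of_rank_lt (by omega)) (R.not_le_of_rank_lt (by omega))
    refine ⟨c, ⟨c₂, by omega, ?_⟩, fun e => c₅ e.ge⟩
    have e₂ := R.inf_le_add c₂ W
    by_contra hne
    have e₃ := R.eq_of_le (inf_le_inf_right W c₂) (by omega)
    exact c₄ (e₃.symm.trans_le inf_le_left)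

theorem exists_hi_ne (h : LineGeom r W k m Q lo hi δ) {l : L} {U : α} (rU : r U = k)
    (Ul : On lo hi U l) (hl : r (lo l ⊓ W) = m) :
    ∃ l', lo l' = lo l ∧ hi l' ≠ hi l ∧ On lo hi U l' := by
  have R := h.spine.rank
  have e₀ := h.rank_hi l
  have e₁ := h.spine.le_top
  have e₂ := h.spine.le_sup
  have e₃ := R.mod U W
  have e₄ : ¬ ⊤ ≤ hi l := R.not_le_of_rank_lt (by omega)
  obtain ⟨B, b₁, b₂, b₃⟩ : ∃ B, U ≤ B ∧ B ≠ hi l ∧ IsLine r W k m (lo l) B := by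
    by_cases hp : Proper r W k m U
    · obtain ⟨B, b₁, -, b₃, b₄⟩ := R.atom Ul.2 le_top e₄
      exact ⟨B, b₁, fun e => b₄ e.le,
        R.isLine_of_proper (h.rank_lo l) (by omega) hp Ul.1 b₁ (.inl hl)⟩
    · have e₅ := h.types_of_on rU Ul hp
      obtain ⟨B, b₁, -, b₃, b₄, b₅⟩ := R.atom₂ (x := U) (y₁ := U ⊔ W) le_top le_sup_left Ul.2
        (R.not_le_of_rank_lt (by omega)) e₄
      have e₆ := R.mod B W
      have e₇ := R.mono (inf_le_inf_right W b₁)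
      have e₈ : r (U ⊔ W) < r (B ⊔ W) := R.lt <| lt_of_le_of_ne (sup_le_sup_right b₁ W)
        fun e => b₄ (e ▸ le_sup_left)
      exact ⟨B, b₁, fun e => b₅ e.le, R.isLine_affine (Ul.1.trans b₁) (h.rank_lo l) (by omega) hl
        (by omega)⟩
  obtain ⟨l', g₁, g₂⟩ := h.exists_line b₃
  exact ⟨l', g₁, fun e => b₂ (g₂ ▸ e), g₁.trans_le Ul.1, b₁.trans_eq g₂.symm⟩

theorem exists_hi_ne' (h : LineGeom r W k m Q lo hi δ) (hw : m + 2 ≤ r W) {l : L} {U : α}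
    (hU : Proper r W k m U) (Ul : On lo hi U l) :
    ∃ l', lo l' = lo l ∧ hi l' ≠ hi l ∧ On lo hi U l' := by
  have R := h.spine.rank
  have e₀ := h.rank_hi l
  have e₁ := hU.1
  have e₂ := hU.2
  have e₃ := R.mod U W
  obtain ⟨B, b₁, b₂, b₃, b₄⟩ := R.atom (x := U) (y := hi l) (z := U ⊔ W) Ul.2 le_sup_left
    (R.not_le_of_rank_lt (by omega))
  have e₄ : B ⊔ W = U ⊔ W := le_antisymm (sup_le b₂ le_sup_right) (sup_le_sup_right b₁ W)
  have e₅ := R.mod B W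
  rw [e₄] at e₅
  obtain ⟨l', g₁, g₂⟩ := h.exists_line
    (R.isLine_of_proper (h.rank_lo l) (by omega : r B = k + 1) hU Ul.1 b₁ (.inr (by omega)))
  exact ⟨l', g₁, fun e => b₄ (g₂ ▸ e).le, g₁.trans_le Ul.1, b₁.trans_eq g₂.symm⟩

theorem exists_sqAt (h : LineGeom r W k m Q lo hi δ) {l l' : L} {U H' : α} (qU : Q U)
    (Ul : On lo hi U l) (hlo : lo l' = lo l) (hhi : hi l' ≠ hi l) (Ul' : On lo hi U l')
    (hH' : IsAlpha r W k m U H') (hne : H' ≠ lo l) : ∃ b c d, SqAt δ lo hi U l b c d := by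
  have rU := h.rank_of_Q qU
  obtain ⟨c, c₁, c₂, Uc⟩ := h.exists_line_of_alpha rU Ul' hH'
  obtain ⟨d, d₁, d₂, Ud⟩ := h.exists_line_of_alpha rU Ul hH'
  exact ⟨l', c, d, h.sq_of_on qU Ul Ul' Uc Ud hlo.symm c₂.symm (c₁.trans d₁.symm) d₂
    (fun e => hne (c₁ ▸ e.symm)) hhi.symm, Ul, Ul', Uc, Ud⟩

theorem exists_sqAt_of_alpha (h : LineGeom r W k m Q lo hi δ) (hb : m + 2 ≤ k) {l : L} {U : α}
    (qU : Q U) (Ul : On lo hi U l) (hl : r (lo l ⊓ W) = m) : ∃ b c d, SqAt δ lo hi U l b c d := by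
  have rU := h.rank_of_Q qU
  obtain ⟨l', e₁, e₂, e₃⟩ := h.exists_hi_ne rU Ul hl
  obtain ⟨H', h₁, h₂⟩ := h.exists_alpha_ne (fun _ => hb) rU Ul Ul.1 (h.rank_lo l)
  exact h.exists_sqAt qU Ul e₁ e₂ e₃ h₁ h₂

theorem exists_proper (h : LineGeom r W k m Q lo hi δ) (l : L) :
    ∃ U, Proper r W k m U ∧ On lo hi U l := by
  obtain ⟨-, -, -, U, -, -, h₁, -, h₂, h₃, -⟩ := h.line l
  exact ⟨U, h₁, h₂, h₃⟩

theorem inSq_of_alpha (h : LineGeom r W k m Q lo hi δ) (hb : m + 2 ≤ k) {l : L}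
    (hl : r (lo l ⊓ W) = m) : InSq δ l := by
  obtain ⟨U, hU, Ul⟩ := h.exists_proper l
  obtain ⟨b, c, d, hs, -⟩ := h.exists_sqAt_of_alpha hb (h.Q_of_proper hU) Ul hl
  exact ⟨b, c, d, hs⟩

theorem inSq_of_rank (h : LineGeom r W k m Q lo hi δ) (hb : m + 2 ≤ k) (hw : m + 2 ≤ r W) (l : L) :
    InSq δ l := by
  obtain ⟨U, hU, Ul⟩ := h.exists_proper l
  obtain ⟨l', e₁, e₂, e₃⟩ := h.exists_hi_ne' hw hU Ul
  obtain ⟨H', h₁, h₂⟩ := h.exists_alpha_ne (fun _ => hb) hU.1 Ul Ul.1 (h.rank_lo l)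
  obtain ⟨b, c, d, hs, -⟩ := h.exists_sqAt (h.Q_of_proper hU) Ul e₁ e₂ e₃ h₁ h₂
  exact ⟨b, c, d, hs⟩

/-- If the common lower end of two lines meets `W` in rank `m - 1`, then their upper ends meet `W` in
rank `m + 1` and the common point of the lines meets it in rank `m` only, so `W` has rank at
least `m + 2`. -/
theorem rank_of_nb_lo (h : LineGeom r W k m Q lo hi δ) {l l' : L} (hn : Nb δ l l')
    (hlo : lo l = lo l') (hl : r (lo l ⊓ W) ≠ m) : m + 2 ≤ r W := by
  have R := h.spine.rank
  obtain ⟨-, U, qU, Ul, Ul'⟩ := (h.adj hn.1).1 hn.2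
  have rU := h.rank_of_Q qU
  have e₁ := R.isLine_types (h.line l)
  have e₂ := R.isLine_types (h.line l')
  rw [← hlo] at e₂
  have e₃ := R.mod (hi l ⊓ W) (hi l' ⊓ W)
  have hhi : hi l ≠ hi l' := fun e => hn.1 (h.ext hlo e)
  rw [← inf_inf_distrib_right, R.inf_eq Ul.2 Ul'.2 (by rw [h.rank_hi l, rU])
    (by rw [h.rank_hi l', rU]) hhi] at e₃
  have hU : Proper r W k m U := by
    by_contra hp
    exact hl (h.types_of_on rU Ul hp).1
  have e₄ := hU.2
  have e₅ := R.mono (sup_le inf_le_right inf_le_right : hi l ⊓ W ⊔ hi l' ⊓ W ≤ W)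
  omega

theorem rank_of_inSq (h : LineGeom r W k m Q lo hi δ) {l : L} (hs : InSq δ l)
    (hl : r (lo l ⊓ W) ≠ m) : m + 2 ≤ r W := by
  obtain ⟨b, c, d, hs⟩ := hs
  obtain ⟨ab, bc, cd, da, ⟨e₁, e₂, e₃, e₄⟩ | ⟨e₁, e₂, e₃, e₄⟩⟩ := h.sq_iff.1 hs
  · exact h.rank_of_nb_lo ab e₁ hl
  · exact h.rank_of_nb_lo (h.symm da) e₄.symm hl

/-- From a square at `U` one reaches every line through `U` with a lower end as in `IsAlpha`
in two steps. -/
theorem lin_of_alpha (h : LineGeom r W k m Q lo hi δ) (hb : m + 2 ≤ k) {a b c d l : L} {U : α}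
    (qU : Q U) (hs : SqAt δ lo hi U a b c d) (Ul : On lo hi U l) (hl : r (lo l ⊓ W) = m) :
    Lin δ 2 a b c d l := by
  have rU := h.rank_of_Q qU
  obtain ⟨u, v, hu, hv, Uu, Uv, huv, hne⟩ : ∃ u v, Lin δ 0 a b c d u ∧ Lin δ 0 a b c d v ∧
      On lo hi U u ∧ On lo hi U v ∧ lo u = lo v ∧ hi u ≠ hi v := by
    obtain ⟨hs, Ua, Ub, Uc, Ud⟩ := hs
    obtain ⟨ab, bc, cd, da, ⟨e₁, e₂, e₃, e₄⟩ | ⟨e₁, e₂, e₃, e₄⟩⟩ := h.sq_iff.1 hs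
    · exact ⟨a, b, .inl rfl, .inr (.inl rfl), Ua, Ub, e₁, fun e => ab.1 (h.ext e₁ e)⟩
    · exact ⟨b, c, .inr (.inl rfl), .inr (.inr (.inl rfl)), Ub, Uc, e₂,
        fun e => bc.1 (h.ext e₂ e)⟩
  have step : ∀ u v, Lin δ 0 a b c d u → Lin δ 0 a b c d v → On lo hi U u → On lo hi U v →
      lo u = lo v → hi u ≠ hi v → ∀ q, On lo hi U q → r (lo q ⊓ W) = m → hi q = hi v →
      Lin δ 1 a b c d q := by
    intro u v hu hv Uu Uv huv hne q Uq hq hqv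
    by_cases e : lo q = lo v
    · exact h.ext e hqv ▸ .inl hv
    · obtain ⟨p, p₁, p₂, Up⟩ := h.exists_line_of_alpha rU Uu ⟨Uq.1, h.rank_lo q, hq⟩
      exact .inr ⟨u, v, p, hu, hv, h.sq_of_on qU Uu Uv Uq Up huv hqv.symm p₁.symm p₂
        (fun e' => e (e'.symm.trans huv)) hne⟩
  have hα : IsAlpha r W k m U (lo l) := ⟨Ul.1, h.rank_lo l, hl⟩
  by_cases e : hi l = hi u
  · exact .inl (step v u hv hu Uv Uu huv.symm hne.symm l Ul hl e)
  · obtain ⟨H', hH', hne'⟩ := h.exists_alpha_ne (fun _ => hb) rU Ul hα.1 hα.2.1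
    obtain ⟨p, p₁, p₂, Up⟩ := h.exists_line_of_alpha rU Uu hH'
    obtain ⟨q, q₁, q₂, Uq⟩ := h.exists_line_of_alpha rU Uu hα
    obtain ⟨s, s₁, s₂, Us⟩ := h.exists_line_of_alpha rU Ul hH'
    refine .inr ⟨p, q, s, ?_, ?_, h.sq_of_on' qU Up Uq Ul Us (p₂.trans q₂.symm) q₁ s₂.symm
      (s₁.trans p₁.symm) (fun e' => e (e'.symm.trans p₂)) (by rwa [p₁, q₁])⟩
    · exact step v u hv hu Uv Uu huv.symm hne.symm p Up (by rw [p₁]; exact hH'.2.2) p₂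
    · exact step v u hv hu Uv Uu huv.symm hne.symm q Uq (by rw [q₁]; exact hl) q₂

/-- If `W` is large, then from a square at a proper point `U` one reaches every line
through `U` in three steps. -/
theorem lin_of_rank (h : LineGeom r W k m Q lo hi δ) (hb : m + 2 ≤ k) (hw : m + 2 ≤ r W)
    {a b c d l : L} {U : α} (hU : Proper r W k m U) (hs : SqAt δ lo hi U a b c d)
    (Ul : On lo hi U l) : Lin δ 3 a b c d l := by
  have qU := h.Q_of_proper hU
  obtain ⟨s, s₁, s₂, Us⟩ := h.exists_hi_ne' hw hU Ul
  obtain ⟨H, hH, hne⟩ := h.exists_alpha_ne (fun _ => hb) hU.1 Ul Ul.1 (h.rank_lo l)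
  obtain ⟨p, p₁, p₂, Up⟩ := h.exists_line_of_alpha hU.1 Us hH
  obtain ⟨q, q₁, q₂, Uq⟩ := h.exists_line_of_alpha hU.1 Ul hH
  exact .inr ⟨p, q, s, h.lin_of_alpha hb qU hs Up (by rw [p₁]; exact hH.2.2),
    h.lin_of_alpha hb qU hs Uq (by rw [q₁]; exact hH.2.2),
    h.sq_of_on qU Up Uq Ul Us (p₁.trans q₁.symm) q₂ s₁.symm p₂.symm
      (fun e => hne (p₁.symm.trans e)) (by rwa [p₂, q₂])⟩

theorem sqInc_of_on (h : LineGeom r W k m Q lo hi δ) (hb : m + 2 ≤ k) {a b c d l : L} {U : α}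
    (qU : Q U) (hs : SqAt δ lo hi U a b c d) (Ul : On lo hi U l) : SqInc δ a b c d l := by
  have rU := h.rank_of_Q qU
  by_cases hl : r (lo l ⊓ W) = m
  · exact .inl (.inl (h.lin_of_alpha hb qU hs Ul hl))
  have hU : Proper r W k m U := by
    by_contra hp
    exact hl (h.types_of_on rU Ul hp).1
  by_cases hw : m + 2 ≤ r W
  · exact .inl (h.lin_of_rank hb hw hU hs Ul)
  by_cases hL : Lin δ 3 a b c d l
  · exact .inl hL
  obtain ⟨H, hH, hne⟩ := h.exists_alpha_ne (fun _ => hb) rU Ul Ul.1 (h.rank_lo l)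
  obtain ⟨p, p₁, p₂, Up⟩ := h.exists_line_of_alpha rU Ul hH
  have hpl : Nb δ p l := h.nb_of_hi (fun e => hne (p₁ ▸ e ▸ rfl)) p₂ qU Up Ul
  refine .inr ⟨fun hs' => hw (h.rank_of_inSq hs' hl), p,
    .inl (h.lin_of_alpha hb qU hs Up (by rw [p₁]; exact hH.2.2)), hpl, fun q hq hqp => ?_⟩
  have Uq := h.on_of_lin rU hs.2.1 hs.2.2.1 hs.2.2.2.1 hs.2.2.2.2 3 q hq
  rcases ((h.adj hqp.1).1 hqp.2).1 with e | e
  · exact .inr (h.opp_of_lo_hi hqp hpl e p₂)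
  · exact .inl (h.nb_of_hi (fun e' => hL (e' ▸ hq)) (e.trans p₂) qU Uq Ul)

theorem on_of_sqInc (h : LineGeom r W k m Q lo hi δ) (hb : m + 2 ≤ k) {a b c d l : L} {U : α}
    (qU : Q U) (hs : SqAt δ lo hi U a b c d) (hl : SqInc δ a b c d l) : On lo hi U l := by
  have rU := h.rank_of_Q qU
  have R := h.spine.rank
  have hlin := h.on_of_lin rU hs.2.1 hs.2.2.1 hs.2.2.2.1 hs.2.2.2.2 3
  rcases hl with hl | ⟨hns, p, hp, hpl, hall⟩
  · exact hlin l hl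
  have Up := hlin p hp
  have hlα : r (lo l ⊓ W) ≠ m := fun e => hns (h.inSq_of_alpha hb e)
  have hw : ¬ m + 2 ≤ r W := fun e => hns (h.inSq_of_rank hb e l)
  have hhi : hi p = hi l := by
    rcases ((h.adj hpl.1).1 hpl.2).1 with e | e
    · exact absurd (h.rank_of_nb_lo (h.symm hpl) e.symm hlα) hw
    · exact e
  have hUl : U ≤ hi l := Up.2.trans_eq hhi
  refine ⟨?_, hUl⟩
  by_contra hlo
  have e₁ := h.rank_lo l
  have e₂ := h.rank_hi l
  have e₃ := R.isLine_types (h.line l)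
  have e₄ := R.mod (lo l) U
  have e₅ : r (lo l ⊔ U) ≤ r (hi l) := R.mono (sup_le (h.line l).1 hUl)
  have e₆ : r U < r (lo l ⊔ U) := R.lt (lt_of_le_of_ne le_sup_right fun e => hlo (e ▸ le_sup_left))
  -- A hyperplane of `U` that gives a line below `hi l` lies above `lo l ⊓ U`.
  have key : ∀ H, IsAlpha r W k m U H → lo l ⊓ U ≤ H := by
    intro H hH
    obtain ⟨q, q₁, q₂, Uq⟩ := h.exists_line_of_alpha rU Up hH
    have hq : Lin δ 3 a b c d q := .inl (h.lin_of_alpha hb qU hs Uq (by rw [q₁]; exact hH.2.2))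
    have hql : Nb δ q l := by
      by_cases e : q = p
      · exact e ▸ hpl
      have hqp : Nb δ q p := h.nb_of_hi e q₂ qU Uq Up
      rcases hall q hq hqp with h₁ | h₁
      · exact h₁
      · exact absurd h₁ (h.dual.not_opp_of_lo q₂ hhi)
    obtain ⟨-, V, qV, Vq, Vl⟩ := (h.adj hql.1).1 hql.2
    have e₇ := R.mod (lo l) H
    have e₈ : r (lo l ⊔ H) ≤ r V := R.mono (sup_le Vl.1 (q₁ ▸ Vq.1))
    have e₉ := h.rank_of_Q qV
    have e₁₀ := hH.2.1
    have e₁₁ := R.eq_of_le (inf_le_inf_left (lo l) hH.1) (by omega)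
    exact e₁₁.symm.trans_le inf_le_right
  have e₇ : lo l ⊓ U ≤ U := inf_le_right
  have e₈ := R.bot
  by_cases hU : Proper r W k m U
  · have e₉ := hU.2
    have e₁₀ : ¬ lo l ⊓ U ≤ U ⊓ W := fun e => by
      have := R.mono (le_inf inf_le_left (e.trans inf_le_right) : lo l ⊓ U ≤ lo l ⊓ W)
      omega
    obtain ⟨c, c₁, c₂, c₃, c₄⟩ := R.coatom (x := U ⊓ W) inf_le_left e₇ e₁₀
    have e₁₁ : c ⊓ W = U ⊓ W := le_antisymm (inf_le_inf_right W c₂) (le_inf c₁ inf_le_right)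
    exact c₄ (key c ⟨c₂, by omega, by rw [e₁₁, e₉]⟩)
  · have e₉ := (h.types_of_on rU Up hU).2.2
    obtain ⟨c, -, c₂, c₃, c₄, c₅⟩ := R.coatom₂ (x := ⊥) (z := U) (y₁ := U ⊓ W) bot_le
      inf_le_left e₇ (R.not_le_of_rank_lt (by omega)) (R.not_le_of_rank_lt (by omega))
    refine c₅ (key c ⟨c₂, by omega, ?_⟩)
    have e₁₀ := R.inf_le_add c₂ W
    by_contra hne
    have e₁₁ := R.eq_of_le (inf_le_inf_right W c₂) (by omega)
    exact c₄ (e₁₁.symm.trans_le inf_le_left)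

/-- An improper point `U` is bad: the top of a line through `U` has another improper point, and no
line of the spine space has two improper points on its closure. -/
theorem bad_of_not_proper (h : LineGeom r W k m Q lo hi δ) (hb : m + 2 ≤ k) {a b c d : L} {U : α}
    (qU : Q U) (hs : SqAt δ lo hi U a b c d) (hU : ¬ Proper r W k m U) : Bad δ a b c d := by
  have R := h.spine.rank
  have rU := h.rank_of_Q qU
  have Ua := hs.2.1
  obtain ⟨t₁, t₂, t₃⟩ := h.types_of_on rU Ua hU
  have e₁ := h.rank_lo a
  have e₂ := h.rank_hi a
  have hWU : hi a ⊓ W ≤ U :=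
    (R.eq_of_le (inf_le_inf_right W Ua.2) (by omega)).symm.trans_le inf_le_left
  obtain ⟨U', u₁, u₂, u₃, u₄⟩ := R.coatom (x := hi a ⊓ W) (y := U) (z := hi a) inf_le_left Ua.2
    (R.not_le_of_rank_lt (by omega))
  have rU' : r U' = k := by omega
  have hWU' : U' ⊓ W = hi a ⊓ W := le_antisymm (inf_le_inf_right W u₂) (le_inf u₁ inf_le_right)
  have hU' : ¬ Proper r W k m U' := fun hp => by have := hp.2; rw [hWU'] at this; omega
  have hnW : ¬ hi a ⊓ W ≤ lo a := fun e => by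
    have := R.mono (le_inf e inf_le_right : hi a ⊓ W ≤ lo a ⊓ W)
    omega
  have hnU' : ¬ lo a ≤ U' := fun e => by
    have hne : U ≠ U' := fun e' => u₄ e'.le
    rw [← R.inf_eq Ua.1 e (by omega) (by omega) hne] at hnW
    exact hnW (le_inf hWU u₁)
  have e₃ := R.mod (lo a) U'
  have e₄ : r (lo a ⊔ U') ≤ r (hi a) := R.mono (sup_le (Ua.1.trans Ua.2) u₂)
  have e₅ : r U' < r (lo a ⊔ U') :=
    R.lt (lt_of_le_of_ne le_sup_right fun e => hnU' (e ▸ le_sup_left))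
  obtain ⟨H, h₁, h₂, h₃, h₄⟩ := R.coatom (x := lo a ⊓ U') (y := hi a ⊓ W) (z := U') inf_le_right u₁
    fun e => hnW (e.trans inf_le_left)
  have e₆ := R.inf_le_add (h₂.trans u₂) W
  have e₇ := R.inf_le_add h₂ W
  rw [hWU'] at e₇
  have e₈ : r (H ⊓ W) ≠ m + 1 := fun e => by
    have := R.eq_of_le (inf_le_inf_right W (h₂.trans u₂)) (by omega)
    exact h₄ (this.symm.trans_le inf_le_left)
  have e₉ := R.mono (inf_le_inf_right W (h₂.trans u₂))
  obtain ⟨l', l₁, l₂⟩ := h.exists_line (R.isLine_affine (h₂.trans u₂) (by omega : r H + 1 = k) e₂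
    (by omega : r (H ⊓ W) = m) t₂)
  have qU' := h.Q_of_rank qU hU rU'
  have Ul' : On lo hi U' l' := ⟨l₁.trans_le h₂, u₂.trans_eq l₂.symm⟩
  obtain ⟨b', c', d', hs'⟩ := h.exists_sqAt_of_alpha hb qU' Ul' (by rw [l₁]; omega)
  refine ⟨l', b', c', d', hs'.1, ⟨a, l', .inl rfl, .inl rfl, ?_⟩, ?_⟩
  · have hne : lo a ≠ H := fun e => hnU' (e ▸ h₂)
    have f₁ := R.mod (lo a) H
    have f₂ := R.mono (le_inf inf_le_left h₁ : lo a ⊓ U' ≤ lo a ⊓ H)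
    have f₃ : r H < r (lo a ⊔ H) := R.lt (lt_of_le_of_ne le_sup_right fun e =>
      hne (R.eq_of_le (e ▸ le_sup_left) (by omega)))
    refine h.nb_of_hi (U := lo a ⊔ H) (fun e => hne (e ▸ l₁)) l₂.symm
      (h.Q_of_rank qU hU (by omega)) ⟨le_sup_left, sup_le (Ua.1.trans Ua.2) (h₂.trans u₂)⟩
      ⟨l₁.trans_le le_sup_right, l₂ ▸ sup_le (Ua.1.trans Ua.2) (h₂.trans u₂)⟩
  · rintro ⟨x, x₁, x₂⟩
    have Ux := h.on_of_sqInc hb qU hs x₁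
    have Ux' := h.on_of_sqInc hb qU' hs' x₂
    obtain ⟨s₁, s₂, -⟩ := h.types_of_on rU Ux hU
    exact u₄ (R.eq_of_rank_inf (h.rank_lo x) (h.rank_hi x) s₁ rU Ux.1 Ux.2 t₃ rU' Ux'.1 Ux'.2
      (by rw [hWU', t₂]) s₂).le

theorem not_bad_of_proper (h : LineGeom r W k m Q lo hi δ) (hb : m + 2 ≤ k) {a b c d : L} {U : α}
    (hU : Proper r W k m U) (hs : SqAt δ lo hi U a b c d) : ¬ Bad δ a b c d := by
  rintro ⟨a', b', c', d', hs', ⟨l, l', hl, hl', hn⟩, hx⟩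
  have R := h.spine.rank
  have qU := h.Q_of_proper hU
  obtain ⟨V, qV, hV⟩ := h.exists_on_of_sq hs'
  have rV := h.rank_of_Q qV
  have Ul := h.on_of_lin hU.1 hs.2.1 hs.2.2.1 hs.2.2.2.1 hs.2.2.2.2 0 l hl
  have Vl' := h.on_of_lin rV hV.1 hV.2.1 hV.2.2.1 hV.2.2.2 0 l' hl'
  obtain ⟨x, Ux, Vx⟩ : ∃ x, On lo hi U x ∧ On lo hi V x := by
    by_cases hne : V = U
    · exact ⟨l, Ul, hne ▸ Ul⟩
    rcases ((h.adj hn.1).1 hn.2).1 with e | e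
    · obtain ⟨x, x₁, x₂⟩ := h.exists_line
        (R.isLine_sup (h.line l') rV Vl'.1 Vl'.2 hU (e ▸ Ul.1) hne)
      exact ⟨x, ⟨x₁.trans_le (e ▸ Ul.1), x₂ ▸ le_sup_right⟩,
        ⟨x₁.trans_le Vl'.1, x₂ ▸ le_sup_left⟩⟩
    · obtain ⟨x, x₁, x₂⟩ := h.exists_line
        (h.spine.isLine_inf (h.line l') rV Vl'.1 Vl'.2 hU (e ▸ Ul.2) hne)
      exact ⟨x, ⟨x₁ ▸ inf_le_right, (e ▸ Ul.2 : U ≤ hi l').trans_eq x₂.symm⟩,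
        ⟨x₁ ▸ inf_le_left, Vl'.2.trans_eq x₂.symm⟩⟩
  exact hx ⟨x, h.sqInc_of_on hb qU hs Ux, h.sqInc_of_on hb qV ⟨hs', hV⟩ Vx⟩

theorem exists_sqAt_of_proper (h : LineGeom r W k m Q lo hi δ) (hb : m + 2 ≤ k) {U : α}
    (hU : Proper r W k m U) : ∃ a b c d, SqAt δ lo hi U a b c d := by
  have R := h.spine.rank
  have e₀ := h.spine.le_top
  obtain ⟨rU, mU⟩ := hU
  obtain ⟨c, c₁, c₂, c₃, -⟩ := R.coatom (x := U ⊓ W) (y := U) (z := U) inf_le_left le_rfl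
      (R.not_le_of_rank_lt (by omega))
  have e₁ : c ⊓ W = U ⊓ W := le_antisymm (inf_le_inf_right W c₂) (le_inf c₁ inf_le_right)
  obtain ⟨B, b₁, -, b₃, -⟩ := R.atom (x := U) (y := U) (z := ⊤) le_rfl le_top
    (R.not_le_of_rank_lt (by omega))
  obtain ⟨l, l₁, l₂⟩ := h.exists_line (R.isLine_of_proper (by omega : r c + 1 = k)
    (by omega : r B = k + 1) ⟨rU, mU⟩ c₂ b₁ (.inl (by rw [e₁, mU])))
  obtain ⟨b', c', d', hs⟩ := h.exists_sqAt_of_alpha hb (h.Q_of_proper ⟨rU, mU⟩)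
    ⟨l₁.trans_le c₂, b₁.trans_eq l₂.symm⟩ (by rw [l₁, e₁, mU])
  exact ⟨l, b', c', d', hs⟩

end LineGeom

end Squares

/-! ### The adjacency of lines is definable from incidence -/

section PointGeom

variable {α : Type*} [Lattice α] [BoundedOrder α] {S L : Type*}

/-- `S` is the set of proper points of a spine space, a point `s` being given by the element `pt s` of
the lattice, and `inc` is incidence. -/
structure PointGeom (r : α → ℕ) (W : α) (k m : ℕ) (pt : S → α) (lo hi : L → α)
    (inc : S → L → Prop) : Prop where
  injective : Function.Injective pt
  proper : ∀ s, Proper r W k m (pt s)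
  exists_pt : ∀ {U}, Proper r W k m U → ∃ s, pt s = U
  inc_iff : ∀ s l, inc s l ↔ On lo hi (pt s) l

/-- Every point of the line `a` is collinear with or equal to every point of the line `b`. -/
def Col (inc : S → L → Prop) (a b : L) : Prop :=
  ∀ s t, inc s a → inc t b → ∃ c, inc s c ∧ inc t c

/-- The lines `a` and `b` have a common point `s`, and some point of `a` and some point of `b`, both
different from `s`, are collinear or equal. -/
def MeetPt (inc : S → L → Prop) (a b : L) : Prop :=
  ∃ s, inc s a ∧ inc s b ∧ ∃ t u, inc t a ∧ t ≠ s ∧ inc u b ∧ u ≠ s ∧ ∃ c, inc t c ∧ inc u c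

/-- The lines `a` and `b` are consecutive in a quadrangle `a`, `a'`, `b'`, `b` of lines in which `Col`
holds for consecutive lines but not for opposite ones. In a spine space this forces the closures
of distinct lines `a` and `b` to meet, possibly in an improper point. -/
def Par (inc : S → L → Prop) (a b : L) : Prop :=
  Col inc a b ∧ ∃ a' b', Col inc a a' ∧ Col inc a' b' ∧ Col inc b' b ∧ ¬ Col inc a' b ∧
    ¬ Col inc a b'

namespace IncDef

variable {inc : S → L → Prop} {ι κ : Type}

theorem col (i j : κ) : IncDef inc fun (_ : ι → S) (v : κ → L) => Col inc (v i) (v j) :=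
  .allPt (.allPt ((IncDef.inc _ _).imp ((IncDef.inc _ _).imp
    (.exLine ((IncDef.inc _ _).and (.inc _ _))))))

theorem meetPt (i j : κ) : IncDef inc fun (_ : ι → S) (v : κ → L) => MeetPt inc (v i) (v j) :=
  .exPt ((IncDef.inc _ _).and ((IncDef.inc _ _).and (.exPt (.exPt ((IncDef.inc _ _).and
    ((IncDef.eqPt _ _).not.and ((IncDef.inc _ _).and ((IncDef.eqPt _ _).not.and
      (.exLine ((IncDef.inc _ _).and (.inc _ _)))))))))))

theorem par (i j : κ) : IncDef inc fun (_ : ι → S) (v : κ → L) => Par inc (v i) (v j) :=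
  (col _ _).and (.exLine (.exLine ((col _ _).and ((col _ _).and ((col _ _).and
    ((col _ _).not.and (col _ _).not))))))

end IncDef

namespace PointGeom

variable {r : α → ℕ} {W : α} {k m : ℕ} {Q : α → Prop} {pt : S → α} {lo hi : L → α}
  {inc : S → L → Prop} {δ : L → L → Prop}

theorem dual (hp : PointGeom r W k m pt lo hi inc) (h : IsSpine r W k m) :
    PointGeom (corank r) (OrderDual.toDual W) (r ⊤ - k) (r ⊤ + m - k - r W)
      (fun s => OrderDual.toDual (pt s)) (fun l => OrderDual.toDual (hi l))
      (fun l => OrderDual.toDual (lo l)) inc where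
  injective := hp.injective
  proper s := h.proper_dual.2 (hp.proper s)
  exists_pt hU := hp.exists_pt (h.proper_dual.1 hU)
  inc_iff s l := (hp.inc_iff s l).trans and_comm

theorem exists_inc_ne (hp : PointGeom r W k m pt lo hi inc) (h : LineGeom r W k m Q lo hi δ) (l : L)
    (U : α) : ∃ s, inc s l ∧ pt s ≠ U := by
  obtain ⟨-, -, -, V₁, V₂, hne, g₁, g₂, g₃, g₄, g₅, g₆⟩ := h.line l
  obtain ⟨s, rfl⟩ := hp.exists_pt g₁
  obtain ⟨t, rfl⟩ := hp.exists_pt g₂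
  by_cases e : pt s = U
  · exact ⟨t, (hp.inc_iff _ _).2 ⟨g₅, g₆⟩, fun e' => hne (e.trans e'.symm)⟩
  · exact ⟨s, (hp.inc_iff _ _).2 ⟨g₃, g₄⟩, e⟩

theorem rank_inf_of_inc (hp : PointGeom r W k m pt lo hi inc) (h : LineGeom r W k m Q lo hi δ)
    {s t : S} {c : L} (hs : inc s c) (ht : inc t c) : k ≤ r (pt s ⊓ pt t) + 1 := by
  have e₁ := h.rank_lo c
  have e₂ := h.spine.rank.mono
    (le_inf ((hp.inc_iff _ _).1 hs).1 ((hp.inc_iff _ _).1 ht).1)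
  omega

theorem col_of_lo (hp : PointGeom r W k m pt lo hi inc) (h : LineGeom r W k m Q lo hi δ)
    {a b : L} (e : lo a = lo b) : Col inc a b := by
  intro s t hs ht
  rw [hp.inc_iff] at hs ht
  by_cases hst : pt s = pt t
  · exact ⟨b, (hp.inc_iff _ _).2 (hst ▸ ht), (hp.inc_iff _ _).2 ht⟩
  obtain ⟨c, c₁, c₂⟩ := h.exists_line (h.spine.rank.isLine_sup (h.line a) (hp.proper s).1 hs.1 hs.2
    (hp.proper t) (e ▸ ht.1) hst)
  exact ⟨c, (hp.inc_iff _ _).2 ⟨c₁.trans_le hs.1, c₂ ▸ le_sup_left⟩,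
    (hp.inc_iff _ _).2 ⟨c₁.trans_le (e ▸ ht.1), c₂ ▸ le_sup_right⟩⟩

/-- A point adjacent to two points of a line is in the star or in the top of the line. -/
theorem _root_.SpineSpace.IsProjRank.le_or_le_of_adj (h : IsProjRank r) {U U' V : α} (hV : r V = k)
    (hUU' : r (U ⊓ U') + 1 = k) (hV₁ : k ≤ r (V ⊓ U) + 1) (hV₂ : k ≤ r (V ⊓ U') + 1) :
    U ⊓ U' ≤ V ∨ V ≤ U ⊔ U' := by
  by_cases e : V ⊓ U ⊔ V ⊓ U' = V
  · right
    rw [← e]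
    exact sup_le_sup inf_le_right inf_le_right
  left
  have e₁ := h.lt (lt_of_le_of_ne (sup_le inf_le_left inf_le_left) e)
  have e₂ := h.eq_of_le (le_sup_left : V ⊓ U ≤ V ⊓ U ⊔ V ⊓ U') (by omega)
  have e₃ := h.eq_of_le (le_sup_right : V ⊓ U' ≤ V ⊓ U ⊔ V ⊓ U') (by omega)
  have e₄ : V ⊓ U ≤ U ⊓ U' := le_inf inf_le_right ((e₂.trans e₃.symm).trans_le inf_le_right)
  exact (h.eq_of_le e₄ (by omega)).symm.trans_le inf_le_left

theorem col_iff (hp : PointGeom r W k m pt lo hi inc) (h : LineGeom r W k m Q lo hi δ) {a b : L} :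
    Col inc a b ↔ lo a = lo b ∨ hi a = hi b := by
  have R := h.spine.rank
  constructor
  swap
  · rintro (e | e)
    · exact hp.col_of_lo h e
    · exact (hp.dual h.spine).col_of_lo h.dual e
  intro hab
  obtain ⟨s, sa, -⟩ := hp.exists_inc_ne h a ⊥
  obtain ⟨s', s'a, hs⟩ := hp.exists_inc_ne h a (pt s)
  obtain ⟨t, tb, -⟩ := hp.exists_inc_ne h b ⊥
  obtain ⟨t', t'b, ht⟩ := hp.exists_inc_ne h b (pt t)
  have ss := hp.proper s
  have ss' := hp.proper s'
  have tt := hp.proper t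
  have tt' := hp.proper t'
  have ra := h.rank_lo a
  have rb := h.rank_lo b
  have ra' := h.rank_hi a
  have rb' := h.rank_hi b
  have Sa := (hp.inc_iff _ _).1 sa
  have Sa' := (hp.inc_iff _ _).1 s'a
  have Tb := (hp.inc_iff _ _).1 tb
  have Tb' := (hp.inc_iff _ _).1 t'b
  have e₁ := R.inf_eq Sa.1 Sa'.1 (by rw [ss.1, ra]) (by rw [ss'.1, ra]) hs.symm
  have e₂ := R.sup_eq Sa.2 Sa'.2 (by rw [ss.1, ra']) (by rw [ss'.1, ra']) hs.symm
  have e₃ := R.inf_eq Tb.1 Tb'.1 (by rw [tt.1, rb]) (by rw [tt'.1, rb]) ht.symm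
  have e₄ := R.sup_eq Tb.2 Tb'.2 (by rw [tt.1, rb']) (by rw [tt'.1, rb']) ht.symm
  have key : ∀ u, inc u b → lo a ≤ pt u ∨ pt u ≤ hi a := by
    intro u hu
    obtain ⟨c, c₁, c₂⟩ := hab s u sa hu
    obtain ⟨c', c₁', c₂'⟩ := hab s' u s'a hu
    have := R.le_or_le_of_adj (hp.proper u).1 (by rw [e₁, ra]) (hp.rank_inf_of_inc h c₂ c₁)
      (hp.rank_inf_of_inc h c₂' c₁')
    rwa [e₁, e₂] at this
  -- A point of `b` above `lo a` but not below `hi a`, together with one below `hi a`, forces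
  -- the lower ends to agree.
  have mixed : ∀ u u', inc u b → inc u' b → pt u ⊓ pt u' = lo b → lo a ≤ pt u → ¬ pt u ≤ hi a →
      pt u' ≤ hi a → lo a = lo b := by
    intro u u' hu hu' e h₁ h₂ h₃
    have f₁ := R.lt (lt_of_le_of_ne (inf_le_left : pt u ⊓ hi a ≤ pt u)
      fun e => h₂ (e.symm.trans_le inf_le_right))
    rw [(hp.proper u).1] at f₁
    have f₂ : lo b ≤ pt u ⊓ hi a := e ▸ inf_le_inf_left _ h₃
    have f₃ : lo a ≤ pt u ⊓ hi a := le_inf h₁ (h.line a).1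
    exact (R.eq_of_le f₃ (by omega)).trans (R.eq_of_le f₂ (by omega)).symm
  by_cases g₁ : pt t ≤ hi a <;> by_cases g₂ : pt t' ≤ hi a
  · right
    rw [← e₄]
    refine (R.eq_of_le (sup_le g₁ g₂) ?_).symm
    rw [e₄, ra', rb']
  · exact .inl (mixed t' t t'b tb (by rw [inf_comm, e₃]) ((key t' t'b).resolve_right g₂) g₂ g₁)
  · exact .inl (mixed t t' tb t'b e₃ ((key t tb).resolve_right g₁) g₁ g₂)
  · left
    rw [← e₃]
    refine R.eq_of_le (le_inf ((key t tb).resolve_right g₁) ((key t' t'b).resolve_right g₂)) ?_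
    rw [e₃]
    omega

/-- Two lines with a common point `U` are in a common star or top if some point of the one and some
point of the other, both different from `U`, are adjacent. -/
theorem _root_.SpineSpace.IsProjRank.eq_or_eq_of_adj (R : IsProjRank r) {H B H' B' U T T' : α}
    (rH : r H + 1 = k) (rH' : r H' + 1 = k) (rB : r B = k + 1) (rB' : r B' = k + 1) (rU : r U = k)
    (rT : r T = k) (rT' : r T' = k) (h₁ : H ≤ U) (h₂ : U ≤ B) (h₃ : H' ≤ U) (h₄ : U ≤ B')
    (h₅ : H ≤ T) (h₆ : T ≤ B) (h₇ : H' ≤ T') (h₈ : T' ≤ B') (hT : T ≠ U) (hT' : T' ≠ U)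
    (hadj : k ≤ r (T ⊓ T') + 1) : H = H' ∨ B = B' := by
  by_contra! hne
  have e₁ := R.inf_eq h₂ h₄ (by omega) (by omega) hne.2
  have e₂ := R.inf_eq h₁ h₅ (by omega) (by omega) hT.symm
  have e₃ := R.inf_eq h₃ h₇ (by omega) (by omega) hT'.symm
  have e₄ : T ⊓ T' ≤ U := by rw [← e₁]; exact inf_le_inf h₆ h₈
  have e₅ : T ⊓ T' ≤ H := by rw [← e₂]; exact le_inf e₄ inf_le_left
  have e₆ : T ⊓ T' ≤ H' := by rw [← e₃]; exact le_inf e₄ inf_le_right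
  exact hne.1 ((R.eq_of_le e₅ (by omega)).symm.trans (R.eq_of_le e₆ (by omega)))

theorem meetPt_iff (hp : PointGeom r W k m pt lo hi inc) (h : LineGeom r W k m Q lo hi δ) {a b : L} :
    MeetPt inc a b ↔ (lo a = lo b ∨ hi a = hi b) ∧
      ∃ U, Proper r W k m U ∧ On lo hi U a ∧ On lo hi U b := by
  have R := h.spine.rank
  constructor
  · rintro ⟨s, sa, sb, t, u, ta, hts, ub, hus, c, tc, uc⟩
    refine ⟨?_, pt s, hp.proper s, (hp.inc_iff _ _).1 sa, (hp.inc_iff _ _).1 sb⟩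
    by_contra! hne
    have e₀ := hp.rank_inf_of_inc h tc uc
    have ra := h.rank_lo a
    have rb := h.rank_lo b
    have ra' := h.rank_hi a
    have rb' := h.rank_hi b
    have rs := (hp.proper s).1
    have rt := (hp.proper t).1
    have ru := (hp.proper u).1
    rw [hp.inc_iff] at sa sb ta ub
    have := R.eq_or_eq_of_adj ra rb ra' rb' rs rt ru sa.1 sa.2 sb.1 sb.2 ta.1 ta.2 ub.1 ub.2
      (fun e => hts (hp.injective e)) (fun e => hus (hp.injective e)) e₀
    exact this.elim hne.1 hne.2
  · rintro ⟨hlh, U, hU, Ua, Ub⟩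
    obtain ⟨s, rfl⟩ := hp.exists_pt hU
    obtain ⟨t, ta, ht⟩ := hp.exists_inc_ne h a (pt s)
    obtain ⟨u, ub, hu⟩ := hp.exists_inc_ne h b (pt s)
    exact ⟨s, (hp.inc_iff _ _).2 Ua, (hp.inc_iff _ _).2 Ub, t, u, ta, fun e => ht (e ▸ rfl), ub,
      fun e => hu (e ▸ rfl), (hp.col_iff h).2 hlh t u ta ub⟩

theorem exists_on_of_par (hp : PointGeom r W k m pt lo hi inc) (h : LineGeom r W k m Q lo hi δ)
    {a b : L} (hab : a ≠ b) (hlo : lo a = lo b) (hpar : Par inc a b) :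
    ∃ U, r U = k ∧ On lo hi U a ∧ On lo hi U b := by
  have R := h.spine.rank
  obtain ⟨-, a', b', h₁, h₂, h₃, h₄, h₅⟩ := hpar
  rw [hp.col_iff h] at h₁ h₂ h₃ h₄ h₅
  have ra := h.rank_lo a
  have ra' := h.rank_lo a'
  have rb' := h.rank_hi b
  have ra'' := h.rank_hi a
  have e₁ : hi a = hi a' := h₁.resolve_left fun e => h₄ (.inl (e.symm.trans hlo))
  have e₂ : hi b' = hi b := h₃.resolve_left fun e => h₅ (.inl (hlo.trans e.symm))
  have e₃ : lo a' = lo b' := h₂.resolve_right fun e => h₅ (.inr (e₁.trans e))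
  have e₄ : hi a ≠ hi b := fun e => hab (h.ext hlo e)
  have e₅ : lo a ≤ hi a ⊓ hi b := le_inf (h.line a).1 (hlo ▸ (h.line b).1)
  have e₆ : lo a' ≤ hi a ⊓ hi b :=
    le_inf (e₁ ▸ (h.line a').1) (e₂ ▸ e₃ ▸ (h.line b').1)
  have e₇ : r (hi a ⊓ hi b) < r (hi a) := R.lt (lt_of_le_of_ne inf_le_left fun e =>
    e₄ (R.eq_of_le (e ▸ inf_le_right) (by omega)))
  have e₈ : r (lo a) < r (hi a ⊓ hi b) := R.lt (lt_of_le_of_ne e₅ fun e =>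
    h₄ (.inl ((R.eq_of_le (e ▸ e₆) (by omega)).trans hlo)))
  exact ⟨hi a ⊓ hi b, by omega, ⟨e₅, inf_le_left⟩, ⟨hlo ▸ e₅, inf_le_right⟩⟩

theorem par_of_on (hp : PointGeom r W k m pt lo hi inc) (h : LineGeom r W k m Q lo hi δ)
    {a b : L} {U : α} (hab : a ≠ b) (hlo : lo a = lo b) (rU : r U = k)
    (hU : ¬ Proper r W k m U) (Ua : On lo hi U a) (Ub : On lo hi U b) : Par inc a b := by
  obtain ⟨H, hH, hne⟩ := h.exists_alpha_ne (absurd · hU) rU Ua Ua.1 (h.rank_lo a)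
  obtain ⟨a', a₁, a₂, -⟩ := h.exists_line_of_alpha rU Ua hH
  obtain ⟨b', b₁, b₂, -⟩ := h.exists_line_of_alpha rU Ub hH
  have hhi : hi a ≠ hi b := fun e => hab (h.ext hlo e)
  refine ⟨(hp.col_iff h).2 (.inl hlo), a', b', (hp.col_iff h).2 (.inr a₂.symm),
    (hp.col_iff h).2 (.inl (a₁.trans b₁.symm)), (hp.col_iff h).2 (.inr b₂), ?_, ?_⟩
  · rw [hp.col_iff h]
    rintro (e | e)
    · exact hne (a₁.symm.trans (e.trans hlo.symm))
    · exact hhi (a₂.symm.trans e)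
  · rw [hp.col_iff h]
    rintro (e | e)
    · exact hne (b₁.symm.trans e.symm)
    · exact hhi (e.trans b₂)

/-- The adjacency of lines is definable from incidence. -/
theorem incDef_adj (hp : PointGeom r W k m pt lo hi inc) (h : LineGeom r W k m Q lo hi δ)
    (hQ : (∀ U, Q U → Proper r W k m U) ∨ ∀ U, r U = k → Q U)
    (hδ : ∀ l, δ l l ↔ ∃ l', l' ≠ l ∧ δ l l') {ι κ : Type} (i j : κ) :
    IncDef inc (fun (_ : ι → S) (v : κ → L) => δ (v i) (v j)) := by
  obtain ⟨F, hF, hFδ⟩ : ∃ F : L → L → Prop, (∀ {ι κ : Type} (i j : κ),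
      IncDef inc (fun (_ : ι → S) (v : κ → L) => F (v i) (v j))) ∧
      ∀ a b, a ≠ b → (δ a b ↔ F a b) := by
    rcases hQ with hQ | hQ
    · refine ⟨MeetPt inc, IncDef.meetPt, fun a b hab => ?_⟩
      rw [h.adj hab, hp.meetPt_iff h]
      exact and_congr Iff.rfl ⟨fun ⟨U, h₁, h₂⟩ => ⟨U, hQ U h₁, h₂⟩,
        fun ⟨U, h₁, h₂⟩ => ⟨U, h.Q_of_proper h₁, h₂⟩⟩
    · refine ⟨fun a b => MeetPt inc a b ∨ Par inc a b,
        fun i j => (IncDef.meetPt i j).or (IncDef.par i j), fun a b hab => ?_⟩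
      beta_reduce
      rw [h.adj hab, hp.meetPt_iff h]
      constructor
      · rintro ⟨e, U, qU, Ua, Ub⟩
        by_cases hU : Proper r W k m U
        · exact .inl ⟨e, U, hU, Ua, Ub⟩
        right
        have rU := h.rank_of_Q qU
        rcases e with e | e
        · exact hp.par_of_on h hab e rU hU Ua Ub
        · exact (hp.dual h.spine).par_of_on h.dual (U := OrderDual.toDual U) hab e
            (by simp [corank, rU]) (fun hU' => hU (h.spine.proper_dual.1 hU')) Ua.symm Ub.symm
      · rintro (⟨e, U, hU, hUab⟩ | hpar)
        · exact ⟨e, U, h.Q_of_proper hU, hUab⟩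
        have e := (hp.col_iff h).1 hpar.1
        refine ⟨e, ?_⟩
        rcases e with e | e
        · obtain ⟨U, rU, hUab⟩ := hp.exists_on_of_par h hab e hpar
          exact ⟨U, hQ U rU, hUab⟩
        · obtain ⟨U, rU, Ua, Ub⟩ := (hp.dual h.spine).exists_on_of_par h.dual hab e hpar
          refine ⟨OrderDual.ofDual U, hQ _ ?_, Ua.symm, Ub.symm⟩
          have e₁ := h.spine.le_top
          have e₂ := h.spine.rank.le_top (OrderDual.ofDual U)
          simp only [corank] at rU
          omega
  have key : ∀ a b, δ a b ↔ (a ≠ b ∧ F a b) ∨ (a = b ∧ ∃ c, c ≠ a ∧ F a c) := by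
    intro a b
    by_cases hab : a = b
    · subst hab
      rw [hδ a]
      simp only [ne_eq, not_true, false_and, true_and, false_or]
      exact exists_congr fun c => and_congr_right fun hc => hFδ a c (Ne.symm hc)
    · simp [hab, hFδ a b hab]
  simp only [key]
  exact ((IncDef.eqLine _ _).not.and (hF _ _)).or
    ((IncDef.eqLine _ _).and (.exLine ((IncDef.eqLine _ _).not.and (hF _ _))))

/-! ### Spine spaces in which points are encoded by squares -/

theorem definitionallyEquivalent_of_le (hp : PointGeom r W k m pt lo hi inc)
    (h : LineGeom r W k m Q lo hi δ)
    (hQ : (∀ U, Q U → Proper r W k m U) ∨ ∀ U, r U = k → Q U)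
    (hδ : ∀ l, δ l l ↔ ∃ l', l' ≠ l ∧ δ l l') (hb : m + 2 ≤ k) :
    DefinitionallyEquivalent inc δ := by
  have key : ∀ s a b c d, SqAt δ lo hi (pt s) a b c d → ∀ l, inc s l ↔ SqInc δ a b c d l :=
    fun s a b c d hs l => (hp.inc_iff s l).trans
      ⟨h.sqInc_of_on hb (h.Q_of_proper (hp.proper s)) hs,
        h.on_of_sqInc hb (h.Q_of_proper (hp.proper s)) hs⟩
  refine definitionallyEquivalent_of 4
    (fun x => Sq δ (x 0) (x 1) (x 2) (x 3) ∧ ¬ Bad δ (x 0) (x 1) (x 2) (x 3))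
    (fun x l => SqInc δ (x 0) (x 1) (x 2) (x 3) l) (hp.incDef_adj h hQ hδ)
    (fun g => (LineDef.sq _ _ _ _).and (LineDef.bad _ _ _ _).not)
    (fun g j => LineDef.sqInc _ _ _ _ _) ?_ ?_ ?_
  · rintro x ⟨hs, hbad⟩
    obtain ⟨U, qU, hU⟩ := h.exists_on_of_sq hs
    have pU : Proper r W k m U := by
      by_contra hnp
      exact hbad (h.bad_of_not_proper hb qU ⟨hs, hU⟩ hnp)
    obtain ⟨s, rfl⟩ := hp.exists_pt pU
    exact ⟨s, key s _ _ _ _ ⟨hs, hU⟩⟩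
  · intro s
    obtain ⟨a, b, c, d, hs⟩ := h.exists_sqAt_of_proper hb (hp.proper s)
    exact ⟨![a, b, c, d], ⟨hs.1, h.not_bad_of_proper hb (hp.proper s) hs⟩, key s a b c d hs⟩
  · intro s t hst
    obtain ⟨a, b, c, d, hs, Ua, Ub, -⟩ := h.exists_sqAt_of_proper hb (hp.proper s)
    refine hp.injective (h.eq_of_on hs.1.1.1 (hp.proper s).1 (hp.proper t).1 Ua Ub ?_ ?_)
    · exact (hp.inc_iff _ _).1 ((hst a).1 ((hp.inc_iff _ _).2 Ua))
    · exact (hp.inc_iff _ _).1 ((hst b).1 ((hp.inc_iff _ _).2 Ub))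

/-- The case `m + 2 ≤ r W` is dual to the case `m + 2 ≤ k`. -/
theorem definitionallyEquivalent_of_le' (hp : PointGeom r W k m pt lo hi inc)
    (h : LineGeom r W k m Q lo hi δ)
    (hQ : (∀ U, Q U → Proper r W k m U) ∨ ∀ U, r U = k → Q U)
    (hδ : ∀ l, δ l l ↔ ∃ l', l' ≠ l ∧ δ l l') (hw : m + 2 ≤ r W) :
    DefinitionallyEquivalent inc δ := by
  refine (hp.dual h.spine).definitionallyEquivalent_of_le h.dual ?_ hδ ?_
  · refine hQ.imp (fun hQ U hU => h.spine.proper_dual.2 (hQ _ hU)) fun hQ U hU => hQ _ ?_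
    have e₁ := h.spine.le_top
    have e₂ := h.spine.rank.le_top (OrderDual.ofDual U)
    simp only [corank] at hU
    omega
  · have e₁ := h.spine.le_sup
    have e₂ := h.spine.le_top
    omega

end PointGeom

end PointGeom

/-! ### Projective spaces -/

section Projective

/-- Two lines are equal or in the relation `δ`. -/
def Near {L : Type*} (δ : L → L → Prop) (a b : L) : Prop := a = b ∨ δ a b

/-- The line `l` is equal or in the relation `δ` to each of the lines `a`, `b`, `c`. -/
def Near₃ {L : Type*} (δ : L → L → Prop) (a b c l : L) : Prop :=
  Near δ l a ∧ Near δ l b ∧ Near δ l c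

/-- In a projective space of dimension at least four: `a`, `b`, `c` are concurrent lines that are not
coplanar. The lines meeting all three of them pairwise meet, so they are the lines through a point
or the lines of a plane; a line `p` that is not one of them meets a pencil of them or none. The
existence of `p` and `q` excludes the lines of a plane, as two pencils of a plane share a line. -/
def StarTriple {L : Type*} (δ : L → L → Prop) (a b c : L) : Prop :=
  a ≠ b ∧ Near δ a b ∧ Near δ c a ∧ Near δ c b ∧
    (∀ x y, Near₃ δ a b c x → Near₃ δ a b c y → Near δ x y) ∧
    ∃ p q, ¬ Near₃ δ a b c p ∧ ¬ Near₃ δ a b c q ∧ (∃ x, Near₃ δ a b c x ∧ Near δ x p) ∧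
      (∃ x, Near₃ δ a b c x ∧ Near δ x q) ∧ ¬ ∃ x, Near₃ δ a b c x ∧ Near δ x p ∧ Near δ x q

namespace LineDef

variable {L : Type*} {δ : L → L → Prop} {κ : Type}

theorem near (i j : κ) : LineDef δ fun v : κ → L => Near δ (v i) (v j) :=
  (LineDef.eq _ _).or (.rel _ _)

theorem near₃ (i j l p : κ) : LineDef δ fun v : κ → L => Near₃ δ (v i) (v j) (v l) (v p) :=
  (near _ _).and ((near _ _).and (near _ _))

theorem starTriple (i j l : κ) : LineDef δ fun v : κ → L => StarTriple δ (v i) (v j) (v l) :=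
  (LineDef.eq _ _).not.and ((near _ _).and ((near _ _).and ((near _ _).and
    ((LineDef.all (.all ((near₃ _ _ _ _).imp ((near₃ _ _ _ _).imp (near _ _))))).and
      (.ex (.ex ((near₃ _ _ _ _).not.and ((near₃ _ _ _ _).not.and
        ((LineDef.ex ((near₃ _ _ _ _).and (near _ _))).and
          ((LineDef.ex ((near₃ _ _ _ _).and (near _ _))).and
            (LineDef.ex ((near₃ _ _ _ _).and ((near _ _).and (near _ _)))).not))))))))))

end LineDef

variable {α : Type*} [Lattice α] [BoundedOrder α] {S L : Type*} {r : α → ℕ} {W : α} {k m : ℕ}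
  {Q : α → Prop} {pt : S → α} {lo hi : L → α} {inc : S → L → Prop} {δ : L → L → Prop}

namespace LineGeom

theorem lo_eq (h : LineGeom r W k m Q lo hi δ) (hW : r W = m) (hk : k = m + 1) (l : L) :
    lo l = W := by
  have R := h.spine.rank
  have e₁ := R.isLine_types (h.line l)
  have e₂ := h.rank_lo l
  have e₃ := R.mono (inf_le_right : hi l ⊓ W ≤ W)
  have e₄ := R.eq_of_le (inf_le_left : lo l ⊓ W ≤ lo l) (by omega)
  have e₅ := R.eq_of_le (inf_le_right : lo l ⊓ W ≤ W) (by omega)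
  exact e₄.symm.trans e₅

theorem proper_of_le {α : Type*} [Lattice α] {r : α → ℕ} {W : α} {k m : ℕ} (hW : r W = m) {U : α}
    (hU : r U = k) (hWU : W ≤ U) : Proper r W k m U :=
  ⟨hU, by rw [inf_eq_right.2 hWU, hW]⟩

theorem exists_line_hi (h : LineGeom r W k m Q lo hi δ) (hW : r W = m) (hk : k = m + 1) {U B : α}
    (hU : r U = k) (hB : r B = k + 1) (hWU : W ≤ U) (hUB : U ≤ B) : ∃ l, hi l = B := by
  obtain ⟨l, -, hl⟩ := h.exists_line (h.spine.rank.isLine_of_proper (H := W) (by omega) hB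
    (proper_of_le hW hU hWU) hWU hUB (.inl (by rw [inf_idem, hW])))
  exact ⟨l, hl⟩

theorem near_iff (h : LineGeom r W k m Q lo hi δ) (hW : r W = m) (hk : k = m + 1) {a b : L} :
    Near δ a b ↔ ∃ U, r U = k ∧ W ≤ U ∧ U ≤ hi a ∧ U ≤ hi b := by
  have hlo := h.lo_eq hW hk
  constructor
  · rintro (rfl | hd)
    · obtain ⟨U, hU, Ua⟩ := h.exists_proper a
      exact ⟨U, hU.1, hlo a ▸ Ua.1, Ua.2, Ua.2⟩
    · by_cases hab : a = b
      · subst hab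
        obtain ⟨U, hU, Ua⟩ := h.exists_proper a
        exact ⟨U, hU.1, hlo a ▸ Ua.1, Ua.2, Ua.2⟩
      · obtain ⟨-, U, qU, Ua, Ub⟩ := (h.adj hab).1 hd
        exact ⟨U, h.rank_of_Q qU, hlo a ▸ Ua.1, Ua.2, Ub.2⟩
  · rintro ⟨U, rU, hWU, Ua, Ub⟩
    by_cases hab : a = b
    · exact .inl hab
    · exact .inr ((h.adj hab).2 ⟨.inl ((hlo a).trans (hlo b).symm), U,
        h.Q_of_proper (proper_of_le hW rU hWU), ⟨(hlo a).trans_le hWU, Ua⟩,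
        ⟨(hlo b).trans_le hWU, Ub⟩⟩)

/-- Two lines of a plane meet. -/
theorem near_of_le (h : LineGeom r W k m Q lo hi δ) (hW : r W = m) (hk : k = m + 1) {a b : L}
    {E : α} (hE : r E = k + 2) (ha : hi a ≤ E) (hb : hi b ≤ E) : Near δ a b := by
  have R := h.spine.rank
  rw [h.near_iff hW hk]
  have e₁ := R.mod (hi a) (hi b)
  have e₂ := R.mono (sup_le ha hb)
  have e₃ := h.rank_hi a
  have e₄ := h.rank_hi b
  have e₅ : W ≤ hi a ⊓ hi b := le_inf (h.lo_eq hW hk a ▸ (h.line a).1)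
    (h.lo_eq hW hk b ▸ (h.line b).1)
  obtain ⟨U, h₁, h₂, h₃, -⟩ := R.atom (x := W) (y := W) (z := hi a ⊓ hi b) le_rfl e₅
    (R.not_le_of_rank_lt (by omega))
  exact ⟨U, by omega, h₁, h₂.trans inf_le_left, h₂.trans inf_le_right⟩

theorem eq_inf (h : LineGeom r W k m Q lo hi δ) {U E : α} {p : L} (hU : r U = k) (hp : ¬ hi p ≤ E)
    (h₁ : U ≤ hi p) (h₂ : U ≤ E) : U = hi p ⊓ E := by
  have R := h.spine.rank
  refine R.eq_of_le (le_inf h₁ h₂) ?_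
  have e₁ := R.lt (lt_of_le_of_ne (inf_le_left : hi p ⊓ E ≤ hi p)
    fun e => hp (e.symm.trans_le inf_le_right))
  rw [h.rank_hi p] at e₁
  omega

theorem sup_eq_hi (h : LineGeom r W k m Q lo hi δ) {U V : α} {l : L} (hU : r U = k) (hV : r V = k)
    (hne : U ≠ V) (h₁ : U ≤ hi l) (h₂ : V ≤ hi l) : U ⊔ V = hi l :=
  h.spine.rank.sup_eq h₁ h₂ (by rw [h.rank_hi, hU]) (by rw [h.rank_hi, hV]) hne

/-- A line meeting two lines through `U` passes through `U` or is in their plane. -/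
theorem le_or_le_of_near (h : LineGeom r W k m Q lo hi δ) (hW : r W = m) (hk : k = m + 1)
    {a b l : L} {U : α} (hU : r U = k) (hab : a ≠ b) (Ua : U ≤ hi a) (Ub : U ≤ hi b)
    (ha : Near δ l a) (hb : Near δ l b) : U ≤ hi l ∨ hi l ≤ hi a ⊔ hi b := by
  obtain ⟨V₁, r₁, -, l₁, a₁⟩ := (h.near_iff hW hk).1 ha
  obtain ⟨V₂, r₂, -, l₂, b₂⟩ := (h.near_iff hW hk).1 hb
  by_cases e : V₁ = V₂
  · subst e
    left
    by_cases e' : U = V₁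
    · exact e' ▸ l₁
    · exact absurd (h.ext (by rw [h.lo_eq hW hk, h.lo_eq hW hk])
        ((h.sup_eq_hi hU r₁ e' Ua a₁).symm.trans (h.sup_eq_hi hU r₁ e' Ub b₂))) hab
  · right
    rw [← h.sup_eq_hi r₁ r₂ e l₁ l₂]
    exact sup_le_sup a₁ b₂

theorem exists_transversal (h : LineGeom r W k m Q lo hi δ) (hW : r W = m) (hk : k = m + 1)
    {a b : L} {U : α} (hU : r U = k) (hab : a ≠ b) (Ua : U ≤ hi a) (Ub : U ≤ hi b) :
    ∃ p, ¬ U ≤ hi p ∧ hi p ≤ hi a ⊔ hi b ∧ Near δ a p := by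
  have R := h.spine.rank
  have hlo := h.lo_eq hW hk
  have pts : ∀ l, ∃ V, r V = k ∧ W ≤ V ∧ V ≤ hi l ∧ V ≠ U := by
    intro l
    obtain ⟨-, -, -, V₁, V₂, hne, g₁, g₂, g₃, g₄, g₅, g₆⟩ := h.line l
    rw [hlo] at g₃ g₅
    by_cases e : V₁ = U
    · exact ⟨V₂, g₂.1, g₅, g₆, fun e' => hne (e.trans e'.symm)⟩
    · exact ⟨V₁, g₁.1, g₃, g₄, e⟩
  obtain ⟨V₁, r₁, w₁, a₁, n₁⟩ := pts a
  obtain ⟨V₂, r₂, w₂, b₂, n₂⟩ := pts b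
  have hne : hi a ≠ hi b := fun e => hab (h.ext (by rw [hlo, hlo]) e)
  have e₀ := R.inf_eq Ua Ub (by rw [h.rank_hi, hU]) (by rw [h.rank_hi, hU]) hne
  have n₁₂ : V₁ ≠ V₂ := fun e =>
    n₁ (R.eq_of_le (e₀ ▸ le_inf a₁ (e ▸ b₂)) (by omega))
  have e₁ := R.inf_eq w₁ w₂ (by omega) (by omega) n₁₂
  have e₂ := R.mod V₁ V₂
  rw [e₁] at e₂
  obtain ⟨p, hp⟩ := h.exists_line_hi hW hk r₁ (by omega : r (V₁ ⊔ V₂) = k + 1) w₁ le_sup_left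
  refine ⟨p, fun hUp => ?_, hp ▸ sup_le_sup a₁ b₂,
    (h.near_iff hW hk).2 ⟨V₁, r₁, w₁, a₁, hp ▸ le_sup_left⟩⟩
  have e₃ := h.sup_eq_hi r₁ hU n₁ (hp ▸ le_sup_left) hUp
  have e₄ := h.sup_eq_hi r₁ hU n₁ a₁ Ua
  have e₅ : V₂ ≤ hi a := by rw [← e₄, e₃, hp]; exact le_sup_right
  exact n₂ (R.eq_of_le (e₀ ▸ le_inf e₅ b₂) (by omega))

theorem near₃_iff_of_not_le (h : LineGeom r W k m Q lo hi δ) (hW : r W = m) (hk : k = m + 1)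
    {a b c l : L} {U : α} (hU : r U = k) (hWU : W ≤ U) (hab : a ≠ b) (Ua : U ≤ hi a)
    (Ub : U ≤ hi b) (Uc : U ≤ hi c) (hc : ¬ hi c ≤ hi a ⊔ hi b) : Near₃ δ a b c l ↔ U ≤ hi l := by
  constructor
  · rintro ⟨la, lb, lc⟩
    rcases h.le_or_le_of_near hW hk hU hab Ua Ub la lb with h₁ | h₁
    · exact h₁
    · obtain ⟨V, rV, -, Vl, Vc⟩ := (h.near_iff hW hk).1 lc
      have e₁ := h.eq_inf rV hc Vc (Vl.trans h₁)
      have e₂ := h.eq_inf hU hc Uc (Ua.trans le_sup_left)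
      exact (e₂.trans e₁.symm).trans_le Vl
  · exact fun Ul => ⟨(h.near_iff hW hk).2 ⟨U, hU, hWU, Ul, Ua⟩,
      (h.near_iff hW hk).2 ⟨U, hU, hWU, Ul, Ub⟩, (h.near_iff hW hk).2 ⟨U, hU, hWU, Ul, Uc⟩⟩

/-- A star triple consists of three lines through a point that are not coplanar. -/
theorem exists_of_starTriple (h : LineGeom r W k m Q lo hi δ) (hW : r W = m) (hk : k = m + 1)
    (hn : k + 4 ≤ r ⊤) {a b c : L} (hs : StarTriple δ a b c) :
    ∃ U, r U = k ∧ W ≤ U ∧ ∀ l, Near₃ δ a b c l ↔ U ≤ hi l := by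
  have R := h.spine.rank
  have hlo := h.lo_eq hW hk
  obtain ⟨hab, nab, nca, ncb, hcl, p, q, hp, hq, ⟨x, hx, hxp⟩, ⟨y, hy, hyq⟩, hxy⟩ := hs
  obtain ⟨U, rU, hWU, Ua, Ub⟩ := (h.near_iff hW hk).1 nab
  have hne : hi a ≠ hi b := fun e => hab (h.ext (by rw [hlo, hlo]) e)
  have rE : r (hi a ⊔ hi b) = k + 2 := by
    have e₁ := R.mod (hi a) (hi b)
    rw [R.inf_eq Ua Ub (by rw [h.rank_hi, rU]) (by rw [h.rank_hi, rU]) hne, h.rank_hi,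
      h.rank_hi] at e₁
    omega
  by_cases Uc : U ≤ hi c
  · by_cases hc : hi c ≤ hi a ⊔ hi b
    · -- A line through `U` off the plane does not meet a line of the plane that avoids `U`.
      exfalso
      obtain ⟨B, b₁, -, b₃, b₄⟩ := R.atom (x := U) (y := hi a ⊔ hi b) (z := ⊤)
        (Ua.trans le_sup_left) le_top (R.not_le_of_rank_lt (by omega))
      obtain ⟨s, hs⟩ := h.exists_line_hi hW hk rU (by omega : r B = k + 1) hWU b₁
      obtain ⟨t, t₁, t₂, -⟩ := h.exists_transversal hW hk rU hab Ua Ub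
      have hns := hcl s t ⟨(h.near_iff hW hk).2 ⟨U, rU, hWU, hs ▸ b₁, Ua⟩,
        (h.near_iff hW hk).2 ⟨U, rU, hWU, hs ▸ b₁, Ub⟩,
        (h.near_iff hW hk).2 ⟨U, rU, hWU, hs ▸ b₁, Uc⟩⟩
        ⟨h.near_of_le hW hk rE t₂ le_sup_left, h.near_of_le hW hk rE t₂ le_sup_right,
          h.near_of_le hW hk rE t₂ hc⟩
      obtain ⟨V, rV, -, Vs, Vt⟩ := (h.near_iff hW hk).1 hns
      have e₁ := h.eq_inf rV (hs ▸ b₄) Vs (Vt.trans t₂)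
      have e₂ := h.eq_inf rU (hs ▸ b₄) (hs ▸ b₁) (Ua.trans le_sup_left)
      exact t₁ ((e₂.trans e₁.symm).trans_le Vt)
    · exact ⟨U, rU, hWU, fun l => h.near₃_iff_of_not_le hW hk rU hWU hab Ua Ub Uc hc⟩
  -- The triangle: two pencils of lines of the plane share the line joining their vertices.
  exfalso
  have hc := (h.le_or_le_of_near hW hk rU hab Ua Ub nca ncb).resolve_left Uc
  have hN : ∀ l, Near₃ δ a b c l ↔ hi l ≤ hi a ⊔ hi b := by
    intro l
    constructor
    · rintro ⟨la, lb, lc⟩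
      by_contra hl
      have Ul := (h.le_or_le_of_near hW hk rU hab Ua Ub la lb).resolve_right hl
      obtain ⟨V, rV, -, Vl, Vc⟩ := (h.near_iff hW hk).1 lc
      have e₁ := h.eq_inf rV hl Vl (Vc.trans hc)
      have e₂ := h.eq_inf rU hl Ul (Ua.trans le_sup_left)
      exact Uc ((e₂.trans e₁.symm).trans_le Vc)
    · exact fun hl => ⟨h.near_of_le hW hk rE hl le_sup_left, h.near_of_le hW hk rE hl le_sup_right,
        h.near_of_le hW hk rE hl hc⟩
  rw [hN] at hx hy
  obtain ⟨V, rV, wV, Vx, Vp⟩ := (h.near_iff hW hk).1 hxp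
  obtain ⟨V', rV', wV', V'y, V'q⟩ := (h.near_iff hW hk).1 hyq
  by_cases e : V = V'
  · exact hxy ⟨x, (hN x).2 hx, hxp, (h.near_iff hW hk).2 ⟨V, rV, wV, Vx, e ▸ V'q⟩⟩
  · have e₁ := R.mod V V'
    rw [R.inf_eq wV wV' (by omega) (by omega) e] at e₁
    obtain ⟨z, hz⟩ := h.exists_line_hi hW hk rV (by omega : r (V ⊔ V') = k + 1) wV le_sup_left
    exact hxy ⟨z, (hN z).2 (hz ▸ sup_le (Vx.trans hx) (V'y.trans hy)),
      (h.near_iff hW hk).2 ⟨V, rV, wV, hz ▸ le_sup_left, Vp⟩,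
      (h.near_iff hW hk).2 ⟨V', rV', wV', hz ▸ le_sup_right, V'q⟩⟩

theorem exists_starTriple (h : LineGeom r W k m Q lo hi δ) (hW : r W = m) (hk : k = m + 1)
    (hn : k + 4 ≤ r ⊤) {U : α} (rU : r U = k) (hWU : W ≤ U) :
    ∃ a b c, StarTriple δ a b c ∧ ∀ l, Near₃ δ a b c l ↔ U ≤ hi l := by
  have R := h.spine.rank
  have hlo := h.lo_eq hW hk
  have step : ∀ E, U ≤ E → r E < r ⊤ →
      ∃ l, U ≤ hi l ∧ ¬ hi l ≤ E ∧ r (E ⊔ hi l) = r E + 1 := by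
    intro E hUE hE
    obtain ⟨B, b₁, -, b₃, b₄⟩ := R.atom (x := U) (y := E) (z := ⊤) hUE le_top
      (R.not_le_of_rank_lt hE)
    obtain ⟨l, rfl⟩ := h.exists_line_hi hW hk rU (by omega : r B = k + 1) hWU b₁
    have e₁ := R.mod E (hi l)
    rw [inf_comm, ← h.eq_inf rU b₄ b₁ hUE] at e₁
    exact ⟨l, b₁, b₄, by omega⟩
  obtain ⟨a, Ua, -, ra⟩ := step U le_rfl (by omega)
  rw [sup_eq_right.2 Ua] at ra
  obtain ⟨b, Ub, hb, rb⟩ := step (hi a) Ua (by omega)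
  obtain ⟨c, Uc, hc, rc⟩ := step (hi a ⊔ hi b) (Ua.trans le_sup_left) (by omega)
  obtain ⟨d, Ud, hd, rd⟩ := step (hi a ⊔ hi b ⊔ hi c) (Uc.trans le_sup_right) (by omega)
  have hab : a ≠ b := fun e => hb (e ▸ le_rfl)
  have hcd : c ≠ d := fun e => hd (e ▸ le_sup_right)
  have hN : ∀ l, Near₃ δ a b c l ↔ U ≤ hi l :=
    fun l => h.near₃_iff_of_not_le hW hk rU hWU hab Ua Ub Uc hc
  have near : ∀ {x y}, U ≤ hi x → U ≤ hi y → Near δ x y := fun hx hy =>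
    (h.near_iff hW hk).2 ⟨U, rU, hWU, hx, hy⟩
  obtain ⟨p, p₁, p₂, p₃⟩ := h.exists_transversal hW hk rU hab Ua Ub
  obtain ⟨q, q₁, q₂, q₃⟩ := h.exists_transversal hW hk rU hcd Uc Ud
  refine ⟨a, b, c, ⟨hab, near Ua Ub, near Uc Ua, near Uc Ub,
    fun x y hx hy => near ((hN x).1 hx) ((hN y).1 hy), p, q, fun e => p₁ ((hN p).1 e),
    fun e => q₁ ((hN q).1 e), ⟨a, (hN a).2 Ua, p₃⟩, ⟨c, (hN c).2 Uc, q₃⟩, ?_⟩, hN⟩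
  -- A line through `U` meeting both `p` and `q` would be in two planes that share only `U`.
  rintro ⟨x, hx, hxp, hxq⟩
  have Ux := (hN x).1 hx
  obtain ⟨V, rV, -, Vx, Vp⟩ := (h.near_iff hW hk).1 hxp
  obtain ⟨V', rV', -, V'x, V'q⟩ := (h.near_iff hW hk).1 hxq
  have hne : U ≠ V := fun e => p₁ (e ▸ Vp)
  have hne' : U ≠ V' := fun e => q₁ (e ▸ V'q)
  have e₁ : hi x ≤ hi a ⊔ hi b := by
    rw [← h.sup_eq_hi rU rV hne Ux Vx]
    exact sup_le (Ua.trans le_sup_left) (Vp.trans p₂)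
  have e₂ : hi x ≤ hi c ⊔ hi d := by
    rw [← h.sup_eq_hi rU rV' hne' Ux V'x]
    exact sup_le (Uc.trans le_sup_left) (V'q.trans q₂)
  have e₃ := R.mod (hi a ⊔ hi b) (hi c ⊔ hi d)
  rw [← sup_assoc, rd, rc, rb, ra] at e₃
  have e₄ := R.mono (le_inf e₁ e₂)
  have e₅ := R.mod (hi c) (hi d)
  have e₆ := R.mono (le_inf Uc Ud)
  rw [h.rank_hi, h.rank_hi] at e₅
  rw [h.rank_hi] at e₄
  omega

end LineGeom

namespace PointGeom

theorem definitionallyEquivalent_of_projective (hp : PointGeom r W k m pt lo hi inc)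
    (h : LineGeom r W k m Q lo hi δ)
    (hQ : (∀ U, Q U → Proper r W k m U) ∨ ∀ U, r U = k → Q U)
    (hδ : ∀ l, δ l l ↔ ∃ l', l' ≠ l ∧ δ l l') (hW : r W = m) (hk : k = m + 1)
    (hn : k + 4 ≤ r ⊤) : DefinitionallyEquivalent inc δ := by
  have R := h.spine.rank
  have hWs : ∀ s, W ≤ pt s := fun s => by
    obtain ⟨-, e⟩ := hp.proper s
    exact (R.eq_of_le (inf_le_right : pt s ⊓ W ≤ W) (by omega)).symm.trans_le inf_le_left
  have hinc : ∀ s l, inc s l ↔ pt s ≤ hi l := fun s l => by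
    rw [hp.inc_iff, On, h.lo_eq hW hk]
    exact and_iff_right (hWs s)
  refine definitionallyEquivalent_of 3 (fun x => StarTriple δ (x 0) (x 1) (x 2))
    (fun x l => Near₃ δ (x 0) (x 1) (x 2) l) (hp.incDef_adj h hQ hδ)
    (fun g => LineDef.starTriple _ _ _) (fun g j => LineDef.near₃ _ _ _ _) ?_ ?_ ?_
  · intro x hx
    obtain ⟨U, rU, hWU, hN⟩ := h.exists_of_starTriple hW hk hn hx
    obtain ⟨s, rfl⟩ := hp.exists_pt (LineGeom.proper_of_le hW rU hWU)
    exact ⟨s, fun l => (hinc s l).trans (hN l).symm⟩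
  · intro s
    obtain ⟨a, b, c, hs, hN⟩ := h.exists_starTriple hW hk hn (hp.proper s).1 (hWs s)
    exact ⟨![a, b, c], hs, fun l => (hinc s l).trans (hN l).symm⟩
  · intro s t hst
    obtain ⟨a, b, c, ⟨hab, nab, nca, ncb, -⟩, hN⟩ :=
      h.exists_starTriple hW hk hn (hp.proper s).1 (hWs s)
    have ha : Near₃ δ a b c a := ⟨.inl rfl, nab, (h.near_iff hW hk).2 (by
      obtain ⟨U, h₁, h₂, h₃, h₄⟩ := (h.near_iff hW hk).1 nca
      exact ⟨U, h₁, h₂, h₄, h₃⟩)⟩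
    have hb : Near₃ δ a b c b := ⟨(h.near_iff hW hk).2 (by
      obtain ⟨U, h₁, h₂, h₃, h₄⟩ := (h.near_iff hW hk).1 nab
      exact ⟨U, h₁, h₂, h₄, h₃⟩), .inl rfl, (h.near_iff hW hk).2 (by
      obtain ⟨U, h₁, h₂, h₃, h₄⟩ := (h.near_iff hW hk).1 ncb
      exact ⟨U, h₁, h₂, h₄, h₃⟩)⟩
    have sa := (hinc s a).2 ((hN a).1 ha)
    have sb := (hinc s b).2 ((hN b).1 hb)
    exact hp.injective (h.eq_of_on hab (hp.proper s).1 (hp.proper t).1 ((hp.inc_iff _ _).1 sa)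
      ((hp.inc_iff _ _).1 sb) ((hp.inc_iff _ _).1 ((hst a).1 sa))
      ((hp.inc_iff _ _).1 ((hst b).1 sb)))

/-- A spine space that consists of a single point is encoded by the empty tuple of lines. -/
theorem definitionallyEquivalent_of_eq (hp : PointGeom r W k m pt lo hi inc)
    (h : LineGeom r W k m Q lo hi δ)
    (hQ : (∀ U, Q U → Proper r W k m U) ∨ ∀ U, r U = k → Q U)
    (hδ : ∀ l, δ l l ↔ ∃ l', l' ≠ l ∧ δ l l') (hW : r W = m) (hk : k = m) :
    DefinitionallyEquivalent inc δ := by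
  have R := h.spine.rank
  have hU : ∀ U, Proper r W k m U → U = W := fun U hU =>
    (R.eq_of_le (inf_le_left : U ⊓ W ≤ U) (by rw [hU.1, hU.2, hk])).symm.trans
      (R.eq_of_le (inf_le_right : U ⊓ W ≤ W) (by rw [hU.2, hW]))
  have hL : L → False := fun l => by
    obtain ⟨-, -, -, U, V, hne, h₁, h₂, -⟩ := h.line l
    exact hne ((hU U h₁).trans (hU V h₂).symm)
  obtain ⟨s, hs⟩ := hp.exists_pt (U := W) ⟨hW.trans hk.symm, by rw [inf_idem, hW]⟩
  -- A tautology stands for the true predicate, which is not among the generators of `LineDef`.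
  refine definitionallyEquivalent_of 0 (fun _ => ∀ l : L, l = l) (fun _ l => l = l)
    (hp.incDef_adj h hQ hδ) (fun g => .all (.eq _ _)) (fun g j => .eq _ _)
    (fun x _ => ⟨s, fun l => (hL l).elim⟩)
    (fun t => ⟨Fin.elim0, fun l => rfl, fun l => (hL l).elim⟩)
    (fun t u _ => hp.injective ((hU _ (hp.proper t)).trans (hU _ (hp.proper u)).symm))

end PointGeom

end Projective

/-! ### Planes of a ranked lattice -/

section PlaneAxioms

variable {α : Type*} [Lattice α] [BoundedOrder α] {r : α → ℕ} {k : ℕ}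

/-- The elements of rank `k` of the interval from `Z` to `Y`, together with the flags `H ≤ B` of ranks
`k - 1` and `k + 1` in this interval, satisfy the axioms of a projective plane. -/
def PlaneAxioms (r : α → ℕ) (k : ℕ) (Z Y : α) : Prop :=
  (∀ U U', r U = k → r U' = k → Z ≤ U → U ≤ Y → Z ≤ U' → U' ≤ Y → U ≠ U' →
    r (U ⊓ U') + 1 = k ∧ r (U ⊔ U') = k + 1) ∧
  (∀ H B H' B', H ≤ B → H' ≤ B' → r H + 1 = k → r B = k + 1 → r H' + 1 = k → r B' = k + 1 →
    Z ≤ H → B ≤ Y → Z ≤ H' → B' ≤ Y → ∃ U, r U = k ∧ H ≤ U ∧ U ≤ B ∧ H' ≤ U ∧ U ≤ B') ∧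
  ∃ q : Fin 4 → α, Function.Injective q ∧ (∀ i, r (q i) = k ∧ Z ≤ q i ∧ q i ≤ Y) ∧
    ∀ H B, r H + 1 = k → r B = k + 1 → ∀ i j h : Fin 4, i ≠ j → j ≠ h → i ≠ h →
      ¬ ((H ≤ q i ∧ q i ≤ B) ∧ (H ≤ q j ∧ q j ≤ B) ∧ (H ≤ q h ∧ q h ≤ B))

namespace IsProjRank

/-- Four points in general position in an interval of length three. -/
theorem exists_quadrangle (R : IsProjRank r) {Z Y : α} (hZY : Z ≤ Y) (hZ : r Z + 1 = k)
    (hY : r Y = k + 2) : ∃ q : Fin 4 → α, Function.Injective q ∧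
      (∀ i, r (q i) = k ∧ Z ≤ q i ∧ q i ≤ Y) ∧
      ∀ B, r B = k + 1 → ∀ i j h : Fin 4, i ≠ j → j ≠ h → i ≠ h →
        ¬ (q i ≤ B ∧ q j ≤ B ∧ q h ≤ B) := by
  obtain ⟨a, a₁, a₂, a₃, -⟩ := R.atom (x := Z) (y := Z) (z := Y) le_rfl hZY
    (R.not_le_of_rank_lt (by omega))
  obtain ⟨b, b₁, b₂, b₃, b₄⟩ := R.atom (x := Z) (y := a) (z := Y) a₁ hZY
    (R.not_le_of_rank_lt (by omega))
  have sup_rank : ∀ {x y}, Z ≤ x → Z ≤ y → r x = r Z + 1 → r y = r Z + 1 → x ≠ y →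
      r (x ⊔ y) = k + 1 := by
    intro x y h₁ h₂ h₃ h₄ h₅
    have := R.mod x y
    rw [R.inf_eq h₁ h₂ h₃ h₄ h₅] at this
    omega
  have sup_eq : ∀ {x y B}, Z ≤ x → Z ≤ y → r x = r Z + 1 → r y = r Z + 1 → x ≠ y → r B = k + 1 →
      x ≤ B → y ≤ B → x ⊔ y = B := fun h₁ h₂ h₃ h₄ h₅ h₆ h₇ h₈ =>
    R.eq_of_le (sup_le h₇ h₈) (by rw [sup_rank h₁ h₂ h₃ h₄ h₅, h₆])
  have hab : a ≠ b := fun e => b₄ e.ge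
  have rab := sup_rank a₁ b₁ a₃ b₃ hab
  obtain ⟨c, c₁, c₂, c₃, c₄⟩ := R.atom (x := Z) (y := a ⊔ b) (z := Y) (a₁.trans le_sup_left) hZY
    (R.not_le_of_rank_lt (by omega))
  obtain ⟨t, t₁, t₂, t₃, t₄, t₅⟩ := R.third (x := Z) (z := a ⊔ b) a₁ le_sup_left b₁ le_sup_right
    (by omega) a₃ b₃
  have htc : t ≠ c := fun e => c₄ (e ▸ t₂)
  have rtc := sup_rank t₁ c₁ t₃ c₃ htc
  obtain ⟨d, d₁, d₂, d₃, d₄, d₅⟩ := R.third (x := Z) (z := t ⊔ c) t₁ le_sup_left c₁ le_sup_right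
    (by omega) t₃ c₃
  have hdc : ∀ {B}, r B = k + 1 → c ≤ B → d ≤ B → t ≤ B := fun hB hc hd => by
    rw [← sup_eq d₁ c₁ d₃ c₃ d₅ hB hd hc, sup_eq d₁ c₁ d₃ c₃ d₅ rtc d₂ le_sup_right]
    exact le_sup_left
  have habc : ∀ {B}, r B = k + 1 → a ≤ B → b ≤ B → c ≤ B → False := fun hB ha hb hc =>
    c₄ (sup_eq a₁ b₁ a₃ b₃ hab hB ha hb ▸ hc)
  have habd : ∀ {B}, r B = k + 1 → a ≤ B → b ≤ B → d ≤ B → False := fun hB ha hb hd => by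
    have e₁ := sup_eq a₁ b₁ a₃ b₃ hab hB ha hb
    have e₂ := sup_eq d₁ t₁ d₃ t₃ d₄ hB hd (e₁ ▸ t₂)
    have e₃ := sup_eq d₁ t₁ d₃ t₃ d₄ rtc d₂ le_sup_left
    exact habc hB ha hb (by rw [← e₂, e₃]; exact le_sup_right)
  have hacd : ∀ {B}, r B = k + 1 → a ≤ B → c ≤ B → d ≤ B → False := fun hB ha hc hd => by
    have e₂ := sup_eq t₁ a₁ t₃ a₃ t₄ hB (hdc hB hc hd) ha
    have e₃ := sup_eq t₁ a₁ t₃ a₃ t₄ rab t₂ le_sup_left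
    exact habc hB ha (by rw [← e₂, e₃]; exact le_sup_right) hc
  have hbcd : ∀ {B}, r B = k + 1 → b ≤ B → c ≤ B → d ≤ B → False := fun hB hb hc hd => by
    have e₂ := sup_eq t₁ b₁ t₃ b₃ t₅ hB (hdc hB hc hd) hb
    have e₃ := sup_eq t₁ b₁ t₃ b₃ t₅ rab t₂ le_sup_right
    exact habc hB (by rw [← e₂, e₃]; exact le_sup_left) hb hc
  have hac : a ≠ c := fun e => c₄ (e ▸ le_sup_left)
  have hbc : b ≠ c := fun e => c₄ (e ▸ le_sup_right)
  have had : a ≠ d := fun e => habd rab le_sup_left le_sup_right (e ▸ le_sup_left)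
  have hbd : b ≠ d := fun e => habd rab le_sup_left le_sup_right (e ▸ le_sup_right)
  refine ⟨![a, b, c, d], ?_, ?_, ?_⟩
  · have hcd : c ≠ d := d₅.symm
    clear * - hab hac hbc had hbd hcd
    intro i j
    fin_cases i <;> fin_cases j <;>
      simp [hab, hac, hbc, had, hbd, hcd, hab.symm, hac.symm, hbc.symm, had.symm, hbd.symm,
        hcd.symm]
  · have e : r Z + 1 = k := hZ
    intro i
    fin_cases i
    · exact ⟨a₃.trans e, a₁, a₂⟩
    · exact ⟨b₃.trans e, b₁, b₂⟩
    · exact ⟨c₃.trans e, c₁, c₂⟩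
    · exact ⟨d₃.trans e, d₁, d₂.trans (sup_le (t₂.trans (sup_le a₂ b₂)) c₂)⟩
  · intro B hB
    have f₁ := @habc B hB
    have f₂ := @habd B hB
    have f₃ := @hacd B hB
    have f₄ := @hbcd B hB
    clear * - f₁ f₂ f₃ f₄
    intro i j h
    fin_cases i <;> fin_cases j <;> fin_cases h <;> simp <;> tauto

theorem planeAxioms_star (R : IsProjRank r) {Z Y : α} (hZY : Z ≤ Y) (hZ : r Z + 1 = k)
    (hY : r Y = k + 2) : PlaneAxioms r k Z Y := by
  refine ⟨?_, ?_, ?_⟩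
  · intro U U' hU hU' h₁ _ h₂ _ hne
    have e := R.mod U U'
    rw [R.inf_eq h₁ h₂ (by omega) (by omega) hne] at e ⊢
    omega
  · intro H B H' B' hHB hHB' hH hB hH' hB' h₁ h₂ h₃ h₄
    obtain rfl := R.eq_of_le h₁ (by omega)
    obtain rfl := R.eq_of_le h₃ (by omega)
    have e₁ := R.mod B B'
    have e₂ := R.mono (sup_le h₂ h₄)
    obtain ⟨U, u₁, u₂, u₃, -⟩ := R.atom (x := Z) (y := Z) (z := B ⊓ B') le_rfl
      (le_inf hHB hHB') (R.not_le_of_rank_lt (by omega))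
    exact ⟨U, by omega, u₁, u₂.trans inf_le_left, u₁, u₂.trans inf_le_right⟩
  · obtain ⟨q, h₁, h₂, h₃⟩ := R.exists_quadrangle hZY hZ hY
    exact ⟨q, h₁, h₂, fun H B _ hB i j h g₁ g₂ g₃ g =>
      h₃ B hB i j h g₁ g₂ g₃ ⟨g.1.2, g.2.1.2, g.2.2.2⟩⟩

theorem planeAxioms_top (R : IsProjRank r) {Z Y : α} (hZY : Z ≤ Y) (hZ : r Z + 2 = k)
    (hY : r Y = k + 1) : PlaneAxioms r k Z Y := by
  have rk := R.le_top
  have hYt := rk Y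
  obtain ⟨h₁, h₂, q, h₃, h₄, h₅⟩ := R.dual.planeAxioms_star (k := r ⊤ - k)
    (Z := OrderDual.toDual Y) (Y := OrderDual.toDual Z) hZY
    (by simp only [corank, OrderDual.ofDual_toDual]; omega)
    (by simp only [corank, OrderDual.ofDual_toDual]; omega)
  refine ⟨?_, ?_, fun i => OrderDual.ofDual (q i), fun i j h => h₃ h, fun i => ?_, ?_⟩
  · intro U U' hU hU' g₁ g₂ g₃ g₄ hne
    have := (h₁ (OrderDual.toDual U) (OrderDual.toDual U') (by simp [corank, hU])
      (by simp [corank, hU']) g₂ g₁ g₄ g₃ hne).1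
    have e := R.mod U U'
    have e' := rk (U ⊔ U')
    simp only [corank, ofDual_inf, OrderDual.ofDual_toDual] at this
    omega
  · intro H B H' B' hHB hHB' hH hB hH' hB' g₁ g₂ g₃ g₄
    have e₁ := rk B
    have e₂ := rk B'
    obtain ⟨U, u₁, u₂, u₃, u₄, u₅⟩ := h₂ (OrderDual.toDual B) (OrderDual.toDual H)
      (OrderDual.toDual B') (OrderDual.toDual H') hHB hHB'
      (by simp only [corank, OrderDual.ofDual_toDual]; omega)
      (by simp only [corank, OrderDual.ofDual_toDual]; omega)
      (by simp only [corank, OrderDual.ofDual_toDual]; omega)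
      (by simp only [corank, OrderDual.ofDual_toDual]; omega) g₂ g₁ g₄ g₃
    have e₃ := rk (OrderDual.ofDual U)
    simp only [corank] at u₁
    exact ⟨OrderDual.ofDual U, by omega, u₃, u₂, u₅, u₄⟩
  · obtain ⟨e₁, e₂, e₃⟩ := h₄ i
    have e₄ := rk (OrderDual.ofDual (q i))
    simp only [corank] at e₁
    refine ⟨?_, e₃, e₂⟩
    change r (OrderDual.ofDual (q i)) = k
    omega
  · intro H B hH hB i j h g₁ g₂ g₃ ⟨e₁, e₂, e₃⟩
    have e₄ := rk B
    exact h₅ (OrderDual.toDual B) (OrderDual.toDual H)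
      (by simp only [corank, OrderDual.ofDual_toDual]; omega)
      (by simp only [corank, OrderDual.ofDual_toDual]; omega) i j h g₁ g₂ g₃
      ⟨e₁.symm, e₂.symm, e₃.symm⟩

end IsProjRank

end PlaneAxioms

/-! ### Closures and planes in point-line spaces -/

section Closure

variable {S : Type*} {ℒ : Set (Set S)} {P : Set S}

theorem isSubspace_cl (X : Set S) : IsSubspace ℒ (cl ℒ X) := fun l hl hn =>
  Set.subset_sInter fun _ hY => hY.1 l hl
    (hn.mono (Set.inter_subset_inter_right l (Set.sInter_subset_of_mem hY)))

theorem subset_cl (X : Set S) : X ⊆ cl ℒ X := Set.subset_sInter fun _ hY => hY.2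

theorem cl_subset {X Y : Set S} (hY : IsSubspace ℒ Y) (hXY : X ⊆ Y) : cl ℒ X ⊆ Y :=
  Set.sInter_subset_of_mem ⟨hY, hXY⟩

theorem cl_mono {X Y : Set S} (h : X ⊆ Y) : cl ℒ X ⊆ cl ℒ Y :=
  cl_subset (isSubspace_cl Y) (h.trans (subset_cl Y))

theorem cl_eq_line (hpl : ∀ l ∈ ℒ, ∀ l' ∈ ℒ, (l ∩ l').Nontrivial → l = l') {l X : Set S}
    (hl : l ∈ ℒ) (hXl : X ⊆ l) (hX : X.Nontrivial) : cl ℒ X = l :=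
  (cl_subset (fun l' hl' hn => (hpl l' hl' l hl hn).subset) hXl).antisymm
    (isSubspace_cl X l hl (hX.mono (Set.subset_inter hXl (subset_cl X))))

/-- A subspace containing two lines of a plane contains the plane. -/
theorem subset_of_isPlane {E Y l l' : Set S} (hE : IsPlane ℒ E) (hl : l ∈ ℒ) (hl' : l' ∈ ℒ)
    (hlE : l ⊆ E) (hlE' : l' ⊆ E) (hne : l ≠ l') (hn : l.Nontrivial) (hY : IsSubspace ℒ Y)
    (hlY : l ⊆ Y) (hlY' : l' ⊆ Y) : E ⊆ Y := by
  obtain ⟨⟨hsub, hstr⟩, -, hmeet, -⟩ := hE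
  intro p hp
  by_cases hpl : p ∈ l
  · exact hlY hpl
  obtain ⟨o, ⟨-, hol, hol'⟩, ho⟩ := hmeet l ⟨hl, hlE⟩ l' ⟨hl', hlE'⟩ hne
  obtain ⟨a, hal, hao⟩ := hn.exists_ne o
  have hal' : a ∉ l' := fun h => hao (ho a ⟨hlE hal, hal, h⟩)
  obtain ⟨g, hg, hpg, hag⟩ := hstr p hp a (hlE hal) fun e => hpl (e ▸ hal)
  have hgE : g ⊆ E := hsub g hg ⟨p, ⟨hpg, hp⟩, a, ⟨hag, hlE hal⟩, fun e => hpl (e ▸ hal)⟩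
  obtain ⟨b, ⟨-, hbg, hbl'⟩, -⟩ := hmeet g ⟨hg, hgE⟩ l' ⟨hl', hlE'⟩ fun e => hal' (e ▸ hag)
  exact hY g hg ⟨a, ⟨hag, hlY hal⟩, b, ⟨hbg, hlY' hbl'⟩, fun e => hal' (e ▸ hbl')⟩ hpg

/-- A plane is not contained in a line. -/
theorem not_subset_line_of_isPlane {E l : Set S} (hE : IsPlane ℒ E) (hl : l ∈ ℒ) : ¬ E ⊆ l := by
  obtain ⟨⟨hsub, -⟩, -, -, q, hq, hqE, hgen⟩ := hE
  intro h
  have hlE : l ⊆ E := hsub l hl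
    ⟨q 0, ⟨h (hqE 0), hqE 0⟩, q 1, ⟨h (hqE 1), hqE 1⟩, fun e => by simpa using hq e⟩
  exact hgen l ⟨hl, hlE⟩ 0 1 2 (by decide) (by decide) (by decide)
    ⟨h (hqE 0), h (hqE 1), h (hqE 2)⟩

/-- A line of the fragment in a plane of the fragment meets another line in this plane. -/
theorem exists_line_ne_of_isFragPlane (hpl : ∀ l ∈ ℒ, ∀ l' ∈ ℒ, (l ∩ l').Nontrivial → l = l')
    {E L : Set S} (hE : IsFragPlane ℒ P E) (hL : L ∈ fragLines ℒ P) (hLE : L ⊆ E) :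
    ∃ L' ∈ fragLines ℒ P, L' ≠ L ∧ L' ⊆ E ∧ ∃ U ∈ P, U ∈ L ∧ U ∈ L' := by
  obtain ⟨l, hl, rfl, hn⟩ := hL
  obtain ⟨hEP, hEs, hEc⟩ := hE
  obtain ⟨V, hVE, hVl⟩ : ∃ V ∈ E, V ∉ l := by
    by_contra! h
    exact not_subset_line_of_isPlane hEc hl
      (cl_subset (fun l' hl' hn' => (hpl l' hl' l hl hn').subset) h)
  obtain ⟨U, hU⟩ := hn.nonempty
  have hVU : V ≠ U := fun e => hVl (e ▸ hU.1)
  obtain ⟨g, hg, hVg, hUg⟩ := hEc.1.2 V (subset_cl E hVE) U (subset_cl E (hLE hU)) hVU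
  have hgL : g ∩ P ∈ fragLines ℒ P :=
    ⟨g, hg, rfl, V, ⟨hVg, hEP hVE⟩, U, ⟨hUg, hU.2⟩, hVU⟩
  exact ⟨g ∩ P, hgL, fun e => hVl ((e.subset ⟨hVg, hEP hVE⟩ : V ∈ l ∩ P).1),
    hEs _ hgL ⟨V, ⟨⟨hVg, hEP hVE⟩, hVE⟩, U, ⟨⟨hUg, hU.2⟩, hLE hU⟩, hVU⟩, U, hU.2, hU, hUg, hU.2⟩

theorem coplanar_self_iff (hpl : ∀ l ∈ ℒ, ∀ l' ∈ ℒ, (l ∩ l').Nontrivial → l = l')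
    (L : fragLines ℒ P) : Coplanar ℒ P L L ↔ ∃ L', L' ≠ L ∧ Coplanar ℒ P L L' := by
  constructor
  · rintro ⟨E, hE, hLE, -⟩
    obtain ⟨L', hL', hne, hLE', -⟩ := exists_line_ne_of_isFragPlane hpl hE L.2 hLE
    exact ⟨⟨L', hL'⟩, fun e => hne (congrArg Subtype.val e), E, hE, hLE, hLE'⟩
  · rintro ⟨L', -, E, hE, hLE, -⟩
    exact ⟨E, hE, hLE, hLE⟩

end Closure

/-! ### The lattice of subspaces of a vector space -/

section Subspaces

variable {K V : Type*} [DivisionRing K] [AddCommGroup V] [Module K V] [FiniteDimensional K V]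

theorem finrank_sup_span {X : Submodule K V} {v : V} (hv : v ∉ X) :
    Module.finrank K (X ⊔ K ∙ v : Submodule K V) = Module.finrank K X + 1 := by
  have h₀ : v ≠ 0 := fun e => hv (e ▸ X.zero_mem)
  have h := Submodule.finrank_sup_add_finrank_inf_eq X (K ∙ v)
  have hd : X ⊓ (K ∙ v) = ⊥ := (Submodule.disjoint_span_singleton' h₀).2 hv |>.eq_bot
  rw [hd, finrank_bot, finrank_span_singleton h₀] at h
  exact h

theorem isProjRank_finrank : IsProjRank (fun X : Submodule K V => Module.finrank K X) where
  bot := finrank_bot K V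
  lt h := Submodule.finrank_lt_finrank_of_lt h
  mod x y := Submodule.finrank_sup_add_finrank_inf_eq x y
  atom {x y z} hxy hxz hzy := by
    obtain ⟨v, hvz, hvy⟩ := SetLike.not_le_iff_exists.1 hzy
    exact ⟨x ⊔ K ∙ v, le_sup_left, sup_le hxz (by simpa using hvz),
      finrank_sup_span fun h => hvy (hxy h),
      fun h => hvy (h (Submodule.mem_sup_right (Submodule.mem_span_singleton_self v)))⟩
  coatom {x y z} hxz hyz hyx := by
    obtain ⟨v, hvy, hvx⟩ := SetLike.not_le_iff_exists.1 hyx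
    have hs : x ⊔ K ∙ v ≤ z := sup_le hxz (by simpa using hyz hvy)
    obtain ⟨c, hc⟩ := exists_isCompl (x ⊔ K ∙ v)
    have e₁ : (x ⊔ K ∙ v) ⊔ c ⊓ z = z := by
      rw [← sup_inf_assoc_of_le c hs, hc.sup_eq_top, top_inf_eq]
    have e₂ : (x ⊔ K ∙ v) ⊓ (c ⊓ z) = ⊥ := by rw [← inf_assoc, hc.inf_eq_bot, bot_inf_eq]
    have e₃ : x ⊓ (c ⊓ z) = ⊥ := eq_bot_iff.2 (e₂ ▸ inf_le_inf_right _ le_sup_left)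
    have f₁ := Submodule.finrank_sup_add_finrank_inf_eq (x ⊔ K ∙ v) (c ⊓ z)
    have f₂ := Submodule.finrank_sup_add_finrank_inf_eq x (c ⊓ z)
    rw [e₁, e₂, finrank_bot, finrank_sup_span hvx] at f₁
    rw [e₃, finrank_bot] at f₂
    refine ⟨x ⊔ c ⊓ z, le_sup_left, sup_le hxz inf_le_right, ?_, fun h => ?_⟩
    · omega
    · have hz : z ≤ x ⊔ c ⊓ z := by
        conv_lhs => rw [← e₁]
        exact sup_le (sup_le le_sup_left (by simpa using h hvy)) le_sup_right
      have := Submodule.finrank_mono hz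
      omega
  third {x z y₁ y₂} h₁ h₂ h₃ h₄ hz hy₁ hy₂ := by
    obtain ⟨v, hvz, hv₁, hv₂⟩ : ∃ v ∈ z, v ∉ y₁ ∧ v ∉ y₂ := by
      have hn : ∀ {y : Submodule K V}, Module.finrank K y = Module.finrank K x + 1 → ¬ z ≤ y :=
        fun hy h => by
          have := Submodule.finrank_mono h
          omega
      obtain ⟨a, haz, ha₁⟩ := SetLike.not_le_iff_exists.1 (hn hy₁)
      obtain ⟨b, hbz, hb₂⟩ := SetLike.not_le_iff_exists.1 (hn hy₂)
      by_cases ha₂ : a ∈ y₂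
      swap
      · exact ⟨a, haz, ha₁, ha₂⟩
      by_cases hb₁ : b ∈ y₁
      swap
      · exact ⟨b, hbz, hb₁, hb₂⟩
      exact ⟨a + b, z.add_mem haz hbz, fun h => ha₁ ((y₁.add_mem_iff_left hb₁).1 h),
        fun h => hb₂ ((y₂.add_mem_iff_right ha₂).1 h)⟩
    have hv : v ∈ x ⊔ K ∙ v := Submodule.mem_sup_right (Submodule.mem_span_singleton_self v)
    exact ⟨x ⊔ K ∙ v, le_sup_left, sup_le (h₁.trans h₂) (by simpa using hvz),
      finrank_sup_span fun h => hv₁ (h₁ h), fun e => hv₁ (e ▸ hv), fun e => hv₂ (e ▸ hv)⟩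

end Subspaces

/-! ### The lines of a spine space and their adjacency -/

section Lines

variable {K V : Type*} [DivisionRing K] [AddCommGroup V] [Module K V]
  {k m : ℕ} {W : Submodule K V}

/-- The `k`-dimensional subspaces between `H` and `B`. -/
def grassSeg (k : ℕ) (H B : Submodule K V) : Set (Grass K V k) := {U | H ≤ U.1 ∧ U.1 ≤ B}

variable (K V) in
/-- The dimension of subspaces as a rank function. -/
noncomputable abbrev dimRank : Submodule K V → ℕ := fun X => Module.finrank K X

theorem exists_seg_of_mem_spineLines {L : Set (Grass K V k)} (hL : L ∈ spineLines k m W) :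
    ∃ H B, IsLine (dimRank K V) W k m H B ∧ L = grassSeg k H B ∩ spinePoints k m W := by
  obtain ⟨_, ⟨H, B, h₁, h₂, h₃, rfl⟩, rfl, U, hU, T, hT, hne⟩ := hL
  exact ⟨H, B, ⟨h₃, h₁, h₂, U.1, T.1, fun e => hne (Subtype.ext e), ⟨U.2, hU.2⟩, ⟨T.2, hT.2⟩,
    hU.1.1, hU.1.2, hT.1.1, hT.1.2⟩, rfl⟩

theorem nontrivial_of_isLine {H B : Submodule K V} (h : IsLine (dimRank K V) W k m H B) :
    (grassSeg k H B ∩ spinePoints k m W).Nontrivial := by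
  obtain ⟨-, -, -, U, T, hne, ⟨h₁, h₂⟩, ⟨h₃, h₄⟩, h₅, h₆, h₇, h₈⟩ := h
  exact ⟨⟨U, h₁⟩, ⟨⟨h₅, h₆⟩, h₂⟩, ⟨T, h₃⟩, ⟨⟨h₇, h₈⟩, h₄⟩, fun e => hne (congrArg Subtype.val e)⟩

theorem seg_mem_grassLines {H B : Submodule K V} (h : IsLine (dimRank K V) W k m H B) :
    grassSeg k H B ∈ grassLines K V k :=
  ⟨H, B, h.2.1, h.2.2.1, h.1, rfl⟩

theorem seg_mem_spineLines {H B : Submodule K V} (h : IsLine (dimRank K V) W k m H B) :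
    grassSeg k H B ∩ spinePoints k m W ∈ spineLines k m W :=
  ⟨_, seg_mem_grassLines h, rfl, nontrivial_of_isLine h⟩

variable [FiniteDimensional K V]

theorem eq_of_nontrivial_inter_seg {H B H' B' : Submodule K V} (hH : Module.finrank K H + 1 = k)
    (hB : Module.finrank K B = k + 1) (hH' : Module.finrank K H' + 1 = k)
    (hB' : Module.finrank K B' = k + 1)
    (hn : (grassSeg k H B ∩ grassSeg k H' B').Nontrivial) : H = H' ∧ B = B' := by
  obtain ⟨U, ⟨hU, hU'⟩, T, ⟨hT, hT'⟩, hne⟩ := hn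
  have R := isProjRank_finrank (K := K) (V := V)
  have hne : U.1 ≠ T.1 := fun e => hne (Subtype.ext e)
  have e₁ := U.2
  have e₂ := T.2
  constructor
  · exact (R.inf_eq hU.1 hT.1 (by omega) (by omega) hne).symm.trans
      (R.inf_eq hU'.1 hT'.1 (by omega) (by omega) hne)
  · exact (R.sup_eq hU.2 hT.2 (by omega) (by omega) hne).symm.trans
      (R.sup_eq hU'.2 hT'.2 (by omega) (by omega) hne)

theorem eq_of_nontrivial_inter_grassLines : ∀ l ∈ grassLines K V k, ∀ l' ∈ grassLines K V k,
    (l ∩ l').Nontrivial → l = l' := by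
  rintro _ ⟨H, B, h₁, h₂, -, rfl⟩ _ ⟨H', B', h₁', h₂', -, rfl⟩ hn
  obtain ⟨rfl, rfl⟩ := eq_of_nontrivial_inter_seg h₁ h₂ h₁' h₂' hn
  rfl

theorem cl_seg {H B : Submodule K V} (h : IsLine (dimRank K V) W k m H B) :
    cl (grassLines K V k) (grassSeg k H B ∩ spinePoints k m W) = grassSeg k H B :=
  cl_eq_line eq_of_nontrivial_inter_grassLines (seg_mem_grassLines h) Set.inter_subset_left
    (nontrivial_of_isLine h)

theorem seg_subset_seg_iff {H B Z Y : Submodule K V} (hHB : H ≤ B)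
    (hH : Module.finrank K H + 1 = k) (hB : Module.finrank K B = k + 1) :
    grassSeg k H B ⊆ grassSeg k Z Y ↔ Z ≤ H ∧ B ≤ Y := by
  have R := isProjRank_finrank (K := K) (V := V)
  constructor
  swap
  · exact fun h U hU => ⟨h.1.trans hU.1, hU.2.trans h.2⟩
  intro h
  obtain ⟨p, p₁, p₂, p₃, -⟩ := R.atom (x := H) (y := H) (z := B) le_rfl hHB
    (R.not_le_of_rank_lt (by omega))
  obtain ⟨q, q₁, q₂, q₃, q₄⟩ := R.atom (x := H) (y := p) (z := B) p₁ hHB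
    (R.not_le_of_rank_lt (by omega))
  have hne : p ≠ q := fun e => q₄ e.ge
  have hp : (⟨p, by omega⟩ : Grass K V k) ∈ grassSeg k Z Y := h ⟨p₁, p₂⟩
  have hq : (⟨q, by omega⟩ : Grass K V k) ∈ grassSeg k Z Y := h ⟨q₁, q₂⟩
  rw [← R.inf_eq p₁ q₁ p₃ q₃ hne, ← R.sup_eq p₂ q₂ (by omega) (by omega) hne]
  exact ⟨le_inf hp.1 hq.1, sup_le hp.2 hq.2⟩

theorem isPlane_seg {Z Y : Submodule K V} (h : PlaneAxioms (dimRank K V) k Z Y) :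
    IsPlane (grassLines K V k) (grassSeg k Z Y) := by
  have R := isProjRank_finrank (K := K) (V := V)
  obtain ⟨hjoin, hmeet, q, hq, hqX, hgen⟩ := h
  have join : ∀ U ∈ grassSeg k Z Y, ∀ T ∈ grassSeg k Z Y, U ≠ T →
      ∃ l ∈ grassLines K V k, U ∈ l ∧ T ∈ l := by
    intro U hU T hT hne
    obtain ⟨h₁, h₂⟩ := hjoin U.1 T.1 U.2 T.2 hU.1 hU.2 hT.1 hT.2 fun e => hne (Subtype.ext e)
    exact ⟨_, ⟨U.1 ⊓ T.1, U.1 ⊔ T.1, h₁, h₂, inf_le_left.trans le_sup_left, rfl⟩,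
      ⟨inf_le_left, le_sup_left⟩, ⟨inf_le_right, le_sup_right⟩⟩
  have hsub : IsSubspace (grassLines K V k) (grassSeg k Z Y) := by
    rintro _ ⟨H, B, h₁, h₂, h₃, rfl⟩ ⟨U, ⟨hU, hUX⟩, T, ⟨hT, hTX⟩, hne⟩
    have hne : U.1 ≠ T.1 := fun e => hne (Subtype.ext e)
    have e₁ := U.2
    have e₂ := T.2
    refine (seg_subset_seg_iff h₃ h₁ h₂).2 ⟨?_, ?_⟩
    · rw [← R.inf_eq hU.1 hT.1 (by omega) (by omega) hne]
      exact le_inf hUX.1 hTX.1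
    · rw [← R.sup_eq hU.2 hT.2 (by omega) (by omega) hne]
      exact sup_le hUX.2 hTX.2
  refine ⟨⟨hsub, join⟩, ?_, ?_, fun i => ⟨q i, (hqX i).1⟩,
    fun i j e => hq (congrArg Subtype.val e), fun i => (hqX i).2, ?_⟩
  · intro U hU T hT hne
    obtain ⟨l, hl, hUl, hTl⟩ := join U hU T hT hne
    exact ⟨l, ⟨⟨hl, hsub l hl ⟨U, ⟨hUl, hU⟩, T, ⟨hTl, hT⟩, hne⟩⟩, hUl, hTl⟩,
      fun l' hl' => eq_of_nontrivial_inter_grassLines l' hl'.1.1 l hl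
        ⟨U, ⟨hl'.2.1, hUl⟩, T, ⟨hl'.2.2, hTl⟩, hne⟩⟩
  · intro l hl l' hl' hne
    have hl₀ := hl.1
    have hl₀' := hl'.1
    obtain ⟨⟨H, B, h₁, h₂, h₃, rfl⟩, hlX⟩ := hl
    obtain ⟨⟨H', B', h₁', h₂', h₃', rfl⟩, hlX'⟩ := hl'
    obtain ⟨g₁, g₂⟩ := (seg_subset_seg_iff h₃ h₁ h₂).1 hlX
    obtain ⟨g₁', g₂'⟩ := (seg_subset_seg_iff h₃' h₁' h₂').1 hlX'
    obtain ⟨U, u₁, u₂, u₃, u₄, u₅⟩ := hmeet H B H' B' h₃ h₃' h₁ h₂ h₁' h₂' g₁ g₂ g₁' g₂'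
    refine ⟨⟨U, u₁⟩, ⟨hlX ⟨u₂, u₃⟩, ⟨u₂, u₃⟩, ⟨u₄, u₅⟩⟩, fun T ⟨_, hT, hT'⟩ => ?_⟩
    by_contra hTU
    exact hne (eq_of_nontrivial_inter_grassLines _ hl₀ _ hl₀'
      ⟨T, ⟨hT, hT'⟩, ⟨U, u₁⟩, ⟨⟨u₂, u₃⟩, ⟨u₄, u₅⟩⟩, hTU⟩)
  · rintro _ ⟨⟨H, B, h₁, h₂, h₃, rfl⟩, -⟩ i j h hij hjh hih ⟨hi, hj, hh⟩
    exact hgen H B h₁ h₂ i j h hij hjh hih ⟨hi, hj, hh⟩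

/-- Two lines of a plane are in a common star or top and meet. -/
theorem eq_or_eq_of_isPlane {X : Set (Grass K V k)} {H B H' B' : Submodule K V}
    (hX : IsPlane (grassLines K V k) X) (h : IsLine (dimRank K V) W k m H B)
    (h' : IsLine (dimRank K V) W k m H' B') (hlX : grassSeg k H B ⊆ X)
    (hlX' : grassSeg k H' B' ⊆ X) (hne : ¬ (H = H' ∧ B = B')) :
    (H = H' ∨ B = B') ∧ ∃ U : Submodule K V, Module.finrank K U = k ∧ (H ≤ U ∧ U ≤ B) ∧
      (H' ≤ U ∧ U ≤ B') := by
  have R := isProjRank_finrank (K := K) (V := V)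
  obtain ⟨⟨-, hstr⟩, -, hmeet, -⟩ := hX
  have hsne : grassSeg k H B ≠ grassSeg k H' B' := fun e => hne <|
    eq_of_nontrivial_inter_seg h.2.1 h.2.2.1 h'.2.1 h'.2.2.1 <| by
      rw [← e, Set.inter_self]
      exact (nontrivial_of_isLine h).mono Set.inter_subset_left
  obtain ⟨U, ⟨-, hU, hU'⟩, -⟩ :=
    hmeet _ ⟨seg_mem_grassLines h, hlX⟩ _ ⟨seg_mem_grassLines h', hlX'⟩ hsne
  refine ⟨?_, U.1, U.2, hU, hU'⟩
  obtain ⟨T, hT, hTU⟩ := ((nontrivial_of_isLine h).mono Set.inter_subset_left).exists_ne U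
  obtain ⟨T', hT', hTU'⟩ := ((nontrivial_of_isLine h').mono Set.inter_subset_left).exists_ne U
  have hTT : T ≠ T' := by
    rintro rfl
    exact hne (eq_of_nontrivial_inter_seg h.2.1 h.2.2.1 h'.2.1 h'.2.2.1
      ⟨T, ⟨hT, hT'⟩, U, ⟨hU, hU'⟩, hTU⟩)
  obtain ⟨_, ⟨H₀, B₀, g₁, g₂, g₃, rfl⟩, g₄, g₅⟩ := hstr T (hlX hT) T' (hlX' hT') hTT
  have e := R.mono (le_inf g₄.1 g₅.1)
  exact R.eq_or_eq_of_adj h.2.1 h'.2.1 h.2.2.1 h'.2.2.1 U.2 T.2 T'.2 hU.1 hU.2 hU'.1 hU'.2 hT.1 hT.2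
    hT'.1 hT'.2 (fun e => hTU (Subtype.ext e)) (fun e => hTU' (Subtype.ext e)) (by omega)

/-- Two meeting lines in a common star or top are in a plane. -/
theorem exists_isFragPlane {H B H' B' U : Submodule K V} (h : IsLine (dimRank K V) W k m H B)
    (h' : IsLine (dimRank K V) W k m H' B') (hne : ¬ (H = H' ∧ B = B')) (he : H = H' ∨ B = B')
    (hU : Module.finrank K U = k) (h₁ : H ≤ U) (h₂ : U ≤ B) (h₃ : H' ≤ U) (h₄ : U ≤ B') :
    ∃ E, IsFragPlane (grassLines K V k) (spinePoints k m W) E ∧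
      grassSeg k H B ∩ spinePoints k m W ⊆ E ∧ grassSeg k H' B' ∩ spinePoints k m W ⊆ E := by
  have R := isProjRank_finrank (K := K) (V := V)
  obtain ⟨Z, Y, hX, z₁, y₁, z₂, y₂⟩ : ∃ Z Y, PlaneAxioms (dimRank K V) k Z Y ∧ Z ≤ H ∧ B ≤ Y ∧
      Z ≤ H' ∧ B' ≤ Y := by
    have a₁ : Module.finrank K H + 1 = k := h.2.1
    have a₂ : Module.finrank K B = k + 1 := h.2.2.1
    have a₃ : Module.finrank K H' + 1 = k := h'.2.1
    have a₄ : Module.finrank K B' = k + 1 := h'.2.2.1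
    rcases he with rfl | rfl
    · have e := R.mod B B'
      rw [R.inf_eq h₂ h₄ (by omega) (by omega) fun e => hne ⟨rfl, e⟩] at e
      exact ⟨H, B ⊔ B', R.planeAxioms_star (h.1.trans le_sup_left) a₁ (by omega), le_rfl,
        le_sup_left, le_rfl, le_sup_right⟩
    · have e := R.mod H H'
      rw [R.sup_eq h₁ h₃ (by omega) (by omega) fun e => hne ⟨e, rfl⟩] at e
      exact ⟨H ⊓ H', B, R.planeAxioms_top (inf_le_left.trans h.1) (by omega) a₂, inf_le_left,
        le_rfl, inf_le_right, le_rfl⟩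
  have hP := isPlane_seg hX
  have s₁ : grassSeg k H B ⊆ grassSeg k Z Y :=
    (seg_subset_seg_iff h.1 h.2.1 h.2.2.1).2 ⟨z₁, y₁⟩
  have s₂ : grassSeg k H' B' ⊆ grassSeg k Z Y :=
    (seg_subset_seg_iff h'.1 h'.2.1 h'.2.2.1).2 ⟨z₂, y₂⟩
  have t₁ : grassSeg k H B ∩ spinePoints k m W ⊆ grassSeg k Z Y ∩ spinePoints k m W :=
    Set.inter_subset_inter_left _ s₁
  have t₂ : grassSeg k H' B' ∩ spinePoints k m W ⊆ grassSeg k Z Y ∩ spinePoints k m W :=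
    Set.inter_subset_inter_left _ s₂
  refine ⟨grassSeg k Z Y ∩ spinePoints k m W, ⟨Set.inter_subset_right, ?_, ?_⟩, t₁, t₂⟩
  · rintro _ ⟨l, hl, rfl, -⟩ hn
    refine Set.inter_subset_inter_left _ (hP.1.1 l hl (hn.mono ?_))
    exact Set.inter_subset_inter Set.inter_subset_left Set.inter_subset_left
  · have hcl : cl (grassLines K V k) (grassSeg k Z Y ∩ spinePoints k m W) = grassSeg k Z Y := by
      refine (cl_subset hP.1.1 Set.inter_subset_left).antisymm ?_
      refine subset_of_isPlane hP (seg_mem_grassLines h) (seg_mem_grassLines h') s₁ s₂ ?_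
        ((nontrivial_of_isLine h).mono Set.inter_subset_left) (isSubspace_cl _)
        (cl_seg h ▸ cl_mono t₁) (cl_seg h' ▸ cl_mono t₂)
      exact fun e => hne <| eq_of_nontrivial_inter_seg h.2.1 h.2.2.1 h'.2.1 h'.2.2.1 <| by
        rw [← e, Set.inter_self]
        exact (nontrivial_of_isLine h).mono Set.inter_subset_left
    rw [hcl]
    exact hP

/-- A line is related to itself if and only if it is related to another line; so the diagonal
of the adjacency is definable from the rest. -/
theorem spineRho_self_iff (L : spineLines k m W) :
    spineRho k m W L L ↔ ∃ L', L' ≠ L ∧ spineRho k m W L L' := by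
  constructor
  · rintro ⟨_, ⟨U₀, E, hE, -, -, rfl⟩, hL, -⟩
    obtain ⟨H, B, hl, hLs⟩ := exists_seg_of_mem_spineLines L.2
    obtain ⟨l, hl, hLl, hn⟩ := L.2
    -- The proper points of the closure of `E` form a plane of the spine space containing `L`.
    have hE' : IsFragPlane (grassLines K V k) (spinePoints k m W)
        (cl (grassLines K V k) E ∩ spinePoints k m W) := by
      have hcl : cl (grassLines K V k) (cl (grassLines K V k) E ∩ spinePoints k m W) =
          cl (grassLines K V k) E :=
        (cl_subset (isSubspace_cl E) Set.inter_subset_left).antisymm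
          (cl_mono (Set.subset_inter (subset_cl E) hE.1))
      refine ⟨Set.inter_subset_right, ?_, by rw [hcl]; exact hE.2.2⟩
      rintro _ ⟨g, hg, rfl, -⟩ hn
      exact Set.inter_subset_inter_left _ (isSubspace_cl E g hg (hn.mono
        (Set.inter_subset_inter Set.inter_subset_left Set.inter_subset_left)))
    have hLE : (L : Set (Grass K V k)) ⊆ cl (grassLines K V k) E ∩ spinePoints k m W :=
      Set.subset_inter ((subset_cl _).trans hL.2.2) (hLs.trans_subset Set.inter_subset_right)
    obtain ⟨L', hL', hne, hLE', U, hU, hUL, hUL'⟩ :=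
      exists_line_ne_of_isFragPlane eq_of_nontrivial_inter_grassLines hE' L.2 hLE
    exact ⟨⟨L', hL'⟩, fun e => hne (congrArg Subtype.val e), _,
      ⟨U, _, hE', hU, cl_mono hLE (subset_cl _ hUL), rfl⟩,
      ⟨L.2, subset_cl _ hUL, cl_mono hLE⟩, ⟨hL', subset_cl _ hUL', cl_mono hLE'⟩⟩
  · rintro ⟨L', -, p, hp, hL, -⟩
    exact ⟨p, hp, hL, hL⟩

/-- Points and lines of a spine space in terms of the lattice of subspaces. -/
theorem exists_pointGeom_lineGeom (h : IsSpine (dimRank K V) W k m) :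
    ∃ lo hi : spineLines k m W → Submodule K V,
      PointGeom (dimRank K V) W k m (fun s : spinePoints k m W => s.1.1) lo hi (spineInc k m W) ∧
      LineGeom (dimRank K V) W k m (fun U => Module.finrank K U = k) lo hi (spinePi k m W) ∧
      LineGeom (dimRank K V) W k m (Proper (dimRank K V) W k m) lo hi (spineRho k m W) := by
  choose lo hi hline hseg using fun L : spineLines k m W => exists_seg_of_mem_spineLines L.2
  have hext : ∀ {L L'}, lo L = lo L' → hi L = hi L' → L = L' := fun {L L'} h₁ h₂ =>
    Subtype.ext (by rw [hseg L, hseg L', h₁, h₂])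
  have hex : ∀ {H B}, IsLine (dimRank K V) W k m H B → ∃ L, lo L = H ∧ hi L = B := by
    intro H B hl
    let L : spineLines k m W := ⟨_, seg_mem_spineLines hl⟩
    have e : grassSeg k H B ∩ spinePoints k m W = _ := hseg L
    refine ⟨L, eq_of_nontrivial_inter_seg (hline L).2.1 (hline L).2.2.1 hl.2.1 hl.2.2.1
      ((nontrivial_of_isLine hl).mono (Set.subset_inter ?_ Set.inter_subset_left))⟩
    exact e.trans_subset Set.inter_subset_left
  have hne' : ∀ {L L'}, L ≠ L' → ¬ (lo L = lo L' ∧ hi L = hi L') := fun hne e =>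
    hne (hext e.1 e.2)
  have hcl : ∀ L : spineLines k m W, cl (grassLines K V k) (L : Set (Grass K V k)) =
      grassSeg k (lo L) (hi L) := fun L => by
    rw [hseg L]
    exact cl_seg (hline L)
  refine ⟨lo, hi, ⟨fun s t e => Subtype.ext (Subtype.ext e), fun s => ⟨s.1.2, s.2⟩,
    fun {U} hU => ⟨⟨⟨U, hU.1⟩, hU.2⟩, rfl⟩, fun s L => ?_⟩, ⟨h, hline, hex, hext, ?_, id,
      fun hU => hU.1, fun _ _ hV => hV⟩, ⟨h, hline, hex, hext, ?_, fun hU => hU.1, id,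
      fun hU hU' => absurd hU hU'⟩⟩
  · change s.1 ∈ (L : Set (Grass K V k)) ↔ _
    rw [hseg L]
    exact and_iff_left s.2
  · intro L L' hne
    constructor
    · rintro ⟨E, hE, hLE, hLE'⟩
      exact eq_or_eq_of_isPlane hE.2.2 (hline L) (hline L') (hcl L ▸ cl_mono hLE)
        (hcl L' ▸ cl_mono hLE') (hne' hne)
    · rintro ⟨he, U, hU, hUL, hUL'⟩
      obtain ⟨E, hE, hLE, hLE'⟩ := exists_isFragPlane (hline L) (hline L') (hne' hne) he hU hUL.1
        hUL.2 hUL'.1 hUL'.2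
      exact ⟨E, hE, hseg L ▸ hLE, hseg L' ▸ hLE'⟩
  · intro L L' hne
    constructor
    · rintro ⟨_, ⟨U, E, hE, hU, -, rfl⟩, ⟨-, hUL, hLE⟩, ⟨-, hUL', hLE'⟩⟩
      rw [hcl] at hUL hLE hUL' hLE'
      exact ⟨(eq_or_eq_of_isPlane hE.2.2 (hline L) (hline L') hLE hLE' (hne' hne)).1, U.1,
        ⟨U.2, hU⟩, hUL, hUL'⟩
    · rintro ⟨he, U, hU, hUL, hUL'⟩
      obtain ⟨E, hE, hLE, hLE'⟩ := exists_isFragPlane (hline L) (hline L') (hne' hne) he hU.1 hUL.1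
        hUL.2 hUL'.1 hUL'.2
      rw [← hseg] at hLE hLE'
      have hUL : (⟨U, hU.1⟩ : Grass K V k) ∈ cl (grassLines K V k) (L : Set (Grass K V k)) := by
        rw [hcl]; exact hUL
      have hUL' : (⟨U, hU.1⟩ : Grass K V k) ∈ cl (grassLines K V k) (L' : Set (Grass K V k)) := by
        rw [hcl]; exact hUL'
      exact ⟨_, ⟨_, E, hE, hU.2, cl_mono hLE hUL, rfl⟩, ⟨L.2, hUL, cl_mono hLE⟩,
        ⟨L'.2, hUL', cl_mono hLE'⟩⟩

/-- Each of the two adjacencies determines the spine space if `k` or `dim W` is at least `m + 2`,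
if `U = W` is the only point, or if the points form a projective space of dimension at least `4`. -/
theorem definitionallyEquivalent_spinePi_spineRho (hS : IsSpine (dimRank K V) W k m)
    (h : m + 2 ≤ k ∨ m + 2 ≤ Module.finrank K W ∨
      Module.finrank K W = m ∧ (k = m ∨ k = m + 1 ∧ k + 4 ≤ Module.finrank K V)) :
    DefinitionallyEquivalent (spineInc k m W) (spinePi k m W) ∧
      DefinitionallyEquivalent (spineInc k m W) (spineRho k m W) := by
  obtain ⟨lo, hi, hp, hπ, hρ⟩ := exists_pointGeom_lineGeom hS
  have key : ∀ (Q : Submodule K V → Prop) (δ : spineLines k m W → spineLines k m W → Prop),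
      LineGeom (dimRank K V) W k m Q lo hi δ →
      ((∀ U, Q U → Proper (dimRank K V) W k m U) ∨
        ∀ U : Submodule K V, Module.finrank K U = k → Q U) →
      (∀ l, δ l l ↔ ∃ l', l' ≠ l ∧ δ l l') → DefinitionallyEquivalent (spineInc k m W) δ := by
    intro Q δ hl hQ hδ
    rcases h with hk | hw | ⟨hW, hk | ⟨hk, hn⟩⟩
    · exact hp.definitionallyEquivalent_of_le hl hQ hδ hk
    · exact hp.definitionallyEquivalent_of_le' hl hQ hδ hw
    · exact hp.definitionallyEquivalent_of_eq hl hQ hδ hW hk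
    · exact hp.definitionallyEquivalent_of_projective hl hQ hδ hW hk
        (hn.trans (finrank_top K V).ge)
  exact ⟨key _ _ hπ (.inr fun _ hU => hU)
      (coplanar_self_iff eq_of_nontrivial_inter_grassLines),
    key _ _ hρ (.inl fun _ hU => hU) spineRho_self_iff⟩

end Lines

end SpineSpace

theorem mainTheorem1 {K V : Type*} [DivisionRing K] [AddCommGroup V] [Module K V]
    [FiniteDimensional K V] (n k m w : ℕ) (W : Submodule K V)
    (hn : Module.finrank K V = n) (hw : Module.finrank K W = w)
    (hk : 1 < k) (hkn : k < n - 1)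
    (hm : k ≤ m + (n - w)) (hmk : m ≤ k) (hmw : m ≤ w)
    (h4 : (4 ≤ n - k ∧ w ≠ m + 1) ∨ (4 ≤ k - m ∧ k ≠ m + 1)) :
    SpineSpace.DefinitionallyEquivalent (SpineSpace.spineInc k m W) (SpineSpace.spinePi k m W) ∧
    SpineSpace.DefinitionallyEquivalent (SpineSpace.spineInc k m W) (SpineSpace.spineRho k m W) := by
  have hwn := Submodule.finrank_le W
  have hS : SpineSpace.IsSpine (SpineSpace.dimRank K V) W k m := by
    refine ⟨SpineSpace.isProjRank_finrank, hk, ?_, hmk, ?_, ?_⟩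
    · change k + 1 < Module.finrank K (⊤ : Submodule K V)
      rw [finrank_top]
      omega
    · change m ≤ Module.finrank K W
      omega
    · change k + Module.finrank K W ≤ Module.finrank K (⊤ : Submodule K V) + m
      rw [finrank_top]
      omega
  exact SpineSpace.definitionallyEquivalent_spinePi_spineRho hS (by omega)
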